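/- **Setting.** Let $\mathcal X\subset\mathbb R^{d_x}$, $\mathcal A\subset\mathbb R^{d_a}$ be finite, $r:\mathcal X\times\mathcal A\to[-1,1]$, $p(x'|x,a)$ transition probabilities, $\rho_0$ a probability distribution on $\mathcal X\times\mathcal A$ with state marginal $\rho_0(x)$, $\gamma\in(0,1)$, and $\tilde p(x'|x,a)=\gamma p(x'|x,a)+(1-\gamma)\rho_0(x')$. For a policy $f(x,a)$ (a distribution over actions for each state) let $\mathbb P^f_{(x,a),(x',a')}=p(x'|x,a)f(x',a')$ and $\Pi^f_{(x,a),(x',a')}=\tilde p(x'|x,a)f(x',a')$. Assume that for every policy $f$ with $f>0$ both chains are ergodic (irreducible and aperiodic), let $\pi^f$ and $\sigma^f_{\rho_0}$ be their stationary distributions, and assume that for some $L>0$, $\max\{d_{TV}(\pi^f,\pi^{f'}),d_{TV}(\sigma_{\rho_0}^f,\sigma_{\rho_0}^{f'})\}\le L\,d_{TV}(f,f')$ for all policies $f,f'>0$, where $d_{TV}(q,q')=\frac12\sum_{(x,a)}|q(x,a)-q'(x,a)|$. Let $\beta\in(\frac12,1)$, $\alpha>0$, and let $\sigma\in C^3(\mathbb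 R)$ be bounded with bounded first three derivatives. Put $\alpha^N=\alpha N^{2\beta-2}$, $\zeta^N_k=N^{2\beta-2}/(1+\frac kN)$, $\eta_t=1/(1+\log^2(1+t))$, $\zeta_t=1/(1+t)$, $\eta^N_k=\eta_{k/N}$. Initially $C_0^i,W_0^i,B_0^i,U_0^i$ ($1\le i\le N$) are independent, with laws not depending on $i$ and $N$; $C_0^i,B_0^i$ are real, bounded, with mean zero; $W_0^i,U_0^i$ are $\mathbb R^{d_x+d_a}$-valued with finite first moment. Let $v_0$, $\mu_0$ be the laws of $(C_0^i,W_0^i)$, $(B_0^i,U_0^i)$. Writing $\xi=(x,a)$, put $$Q^N_k(\xi)=N^{-\beta}\sum_{i=1}^N C^i_k\sigma(W^i_k\cdot\xi),\quad P^N_k(\xi)=N^{-\beta}\sum_{i=1}^N B^i_k\sigma(U^i_k\cdot\xi),\quad f^N_k(x,a)=\frac{e^{P^N_k(x,a)}}{\sum_{a'}e^{P^N_k(x,a')}},\quad g^N_k=\frac{\eta^N_k}{|\mathcal A|}+(1-\eta^N_k)f^N_k .$$ The sample paths $\xi_k=(x_k,a_k)$ and $\tilde\xi_k=(\tilde x_k,\tilde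 a_k)$ start from $\rho_0$; given the past up to step $k$, $\xi_{k+1}$ has law $\mathbb P^{g_k^N}_{\xi_k,\cdot}$ and $\tilde\xi_{k+1}$ has law $\Pi^{g_k^N}_{\tilde\xi_k,\cdot}$. With $D_k=r(\xi_k)+\gamma Q^N_k(\xi_{k+1})-Q^N_k(\xi_k)$ the parameters are updated by $$C^i_{k+1}=C^i_k+\tfrac{\alpha^N}{N^\beta}D_k\,\sigma(W^i_k\cdot\xi_k),\qquad W^i_{k+1}=W^i_k+\tfrac{\alpha^N}{N^\beta}D_k\,C^i_k\sigma'(W^i_k\cdot\xi_k)\,\xi_k,$$ $$B^i_{k+1}=B^i_k+\tfrac{\zeta^N_k}{N^\beta}Q^N_k(\tilde\xi_k)\Big(\sigma(U^i_k\cdot\tilde\xi_k)-\sum_{a'}f^N_k(\tilde x_k,a')\sigma(U^i_k\cdot(\tilde x_k,a'))\Big),$$ $$U^i_{k+1}=U^i_k+\tfrac{\zeta^N_k}{N^\beta}Q^N_k(\tilde\xi_k)\Big(B^i_k\sigma'(U^i_k\cdot\tilde\xi_k)\,\tilde\xi_k-\sum_{a'}f^N_k(\tilde x_k,a')B^i_k\sigma'(U^i_k\cdot(\tilde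 x_k,a'))\,(\tilde x_k,a')\Big).$$ Let $f_t^N=f^N_{\lfloor Nt\rfloor}$ and $g_t^N=g^N_{\lfloor Nt\rfloor}$. **Limit.** Let $\langle B_{\xi,\xi'},\nu\rangle=\int\big(\sigma(w\cdot\xi)\sigma(w\cdot\xi')+c^2\sigma'(w\cdot\xi)\sigma'(w\cdot\xi')\,\xi\cdot\xi'\big)\,\nu(dc,dw)$. The limits $Q^{(0)},P^{(0)}$ are continuous on $[0,T]$ and satisfy there $$Q_t^{(0)}(\xi)=\alpha\int_0^t\sum_{\xi',(x'',a'')}\big(r(\xi')+\gamma Q^{(0)}_s(x'',a'')-Q^{(0)}_s(\xi')\big)\langle B_{\xi,\xi'},v_0\rangle\,\pi^{g^{(0)}_s}(\xi')\,g_s^{(0)}(x'',a'')\,p(x''|\xi')\,ds,$$ $$P_t^{(0)}(\xi)=\int_0^t\sum_{x',a',a''}\zeta_s Q^{(0)}_s(x',a')\big(\langle B_{\xi,(x',a')},\mu_0\rangle-\langle B_{\xi,(x',a'')},\mu_0\rangle\big)f_s^{(0)}(x',a'')\,\sigma_{\rho_0}^{g^{(0)}_s}(x',a')\,ds,$$ where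 $f^{(0)}_t(x,a)=e^{P^{(0)}_t(x,a)}/\sum_{a'}e^{P^{(0)}_t(x,a')}$ and $g^{(0)}_t=\frac{\eta_t}{|\mathcal A|}+(1-\eta_t)f^{(0)}_t$. **Proposition.** Let $0<T<\infty$. Such $Q^{(0)},P^{(0)}$ exist, and for any such pair the following holds. Let $\delta^N_t$ be any of $f^N_t$, $g^N_t$, $\pi^{g^N_t}$, $\sigma_{\rho_0}^{g^N_t}$ and let $\delta^{(0)}_t$ be correspondingly $f^{(0)}_t$, $g^{(0)}_t$, $\pi^{g^{(0)}_t}$, $\sigma_{\rho_0}^{g^{(0)}_t}$. For every integer $p\ge1$, $\delta^N_t$ converges to $\delta^{(0)}_t$ in $L_p$ uniformly on $[0,T]$, i.e. $\sup_{t\in[0,T]}\mathbb E[\max_{(x,a)}|\delta_t^N(x,a)-\delta_t^{(0)}(x,a)|^p]\to0$ as $N\to\infty$, and there are constants $C_{T,p},N_{T,p}$ independent of $N$ such that for all $N>N_{T,p}$ $$\sup_{t\in[0,T]}\mathbb E\Big[\max_{(x,a)\in\mathcal X\times\mathcal A}\big|\delta_t^N(x,a)-\delta_t^{(0)}(x,a)\big|^p\Big]\le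 C_{T,p}\Big[N^{p(\beta-1)}+N^{p(\frac12-\beta)}\Big].$$ -/

import Mathlib

open MeasureTheory Filter Topology

noncomputable section

namespace ActorCritic

/-! ### Markov decision processes -/

/-- A finite Markov decision process with states in `ℝ^dx` and actions in `ℝ^da`, rewards in
`[-1, 1]`, transition probabilities `p (x, a) y = p(y | x, a)`, an initial distribution on the
state-action pairs, and a discount factor. -/
structure MDP (dx da : ℕ) where
  X : Finset (EuclideanSpace ℝ (Fin dx))
  A : Finset (EuclideanSpace ℝ (Fin da))
  r : X × A → ℝ
  p : X × A → X → ℝ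
  rho : X × A → ℝ
  gam : ℝ
  r_mem : ∀ s, r s ∈ Set.Icc (-1 : ℝ) 1
  p_nonneg : ∀ s y, 0 ≤ p s y
  p_sum : ∀ s, ∑ y, p s y = 1
  rho_nonneg : ∀ s, 0 ≤ rho s
  rho_sum : ∑ s, rho s = 1
  gam_pos : 0 < gam
  gam_lt_one : gam < 1

/-- The concatenated input space `ℝ^(dx + da)` of the networks. -/
abbrev Feat (dx da : ℕ) := EuclideanSpace ℝ (Fin (dx + da))

/-- The parameters `(C^i, W^i)`, or `(B^i, U^i)`, `i = 1, …, N`, of a shallow network. -/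
abbrev Params (dx da N : ℕ) := Fin N → ℝ × Feat dx da

/-- Total variation distance of two functions on the same finite domain. -/
def dTV {D : Type*} [Fintype D] (q q' : D → ℝ) : ℝ := 1 / 2 * ∑ s, |q s - q' s|

/-- `q` is a stationary distribution of the transition matrix `P`. -/
def IsStationary {D : Type*} [Fintype D] (P : Matrix D D ℝ) (q : D → ℝ) : Prop :=
  (∀ s, 0 ≤ q s) ∧ ∑ s, q s = 1 ∧ Matrix.vecMul q P = q

/-- The stationary distribution of `P` (meaningful when there is exactly one). -/
def stationary {D : Type*} [Fintype D] (P : Matrix D D ℝ) : D → ℝ :=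
  Classical.epsilon (IsStationary P)

namespace MDP

variable {dx da : ℕ} (M : MDP dx da)

/-- The state-action pairs. -/
abbrev S : Type := M.X × M.A

/-- The state-action pair `(x, a)` as a vector of `ℝ^(dx + da)`. -/
def feat (s : M.S) : Feat dx da :=
  WithLp.toLp 2 (Fin.append (fun i => (s.1 : EuclideanSpace ℝ (Fin dx)) i)
    (fun j => (s.2 : EuclideanSpace ℝ (Fin da)) j))

/-- The auxiliary transition probabilities `γ p(y | x, a) + (1 - γ) ρ₀(y)`, where `ρ₀(y)` is the
state marginal of `ρ₀`. -/
def pAux (s : M.S) (y : M.X) : ℝ := M.gam * M.p s y + (1 - M.gam) * ∑ a : M.A, M.rho (y, a)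

/-- A policy that chooses every action with positive probability in every state. -/
def IsPositivePolicy (f : M.S → ℝ) : Prop :=
  (∀ s, 0 < f s) ∧ ∀ x : M.X, ∑ a : M.A, f (x, a) = 1

/-- Transition matrix of the state-action chain that draws the next state from the probabilities
`q` and then the action from the policy `f`. -/
def trans (q : M.S → M.X → ℝ) (f : M.S → ℝ) : Matrix M.S M.S ℝ :=
  Matrix.of fun s s' => q s s'.1 * f s'

/-- The stationary distribution `π^f` of the chain `(M, f)`. -/
def statPi (f : M.S → ℝ) : M.S → ℝ := stationary (M.trans M.p f)

/-- The stationary distribution `σ_{ρ₀}^f` of the auxiliary chain `(M, f)_aux`. -/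
def statSigma (f : M.S → ℝ) : M.S → ℝ := stationary (M.trans M.pAux f)

open Classical in
/-- Both chains are ergodic (irreducible and aperiodic, i.e. some power of the transition matrix
has only positive entries) for every policy that gives positive probability to all actions. -/
def Ergodic : Prop :=
  ∀ f, M.IsPositivePolicy f → (M.trans M.p f).IsPrimitive ∧ (M.trans M.pAux f).IsPrimitive

/-- Lipschitz continuity of the stationary distributions in total variation. -/
def StationaryLipschitz : Prop :=
  ∃ L : ℝ, 0 < L ∧ ∀ f f', M.IsPositivePolicy f → M.IsPositivePolicy f' →
    max (dTV (M.statPi f) (M.statPi f')) (dTV (M.statSigma f) (M.statSigma f')) ≤ L * dTV f f'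

/-- Softmax over the actions. -/
def softmax (P : M.S → ℝ) (s : M.S) : ℝ :=
  Real.exp (P s) / ∑ a : M.A, Real.exp (P (s.1, a))

/-- Mixture of the policy `f` with the uniform policy, with exploration rate `e`. -/
def explore (e : ℝ) (f : M.S → ℝ) (s : M.S) : ℝ :=
  e / (Fintype.card M.A : ℝ) + (1 - e) * f s

end MDP

/-! ### Networks, hyperparameters and initialization -/

/-- The scaling `β`, the learning rate constant `α`, the activation function (in `C_b^3`), and the
laws at initialization of `C^i`, `W^i` (critic) and `B^i`, `U^i` (actor). -/
structure Model (dx da : ℕ) where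
  bet : ℝ
  alp : ℝ
  act : ℝ → ℝ
  lawC : Measure ℝ
  lawW : Measure (Feat dx da)
  lawB : Measure ℝ
  lawU : Measure (Feat dx da)
  bet_mem : bet ∈ Set.Ioo (1 / 2 : ℝ) 1
  alp_pos : 0 < alp
  act_contDiff : ContDiff ℝ 3 act
  act_bdd : ∃ K : ℝ, ∀ j ≤ 3, ∀ x, |iteratedDeriv j act x| ≤ K
  probC : IsProbabilityMeasure lawC
  probW : IsProbabilityMeasure lawW
  probB : IsProbabilityMeasure lawB
  probU : IsProbabilityMeasure lawU
  bddC : ∃ K : ℝ, ∀ᵐ c ∂lawC, |c| ≤ K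
  bddB : ∃ K : ℝ, ∀ᵐ b ∂lawB, |b| ≤ K
  meanC : ∫ c, c ∂lawC = 0
  meanB : ∫ b, b ∂lawB = 0
  momentW : Integrable (fun w => ‖w‖) lawW
  momentU : Integrable (fun u => ‖u‖) lawU

namespace Model

variable {dx da : ℕ} (m : Model dx da)

/-- Law of a pair `(C^i, W^i)` at initialization. -/
def nu : Measure (ℝ × Feat dx da) := m.lawC.prod m.lawW

/-- Law of a pair `(B^i, U^i)` at initialization. -/
def mu : Measure (ℝ × Feat dx da) := m.lawB.prod m.lawU

/-- Learning rate `α^N` of the critic. -/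
def rateCritic (N : ℕ) : ℝ := m.alp / (N : ℝ) ^ (2 - 2 * m.bet)

/-- Learning rate `ζ_k^N` of the actor. -/
def rateActor (N k : ℕ) : ℝ := 1 / ((N : ℝ) ^ (2 - 2 * m.bet) * (1 + (k : ℝ) / N))

/-- Output of the shallow network with parameters `th` and scaling `N^(-β)` at the input `z`. -/
def net {N : ℕ} (th : Params dx da N) (z : Feat dx da) : ℝ :=
  1 / (N : ℝ) ^ m.bet * ∑ i, (th i).1 * m.act (inner ℝ (th i).2 z)

end Model

/-- Exploration rate in rescaled time: `η_t`; also `η_k^N` is its value at `t = k / N`. -/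
def eta (t : ℝ) : ℝ := 1 / (1 + Real.log (1 + t) ^ 2)

/-- Limit of the rescaled learning rate of the actor. -/
def zeta (t : ℝ) : ℝ := 1 / (1 + t)

section Training

variable {dx da : ℕ} (M : MDP dx da) (m : Model dx da)

/-- The actor network, or the critic network, as a function of the state-action pair. -/
def netOn {N : ℕ} (th : Params dx da N) (s : M.S) : ℝ := m.net th (M.feat s)

/-- The actor model: softmax of the actor network. -/
def actorModel {N : ℕ} (th : Params dx da N) : M.S → ℝ := M.softmax (netOn M m th)

/-- One update of the critic parameters `om` along the transition from `s` to `s'`. -/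
def criticStep {N : ℕ} (om : Params dx da N) (s s' : M.S) : Params dx da N := fun i =>
  let c := m.rateCritic N / (N : ℝ) ^ m.bet *
    (M.r s + M.gam * netOn M m om s' - netOn M m om s)
  ((om i).1 + c * m.act (inner ℝ (om i).2 (M.feat s)),
   (om i).2 + (c * ((om i).1 * deriv m.act (inner ℝ (om i).2 (M.feat s)))) • M.feat s)

/-- The `k`-th update of the actor parameters `th`, at the sample `s`, with critic parameters
`om`. -/
def actorStep {N : ℕ} (k : ℕ) (om th : Params dx da N) (s : M.S) : Params dx da N := fun i =>
  let c := m.rateActor N k / (N : ℝ) ^ m.bet * netOn M m om s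
  ((th i).1 + c * (m.act (inner ℝ (th i).2 (M.feat s)) -
      ∑ a : M.A, actorModel M m th (s.1, a) * m.act (inner ℝ (th i).2 (M.feat (s.1, a)))),
   (th i).2 + c • (((th i).1 * deriv m.act (inner ℝ (th i).2 (M.feat s))) • M.feat s -
      ∑ a : M.A, (actorModel M m th (s.1, a) *
        ((th i).1 * deriv m.act (inner ℝ (th i).2 (M.feat (s.1, a))))) • M.feat (s.1, a)))

/-- Critic and actor parameters `(ω_k, θ_k)` after `k` updates, from their initial values and
the sample paths `xi` (critic process) and `xt` (actor process). -/
def trained {N : ℕ} (init : Params dx da N × Params dx da N) (xi xt : ℕ → M.S) :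
    ℕ → Params dx da N × Params dx da N
  | 0 => init
  | k + 1 =>
    let q := trained init xi xt k
    (criticStep M m q.1 (xi k) (xi (k + 1)), actorStep M m k q.1 q.2 (xt k))

/-- The exploration policy `g_k^N` for actor parameters `th`. -/
def explorePolicy {N : ℕ} (k : ℕ) (th : Params dx da N) : M.S → ℝ :=
  M.explore (eta ((k : ℝ) / N)) (actorModel M m th)

/-- A run of the online actor-critic algorithm with `N` hidden units on a probability space:
the initial critic and actor parameters are independent with the prescribed laws, and, given the
past, the next samples of the critic and of the actor process are drawn by means of `p`,
respectively the auxiliary transition probabilities, followed by the current exploration policy. -/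
structure Run (N : ℕ) {Ω : Type*} [mΩ : MeasurableSpace Ω] (ℙ : Measure Ω) where
  F : Filtration ℕ mΩ
  init : Ω → Params dx da N × Params dx da N
  xi : ℕ → Ω → M.S
  xt : ℕ → Ω → M.S
  init_meas : Measurable[F 0] init
  xi_meas : ∀ k, Measurable[F k] (xi k)
  xt_meas : ∀ k, Measurable[F k] (xt k)
  init_law : ℙ.map init =
    (Measure.pi fun _ : Fin N => m.nu).prod (Measure.pi fun _ : Fin N => m.mu)
  xi_law : ∀ s, ℙ.real {ω | xi 0 ω = s} = M.rho s
  xt_law : ∀ s, ℙ.real {ω | xt 0 ω = s} = M.rho s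
  xi_step : ∀ k s, ℙ[Set.indicator {ω | xi (k + 1) ω = s} (fun _ => (1 : ℝ)) | F k] =ᵐ[ℙ]
    fun ω => M.trans M.p (explorePolicy M m k
      (trained M m (init ω) (fun j => xi j ω) (fun j => xt j ω) k).2) (xi k ω) s
  xt_step : ∀ k s, ℙ[Set.indicator {ω | xt (k + 1) ω = s} (fun _ => (1 : ℝ)) | F k] =ᵐ[ℙ]
    fun ω => M.trans M.pAux (explorePolicy M m k
      (trained M m (init ω) (fun j => xi j ω) (fun j => xt j ω) k).2) (xt k ω) s

namespace Run

variable {M m} {N : ℕ} {Ω : Type*} [MeasurableSpace Ω] {ℙ : Measure Ω} (R : Run M m N ℙ)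

/-- The actor parameters after `⌊N t⌋` updates. -/
def theta (t : ℝ) (ω : Ω) : Params dx da N :=
  (trained M m (R.init ω) (fun j => R.xi j ω) (fun j => R.xt j ω) ⌊(N : ℝ) * t⌋₊).2

/-- The time-rescaled actor model `f_t^N`. -/
def fN (t : ℝ) (ω : Ω) : M.S → ℝ := actorModel M m (R.theta t ω)

/-- The time-rescaled exploration policy `g_t^N`. -/
def gN (t : ℝ) (ω : Ω) : M.S → ℝ := explorePolicy M m ⌊(N : ℝ) * t⌋₊ (R.theta t ω)

end Run

/-! ### The limit -/

/-- The pairing `⟨B_{s,s'}, ν⟩` of the kernel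
`B_{s,s'}(c, w) = σ(w·s) σ(w·s') + c² σ'(w·s) σ'(w·s') (s·s')` with `ν`. -/
def kerB (ν : Measure (ℝ × Feat dx da)) (s s' : M.S) : ℝ :=
  ∫ z, (m.act (inner ℝ z.2 (M.feat s)) * m.act (inner ℝ z.2 (M.feat s')) +
    z.1 ^ 2 * deriv m.act (inner ℝ z.2 (M.feat s)) * deriv m.act (inner ℝ z.2 (M.feat s')) *
      inner ℝ (M.feat s) (M.feat s')) ∂ν

/-- The limit exploration policy `g_t` for the limit actor network `P`. -/
def gLim (P : ℝ → M.S → ℝ) (t : ℝ) : M.S → ℝ := M.explore (eta t) (M.softmax (P t))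

/-- `(Q, P)` is continuous on `[0, T]` and satisfies the limit integral equations there
(in particular both vanish at time `0`). -/
structure IsLimit (T : ℝ) (Q P : ℝ → M.S → ℝ) : Prop where
  contQ : ContinuousOn Q (Set.Icc 0 T)
  contP : ContinuousOn P (Set.Icc 0 T)
  eqQ : ∀ t ∈ Set.Icc 0 T, ∀ s, Q t s = m.alp * ∫ u in (0 : ℝ)..t, ∑ s' : M.S, ∑ s'' : M.S,
    (M.r s' + M.gam * Q u s'' - Q u s') * kerB M m m.nu s s' *
      M.statPi (gLim M P u) s' * gLim M P u s'' * M.p s' s''.1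
  eqP : ∀ t ∈ Set.Icc 0 T, ∀ s, P t s = ∫ u in (0 : ℝ)..t, ∑ s' : M.S, ∑ a'' : M.A,
    zeta u * Q u s' * (kerB M m m.mu s s' - kerB M m m.mu s (s'.1, a'')) *
      M.softmax (P u) (s'.1, a'') * M.statSigma (gLim M P u) s'

end Training

/-! ### Errors -/

/-- `sup_{t ∈ [0,T]} 𝔼[max_e |Y_t(e) - y_t(e)|^p] ≤ b`, with the expectations finite. -/
def ErrorLE {E : Type*} [Fintype E] {Ω : Type*} [MeasurableSpace Ω] (ℙ : Measure Ω)
    (T : ℝ) (p : ℕ) (Y : ℝ → Ω → E → ℝ) (y : ℝ → E → ℝ) (b : ℝ) : Prop :=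
  ∀ t ∈ Set.Icc 0 T,
    Integrable (fun ω => ⨆ e, |Y t ω e - y t e| ^ p) ℙ ∧
      ∫ ω, (⨆ e, |Y t ω e - y t e| ^ p) ∂ℙ ≤ b

/-- The `p`-th order errors of `f_t^N`, `g_t^N` and of the two stationary distributions for the
policy `g_t^N` are at most `b` on `[0, T]`, where `P` is the limit actor network. -/
def Run.AllErrorsLE {dx da : ℕ} {M : MDP dx da} {m : Model dx da} {N : ℕ} {Ω : Type*}
    [MeasurableSpace Ω] {ℙ : Measure Ω} (R : Run M m N ℙ) (P : ℝ → M.S → ℝ)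
    (T : ℝ) (p : ℕ) (b : ℝ) : Prop :=
  ErrorLE ℙ T p R.fN (fun t => M.softmax (P t)) b ∧
  ErrorLE ℙ T p R.gN (gLim M P) b ∧
  ErrorLE ℙ T p (fun t ω => M.statPi (R.gN t ω)) (fun t => M.statPi (gLim M P t)) b ∧
  ErrorLE ℙ T p (fun t ω => M.statSigma (R.gN t ω)) (fun t => M.statSigma (gLim M P t)) b

end ActorCritic

end

noncomputable section

namespace ActorCritic

/-! Write `e = N ^ (bet - 1)`. With the rates inserted, both updates are gradient steps of a shallow
network with step size of order `e / N`. In `N * T` steps the parameters move only by `O(e)`, so the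
empirical kernel of each network stays within `O(e)` of its initial value, which is close to `kerB`
because the units are independent. The prefactor `N ^ (-bet)` equals `1 / (N * e)`, hence one step
changes the outputs by `1 / N` times an explicit function of the current networks and samples, up to
`O((e + E) / N)` with `E` the initial deviation of the kernels (`gradStep_linearization`,
`exists_gradPath_bound`, `exists_path_bound`). The critic must be bounded up to time `T` for this;
that holds on every path on which the initial outer weights are bounded and the initial critic is at
most `1` (`exists_critic_bound`).

What remains is a stochastic approximation with step `1 / N`, driven by two Markov chains whose
transition law varies slowly. The solution of the Poisson equation turns the difference between a
sample and its stationary mean into a martingale difference plus a telescoping term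
(`exists_averaging`). This solution has to be bounded and Lipschitz in the parameters, and here
exploration matters: up to time `T` every policy gives each action probability at least `eta T /
|A|`. Such policies form a compact set, on which the fundamental matrix exists by primitivity, is
bounded by continuity, and is Lipschitz by the resolvent identity and the assumed Lipschitz
dependence of the stationary distributions (`GoodKernel.fundInv_inv_bddLip`).

The stationary means are the right-hand sides of the limit equations. Comparison with Riemann sums
along the limit and a discrete Gronwall inequality bound the distance to the limit, path by path, by
`e`, the initial error and the martingale averages (`exists_pathwise`).

Only two random quantities are left. The initial outputs are `N ^ (-bet)` times sums of `N`
independent, bounded, centered terms, hence of order `N ^ (1 / 2 - bet)`. The deviations of the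
initial kernels and the martingale averages are of order `N ^ (-1 / 2)`, which is smaller since `bet
< 1`. All their moments come from exponential moments (`integral_exp_sum_martIncr_le`,
`integral_exp_sum_iid_le`). On paths with initial error above `1` the comparison is not available,
but there the distance capped at `1` is trivially below the initial error (`exists_network_bound`).
The capped distance suffices, because the four quantities of interest are bounded Lipschitz
functions of time and of the actor network (`exists_errorLE`).

The limit equations are solved by Picard iteration after truncating the critic at a level that a
Gronwall estimate shows is never exceeded (`exists_isLimit`). -/

/-- `f` is bounded and Lipschitz continuous on `D`. -/
def BddLip {X : Type*} [PseudoMetricSpace X] (D : Set X) (f : X → ℝ) : Prop :=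
  ∃ K : ℝ, 0 ≤ K ∧ (∀ x ∈ D, |f x| ≤ K) ∧ ∀ x ∈ D, ∀ y ∈ D, |f x - f y| ≤ K * dist x y

/-! ### Calculus of bounded Lipschitz functions -/

namespace BddLip

variable {X : Type*} [PseudoMetricSpace X] {D : Set X} {f g : X → ℝ}

/-- Allows different constants for the bound and the slope; the maximum with `0` keeps the common
constant nonnegative even if `D` is empty. -/
theorem mk' {K L : ℝ} (hK : ∀ x ∈ D, |f x| ≤ K)
    (hL : ∀ x ∈ D, ∀ y ∈ D, |f x - f y| ≤ L * dist x y) : BddLip D f :=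
  ⟨max 0 (max K L), le_max_left _ _,
    fun x hx => (hK x hx).trans ((le_max_left _ _).trans (le_max_right _ _)),
    fun x hx y hy => (hL x hx y hy).trans (mul_le_mul_of_nonneg_right
      ((le_max_right _ _).trans (le_max_right _ _)) dist_nonneg)⟩

theorem const (c : ℝ) : BddLip D fun _ => c :=
  ⟨|c|, abs_nonneg _, fun _ _ => le_rfl, fun x _ y _ => by
    simpa using mul_nonneg (abs_nonneg c) (dist_nonneg (x := x) (y := y))⟩

theorem add (hf : BddLip D f) (hg : BddLip D g) : BddLip D fun x => f x + g x := by
  obtain ⟨K, -, h1, h2⟩ := hf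
  obtain ⟨L, -, h3, h4⟩ := hg
  refine mk' (K := K + L) (L := K + L)
    (fun x hx => (abs_add_le _ _).trans (add_le_add (h1 x hx) (h3 x hx))) fun x hx y hy => ?_
  have e : f x + g x - (f y + g y) = (f x - f y) + (g x - g y) := by ring
  rw [e, add_mul]
  exact (abs_add_le _ _).trans (add_le_add (h2 x hx y hy) (h4 x hx y hy))

theorem mul (hf : BddLip D f) (hg : BddLip D g) : BddLip D fun x => f x * g x := by
  obtain ⟨K, hK, h1, h2⟩ := hf
  obtain ⟨L, hL, h3, h4⟩ := hg
  refine mk' (K := K * L) (L := K * L + K * L) (fun x hx => ?_) fun x hx y hy => ?_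
  · rw [abs_mul]
    exact mul_le_mul (h1 x hx) (h3 x hx) (abs_nonneg _) hK
  · have e : f x * g x - f y * g y = f x * (g x - g y) + (f x - f y) * g y := by ring
    rw [e]
    refine (abs_add_le _ _).trans ?_
    rw [abs_mul, abs_mul, add_mul]
    refine add_le_add ?_ ?_
    · rw [mul_assoc]
      exact mul_le_mul (h1 x hx) (h4 x hx y hy) (abs_nonneg _) hK
    · calc |f x - f y| * |g y| ≤ (K * dist x y) * L :=
            mul_le_mul (h2 x hx y hy) (h3 y hy) (abs_nonneg _) (mul_nonneg hK dist_nonneg)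
        _ = K * L * dist x y := by ring

theorem neg (hf : BddLip D f) : BddLip D fun x => -f x := by
  simpa using (const (D := D) (-1)).mul hf

theorem sub (hf : BddLip D f) (hg : BddLip D g) : BddLip D fun x => f x - g x := by
  simpa [sub_eq_add_neg] using hf.add hg.neg

theorem sum {ι : Type*} (s : Finset ι) {f : ι → X → ℝ} (hf : ∀ i, BddLip D (f i)) :
    BddLip D fun x => ∑ i ∈ s, f i x := by
  classical
  induction s using Finset.induction_on with
  | empty => simpa using const (D := D) 0
  | insert i s hi ih => simpa [Finset.sum_insert hi] using (hf i).add ih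

theorem mono {D' : Set X} (hf : BddLip D f) (h : D' ⊆ D) : BddLip D' f := by
  obtain ⟨K, hK, h1, h2⟩ := hf
  exact ⟨K, hK, fun x hx => h1 x (h hx), fun x hx y hy => h2 x (h hx) y (h hy)⟩

theorem congr (hf : BddLip D f) (h : ∀ x ∈ D, g x = f x) : BddLip D g := by
  obtain ⟨K, hK, h1, h2⟩ := hf
  refine ⟨K, hK, fun x hx => ?_, fun x hx y hy => ?_⟩
  · rw [h x hx]; exact h1 x hx
  · rw [h x hx, h y hy]; exact h2 x hx y hy

theorem comp_lipschitz {Y : Type*} [PseudoMetricSpace Y] {E : Set Y} {φ : Y → X} {L : ℝ}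
    (hf : BddLip D f) (hm : ∀ y ∈ E, φ y ∈ D)
    (hφ : ∀ x ∈ E, ∀ y ∈ E, dist (φ x) (φ y) ≤ L * dist x y) : BddLip E fun y => f (φ y) := by
  obtain ⟨K, hK, h1, h2⟩ := hf
  refine mk' (K := K) (L := K * L) (fun y hy => h1 _ (hm y hy)) fun x hx y hy => ?_
  rw [mul_assoc]
  exact (h2 _ (hm x hx) _ (hm y hy)).trans (mul_le_mul_of_nonneg_left (hφ x hx y hy) hK)

theorem lipschitz_pi {ι : Type*} [Fintype ι] {φ : X → ι → ℝ} (hφ : ∀ i, BddLip D fun y => φ y i) :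
    ∃ L : ℝ, 0 ≤ L ∧ ∀ x ∈ D, ∀ y ∈ D, dist (φ x) (φ y) ≤ L * dist x y := by
  choose K hK _ h2 using hφ
  have hs : 0 ≤ ∑ i, K i := Finset.sum_nonneg fun i _ => hK i
  refine ⟨∑ i, K i, hs, fun x hx y hy => ?_⟩
  rw [dist_pi_le_iff (mul_nonneg hs dist_nonneg)]
  intro i
  rw [Real.dist_eq]
  exact (h2 i x hx y hy).trans (mul_le_mul_of_nonneg_right
    (Finset.single_le_sum (f := K) (fun i _ => hK i) (Finset.mem_univ i)) dist_nonneg)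

/-- Serves to insert a policy depending on time and networks into functions that are controlled only
on a set of policies. -/
theorem comp_pi {ι : Type*} [Fintype ι] {E : Set (ι → ℝ)} {F : (ι → ℝ) → ℝ} (hF : BddLip E F)
    {φ : X → ι → ℝ} (hm : ∀ x ∈ D, φ x ∈ E) (hφ : ∀ i, BddLip D fun y => φ y i) :
    BddLip D fun x => F (φ x) := by
  obtain ⟨L, -, h⟩ := lipschitz_pi hφ
  exact hF.comp_lipschitz hm h

theorem continuousOn (hf : BddLip D f) : ContinuousOn f D := by
  obtain ⟨K, hK, -, h2⟩ := hf
  have : LipschitzOnWith ⟨K, hK⟩ f D := LipschitzOnWith.of_dist_le_mul fun x hx y hy => by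
    rw [Real.dist_eq]; exact h2 x hx y hy
  exact this.continuousOn

end BddLip

/-- A family of bounded Lipschitz functions indexed by a finite type has common constants. -/
theorem BddLip.uniform {X ι : Type*} [PseudoMetricSpace X] [Finite ι] {D : Set X}
    {f : ι → X → ℝ} (hf : ∀ i, BddLip D (f i)) :
    ∃ K : ℝ, 0 ≤ K ∧ (∀ i, ∀ x ∈ D, |f i x| ≤ K) ∧
      ∀ i, ∀ x ∈ D, ∀ y ∈ D, |f i x - f i y| ≤ K * dist x y := by
  cases nonempty_fintype ι
  choose K hK h1 h2 using hf
  have h : ∀ i, K i ≤ ∑ j, K j := fun i =>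
    Finset.single_le_sum (f := K) (fun i _ => hK i) (Finset.mem_univ i)
  exact ⟨∑ i, K i, Finset.sum_nonneg fun i _ => hK i, fun i x hx => (h1 i x hx).trans (h i),
    fun i x hx y hy => (h2 i x hx y hy).trans (mul_le_mul_of_nonneg_right (h i) dist_nonneg)⟩

/-! ### Elementary functions -/

/-- Truncation to `[-R, R]`. -/
def clamp (R x : ℝ) : ℝ := max (-R) (min R x)

theorem clamp_abs_le {R : ℝ} (hR : 0 ≤ R) (x : ℝ) : |clamp R x| ≤ R := by
  unfold clamp
  rw [abs_le]
  exact ⟨le_max_left _ _, max_le (by linarith) (min_le_left _ _)⟩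

theorem clamp_abs_le_abs {R : ℝ} (hR : 0 ≤ R) (x : ℝ) : |clamp R x| ≤ |x| := by
  unfold clamp
  rcases abs_cases x with ⟨h, h'⟩ | ⟨h, h'⟩ <;> rw [h, abs_le] <;> constructor
  · exact le_max_of_le_right (le_min (by linarith) (by linarith))
  · exact max_le (by linarith) (min_le_right _ _)
  · exact le_max_of_le_right (le_min (by linarith) (by linarith))
  · exact max_le (by linarith) ((min_le_right _ _).trans (by linarith))

theorem clamp_eq {R x : ℝ} (h : |x| ≤ R) : clamp R x = x := by
  unfold clamp
  rw [min_eq_right (abs_le.1 h).2, max_eq_right (abs_le.1 h).1]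

theorem clamp_lipschitz (R x y : ℝ) : |clamp R x - clamp R y| ≤ |x - y| := by
  unfold clamp
  have h1 := abs_max_sub_max_le_max (-R) (min R x) (-R) (min R y)
  have h2 := abs_min_sub_min_le_max R x R y
  simp only [sub_self, abs_zero, abs_nonneg, sup_of_le_right] at h1 h2
  exact h1.trans h2

theorem eta_pos (t : ℝ) : 0 < eta t := by unfold eta; positivity

theorem eta_le_one (t : ℝ) : eta t ≤ 1 := by
  unfold eta
  rw [div_le_one (by positivity)]
  nlinarith [sq_nonneg (Real.log (1 + t))]

/-- `eta` is the composition of `x ↦ 1 / (1 + x ^ 2)` with `t ↦ log (1 + t)`, and both are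
1-Lipschitz, the second one for `t ≥ 0`. -/
theorem eta_lipschitz {t u : ℝ} (ht : 0 ≤ t) (hu : 0 ≤ u) : |eta t - eta u| ≤ |t - u| := by
  have key : ∀ x y : ℝ, |1 / (1 + x ^ 2) - 1 / (1 + y ^ 2)| ≤ |x - y| := by
    intro x y
    have hx : 0 < 1 + x ^ 2 := by positivity
    have hy : 0 < 1 + y ^ 2 := by positivity
    rw [div_sub_div _ _ hx.ne' hy.ne', abs_div, abs_of_pos (mul_pos hx hy),
      div_le_iff₀ (mul_pos hx hy)]
    have e : 1 * (1 + y ^ 2) - (1 + x ^ 2) * 1 = -((x - y) * (x + y)) := by ring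
    rw [e, abs_neg, abs_mul]
    refine mul_le_mul_of_nonneg_left ?_ (abs_nonneg _)
    rw [abs_le]
    constructor <;> nlinarith [sq_nonneg (x - 1), sq_nonneg (y - 1), sq_nonneg (x + 1),
      sq_nonneg (y + 1), sq_nonneg (x * y), sq_nonneg x, sq_nonneg y]
  have hlog : ∀ a b : ℝ, 0 ≤ a → a ≤ b → Real.log (1 + b) - Real.log (1 + a) ≤ b - a := by
    intro a b ha hab
    rw [← Real.log_div (by linarith) (by linarith)]
    refine (Real.log_le_sub_one_of_pos (div_pos (by linarith) (by linarith))).trans ?_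
    rw [div_sub_one (by linarith), div_le_iff₀ (by linarith)]
    nlinarith
  refine (key _ _).trans ?_
  rcases le_total t u with h | h
  · rw [abs_sub_comm, abs_sub_comm t u, abs_of_nonneg (sub_nonneg.2 h),
      abs_of_nonneg (sub_nonneg.2 (Real.log_le_log (by linarith) (by linarith)))]
    exact hlog t u ht h
  · rw [abs_of_nonneg (sub_nonneg.2 h),
      abs_of_nonneg (sub_nonneg.2 (Real.log_le_log (by linarith) (by linarith)))]
    exact hlog u t hu h

theorem eta_anti {t u : ℝ} (ht : 0 ≤ t) (h : t ≤ u) : eta u ≤ eta t := by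
  unfold eta
  have h1 : 0 ≤ Real.log (1 + t) := Real.log_nonneg (by linarith)
  have h2 : Real.log (1 + t) ≤ Real.log (1 + u) := Real.log_le_log (by linarith) (by linarith)
  gcongr

theorem zeta_abs_le_one {t : ℝ} (ht : 0 ≤ t) : |zeta t| ≤ 1 := by
  unfold zeta
  rw [abs_of_nonneg (by positivity), div_le_one (by linarith)]
  linarith

theorem zeta_lipschitz {t u : ℝ} (ht : 0 ≤ t) (hu : 0 ≤ u) : |zeta t - zeta u| ≤ |t - u| := by
  unfold zeta
  rw [div_sub_div _ _ (by linarith) (by linarith), abs_div,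
    abs_of_pos (a := (1 + t) * (1 + u)) (by positivity), div_le_iff₀ (by positivity)]
  have e : 1 * (1 + u) - (1 + t) * 1 = -(t - u) := by ring
  rw [e, abs_neg]
  exact le_mul_of_one_le_right (abs_nonneg _) (by nlinarith)

/-! ### Policies -/

namespace MDP

variable {dx da : ℕ} (M : MDP dx da)

theorem nonempty_S : Nonempty M.S := by
  by_contra h
  rw [not_nonempty_iff] at h
  simpa using M.rho_sum

theorem nonempty_A : Nonempty M.A := M.nonempty_S.map Prod.snd

variable {M}

theorem sum_exp_pos (P : M.S → ℝ) (x : M.X) : 0 < ∑ a : M.A, Real.exp (P (x, a)) := by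
  have := M.nonempty_A
  exact Finset.sum_pos (fun a _ => Real.exp_pos _) Finset.univ_nonempty

theorem softmax_pos (P : M.S → ℝ) (s : M.S) : 0 < M.softmax P s :=
  div_pos (Real.exp_pos _) (sum_exp_pos P s.1)

theorem softmax_sum (P : M.S → ℝ) (x : M.X) : ∑ a : M.A, M.softmax P (x, a) = 1 := by
  change ∑ a : M.A, Real.exp (P (x, a)) / ∑ a' : M.A, Real.exp (P (x, a')) = 1
  rw [← Finset.sum_div, div_self (sum_exp_pos P x).ne']

theorem softmax_le_one (P : M.S → ℝ) (s : M.S) : M.softmax P s ≤ 1 := by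
  rw [← softmax_sum P s.1]
  exact Finset.single_le_sum (f := fun a => M.softmax P (s.1, a))
    (fun a _ => (softmax_pos P _).le) (Finset.mem_univ s.2)

/-- The estimate is multiplicative at first: moving `P` by `δ` changes numerator and denominator by
factors in `[exp (-δ), exp δ]` each, so the quotient loses at most a factor `exp (-2δ) ≥ 1 - 2δ`.
Since softmax is at most `1`, this yields the additive bound. -/
theorem softmax_lipschitz (P P' : M.S → ℝ) (s : M.S) :
    |M.softmax P s - M.softmax P' s| ≤ 2 * dist P P' := by
  have key : ∀ P P' : M.S → ℝ, M.softmax P s - M.softmax P' s ≤ 2 * dist P P' := by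
    intro P P'
    set δ := dist P P' with hδ
    have hd : ∀ s, |P s - P' s| ≤ δ := fun s => by
      rw [← Real.dist_eq]; exact dist_le_pi_dist P P' s
    have h1 : M.softmax P s * Real.exp (-(2 * δ)) ≤ M.softmax P' s := by
      unfold softmax
      rw [div_mul_eq_mul_div, div_le_div_iff₀ (sum_exp_pos P s.1) (sum_exp_pos P' s.1),
        Finset.mul_sum, Finset.mul_sum]
      refine Finset.sum_le_sum fun a _ => ?_
      rw [← Real.exp_add, ← Real.exp_add, ← Real.exp_add, Real.exp_le_exp]
      have := abs_le.1 (hd s)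
      have := abs_le.1 (hd (s.1, a))
      linarith
    have h2 : 1 - 2 * δ ≤ Real.exp (-(2 * δ)) := by
      linarith [Real.add_one_le_exp (-(2 * δ))]
    have h3 := mul_le_mul_of_nonneg_left h2 (softmax_pos P s).le
    have h4 := mul_le_mul_of_nonneg_right (softmax_le_one P s)
      (mul_nonneg zero_le_two (dist_nonneg (x := P) (y := P')))
    nlinarith
  rw [abs_le]
  have h := key P' P
  rw [dist_comm] at h
  exact ⟨by linarith, key P P'⟩

/-- The policies that choose every action with probability at least `c`. -/
def policies (M : MDP dx da) (c : ℝ) : Set (M.S → ℝ) :=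
  {f | (∀ s, c ≤ f s) ∧ ∀ x : M.X, ∑ a : M.A, f (x, a) = 1}

theorem IsPositivePolicy.of_mem {c : ℝ} (hc : 0 < c) {f : M.S → ℝ} (hf : f ∈ M.policies c) :
    M.IsPositivePolicy f :=
  ⟨fun s => hc.trans_le (hf.1 s), hf.2⟩

theorem IsPositivePolicy.le_one {f : M.S → ℝ} (hf : M.IsPositivePolicy f) (s : M.S) : f s ≤ 1 := by
  rw [← hf.2 s.1]
  exact Finset.single_le_sum (f := fun a => f (s.1, a)) (fun a _ => (hf.1 _).le)
    (Finset.mem_univ s.2)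

/-- The uniform part of the mixture alone gives the lower bound. A separate `e0` lets one bound
serve a whole range of exploration rates. -/
theorem explore_mem_policies {e e0 : ℝ} (he : e0 ≤ e) (he1 : e ≤ 1) {f : M.S → ℝ}
    (hf : M.IsPositivePolicy f) :
    M.explore e f ∈ M.policies (e0 / (Fintype.card M.A : ℝ)) := by
  have := M.nonempty_A
  refine ⟨fun s => ?_, fun x => ?_⟩
  · unfold explore
    have := mul_nonneg (sub_nonneg.2 he1) (hf.1 s).le
    have : e0 / (Fintype.card M.A : ℝ) ≤ e / (Fintype.card M.A : ℝ) := by gcongr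
    linarith
  · unfold explore
    rw [Finset.sum_add_distrib, ← Finset.mul_sum, hf.2 x, Finset.sum_const, Finset.card_univ,
      nsmul_eq_mul, mul_div_cancel₀ _ (Nat.cast_ne_zero.2 Fintype.card_ne_zero)]
    ring

theorem softmax_isPositivePolicy (P : M.S → ℝ) : M.IsPositivePolicy (M.softmax P) :=
  ⟨softmax_pos P, softmax_sum P⟩

theorem card_A_pos : 0 < (Fintype.card M.A : ℝ) := by
  have := M.nonempty_A
  exact Nat.cast_pos.2 Fintype.card_pos

theorem explore_softmax_isPositivePolicy (t : ℝ) (P : M.S → ℝ) :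
    M.IsPositivePolicy (M.explore (eta t) (M.softmax P)) :=
  IsPositivePolicy.of_mem (div_pos (eta_pos t) card_A_pos)
    (explore_mem_policies le_rfl (eta_le_one t) (softmax_isPositivePolicy P))

end MDP

/-! ### Finite Markov chains -/

section Stochastic

variable {D : Type*} [Fintype D]

/-- The constant vector is in the right kernel of `1 - P`, so there is a nonzero left kernel vector
`v`. Its entrywise absolute value, normalized, is stationary. Irreducibility plays no role. -/
theorem exists_isStationary [Nonempty D] {P : Matrix D D ℝ} (h0 : ∀ s s', 0 ≤ P s s')
    (h1 : ∀ s, ∑ s', P s s' = 1) : ∃ q, IsStationary P q := by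
  classical
  have hdet : (1 - P).det = 0 := by
    rw [← Matrix.exists_mulVec_eq_zero_iff]
    refine ⟨fun _ => 1, fun h => one_ne_zero (congrFun h (Classical.arbitrary D)), ?_⟩
    ext s
    rw [Matrix.sub_mulVec, Matrix.one_mulVec]
    simp [Matrix.mulVec, dotProduct, h1]
  obtain ⟨v, hv0, hv⟩ := Matrix.exists_vecMul_eq_zero_iff.2 hdet
  rw [Matrix.vecMul_sub, Matrix.vecMul_one, sub_eq_zero] at hv
  have hv' : ∀ s, v s = ∑ t, v t * P t s := fun s => congrFun hv s
  have hle : ∀ s ∈ Finset.univ, |v s| ≤ ∑ t, |v t| * P t s := fun s _ => by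
    conv_lhs => rw [hv' s]
    refine (Finset.abs_sum_le_sum_abs _ _).trans (Finset.sum_le_sum fun t _ => ?_)
    rw [abs_mul, abs_of_nonneg (h0 t s)]
  have hsum : ∑ s, |v s| = ∑ s, ∑ t, |v t| * P t s := by
    rw [Finset.sum_comm]
    simp_rw [← Finset.mul_sum, h1, mul_one]
  -- The triangle inequality gives `|v| ≤ |v| P` entrywise, and the row sums give equal totals, so
  -- equality holds in every entry.
  have heq := (Finset.sum_eq_sum_iff_of_le hle).1 hsum
  have hpos : 0 < ∑ s, |v s| := by
    obtain ⟨s, hs⟩ := Function.ne_iff.1 hv0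
    exact Finset.sum_pos' (fun _ _ => abs_nonneg _) ⟨s, Finset.mem_univ s, abs_pos.2 hs⟩
  refine ⟨fun s => |v s| / ∑ s, |v s|, fun s => by positivity, ?_, ?_⟩
  · rw [← Finset.sum_div, div_self hpos.ne']
  · ext s
    change ∑ t, |v t| / (∑ s, |v s|) * P t s = _
    rw [heq s (Finset.mem_univ s), Finset.sum_div]
    exact Finset.sum_congr rfl fun t _ => by ring

theorem isStationary_stationary [Nonempty D] {P : Matrix D D ℝ} (h0 : ∀ s s', 0 ≤ P s s')
    (h1 : ∀ s, ∑ s', P s s' = 1) : IsStationary P (stationary P) :=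
  Classical.epsilon_spec (exists_isStationary h0 h1)

variable [DecidableEq D]

/-- Maximum principle: `x` is also fixed by a power of `P` with positive entries, so its maximal
value is an average of all values with positive weights, which forces them all to be maximal. -/
theorem eq_const_of_mulVec_eq [Nonempty D] {P : Matrix D D ℝ} (h1 : ∀ s, ∑ s', P s s' = 1)
    (hP : P.IsPrimitive) {x : D → ℝ} (hx : P.mulVec x = x) (s t : D) : x s = x t := by
  obtain ⟨k, -, hk⟩ := hP.exists_pos_pow
  have hpow : ∀ n : ℕ, (P ^ n).mulVec x = x := fun n => by
    induction n with
    | zero => simp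
    | succ n ih => rw [pow_succ, ← Matrix.mulVec_mulVec, hx, ih]
  have hone : ∀ n : ℕ, (P ^ n).mulVec (fun _ => 1) = fun _ => 1 := fun n => by
    have h : P.mulVec (fun _ => 1) = fun _ => 1 := by
      ext s; simp [Matrix.mulVec, dotProduct, h1]
    induction n with
    | zero => simp
    | succ n ih => rw [pow_succ, ← Matrix.mulVec_mulVec, h, ih]
  obtain ⟨m, -, hm⟩ := Finset.exists_max_image Finset.univ x Finset.univ_nonempty
  have hmax : ∀ t, x t = x m := by
    have e1 : ∑ t, (P ^ k) m t * x t = x m := congrFun (hpow k) m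
    have e2 : ∑ t, (P ^ k) m t * 1 = 1 := congrFun (hone k) m
    have e3 : ∑ t, (P ^ k) m t * x t = ∑ t, (P ^ k) m t * x m := by
      rw [e1, ← Finset.sum_mul]
      simp only [mul_one] at e2
      rw [e2, one_mul]
    intro t
    have := (Finset.sum_eq_sum_iff_of_le fun t _ =>
      mul_le_mul_of_nonneg_left (hm t (Finset.mem_univ t)) (hk m t).le).1 e3 t (Finset.mem_univ t)
    exact mul_left_cancel₀ (hk m t).ne' this
  rw [hmax s, hmax t]

/-- The matrix `1 - P + 1 ⊗ π`, with `π` the stationary distribution of `P`. Its inverse is the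
fundamental matrix of the chain. -/
def fundInv (P : Matrix D D ℝ) : Matrix D D ℝ :=
  Matrix.of fun s s' => (1 : Matrix D D ℝ) s s' - P s s' + stationary P s'

theorem fundInv_mulVec (P : Matrix D D ℝ) (x : D → ℝ) (s : D) :
    (fundInv P).mulVec x s = x s - P.mulVec x s + ∑ s', stationary P s' * x s' := by
  have e : x s = ∑ s', (1 : Matrix D D ℝ) s s' * x s' := by
    conv_lhs => rw [← Matrix.one_mulVec x]
    rfl
  rw [e]
  simp only [Matrix.mulVec, dotProduct, fundInv, Matrix.of_apply, sub_mul, add_mul,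
    Finset.sum_add_distrib, Finset.sum_sub_distrib]

/-- The stationary distribution is a left fixed vector of `fundInv P`, because `π P = π` and `π` has
total mass one. -/
theorem stationary_fundInv [Nonempty D] {P : Matrix D D ℝ} (h0 : ∀ s s', 0 ≤ P s s')
    (h1 : ∀ s, ∑ s', P s s' = 1) (x : D → ℝ) :
    ∑ s, stationary P s * (fundInv P).mulVec x s = ∑ s', stationary P s' * x s' := by
  have h := isStationary_stationary h0 h1
  have e : ∑ s, stationary P s * P.mulVec x s = ∑ s', stationary P s' * x s' := by
    have h3 : dotProduct (Matrix.vecMul (stationary P) P) x =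
      dotProduct (stationary P) (P.mulVec x) := (Matrix.dotProduct_mulVec _ _ _).symm
    rw [h.2.2] at h3
    exact h3.symm
  simp_rw [fundInv_mulVec, mul_add, mul_sub, Finset.sum_add_distrib, Finset.sum_sub_distrib, e,
    ← Finset.sum_mul, h.2.1]
  ring

/-- Pairing a kernel vector `x` with `π` gives `π x = 0`. Then the rank-one term disappears and `P x
= x`, so `x` is constant by primitivity, and the constant is `π x = 0`. -/
theorem isUnit_det_fundInv [Nonempty D] {P : Matrix D D ℝ} (h1 : ∀ s, ∑ s', P s s' = 1)
    (hP : P.IsPrimitive) : IsUnit (fundInv P).det := by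
  rw [isUnit_iff_ne_zero]
  intro hdet
  obtain ⟨x, hx0, hx⟩ := Matrix.exists_mulVec_eq_zero_iff.2 hdet
  have h := stationary_fundInv hP.nonneg h1 x
  rw [hx] at h
  simp only [Pi.zero_apply, mul_zero, Finset.sum_const_zero] at h
  have hfix : P.mulVec x = x := by
    ext s
    have := congrFun hx s
    rw [fundInv_mulVec, ← h] at this
    simp only [Pi.zero_apply] at this
    linarith
  have hc := eq_const_of_mulVec_eq h1 hP hfix
  apply hx0
  ext s
  have : ∑ s', stationary P s' * x s' = x s := by
    rw [Finset.sum_congr rfl fun s' _ => by rw [hc s' s], ← Finset.sum_mul,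
      (isStationary_stationary hP.nonneg h1).2.1, one_mul]
  rw [← this, ← h]
  rfl

/-- The solution of the Poisson equation of the chain `P` with source `H`. -/
def poisson (P : Matrix D D ℝ) (H : D → ℝ) (s : D) : ℝ :=
  ∑ s', (fundInv P)⁻¹ s s' * (H s' - ∑ t, stationary P t * H t)

/-- The source is centered, so pairing `fundInv P u = H - π H` with `π` shows `π u = 0`; the
rank-one term of `fundInv` therefore drops out and `1 - P` remains. -/
theorem poisson_eq [Nonempty D] {P : Matrix D D ℝ} (h1 : ∀ s, ∑ s', P s s' = 1)
    (hP : P.IsPrimitive) (H : D → ℝ) (s : D) :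
    poisson P H s - ∑ s', P s s' * poisson P H s' = H s - ∑ t, stationary P t * H t := by
  have e : (fundInv P).mulVec (poisson P H) = fun s => H s - ∑ t, stationary P t * H t := by
    have : poisson P H = (fundInv P)⁻¹.mulVec (fun s => H s - ∑ t, stationary P t * H t) := rfl
    rw [this, Matrix.mulVec_mulVec, Matrix.mul_nonsing_inv _ (isUnit_det_fundInv h1 hP),
      Matrix.one_mulVec]
  have h := stationary_fundInv hP.nonneg h1 (poisson P H)
  rw [e] at h
  simp_rw [mul_sub, Finset.sum_sub_distrib, ← Finset.sum_mul,
    (isStationary_stationary hP.nonneg h1).2.1, one_mul, sub_self] at h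
  have := congrFun e s
  rw [fundInv_mulVec, ← h, add_zero] at this
  exact this

end Stochastic

/-! ### Dependence on the policy -/

/-- Transition probabilities whose state-action chain is primitive for every positive policy and
has a stationary distribution which depends on the policy in a Lipschitz continuous way. -/
structure GoodKernel {dx da : ℕ} (M : MDP dx da) (q : M.S → M.X → ℝ) : Prop where
  nonneg : ∀ s y, 0 ≤ q s y
  sum : ∀ s, ∑ y, q s y = 1
  prim : ∀ [DecidableEq M.S], ∀ f, M.IsPositivePolicy f → (M.trans q f).IsPrimitive
  lip : ∃ L : ℝ, 0 < L ∧ ∀ f f', M.IsPositivePolicy f → M.IsPositivePolicy f' →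
    dTV (stationary (M.trans q f)) (stationary (M.trans q f')) ≤ L * dTV f f'

namespace GoodKernel

variable {dx da : ℕ} {M : MDP dx da} {q : M.S → M.X → ℝ}

theorem p (hE : M.Ergodic) (hL : M.StationaryLipschitz) : GoodKernel M M.p where
  nonneg := M.p_nonneg
  sum := M.p_sum
  prim := fun f hf => by convert (hE f hf).1
  lip := by
    obtain ⟨L, h0, h⟩ := hL
    exact ⟨L, h0, fun f f' hf hf' => (le_max_left _ _).trans (h f f' hf hf')⟩

theorem pAux (hE : M.Ergodic) (hL : M.StationaryLipschitz) : GoodKernel M M.pAux where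
  nonneg := fun s y => add_nonneg (mul_nonneg M.gam_pos.le (M.p_nonneg s y))
    (mul_nonneg (sub_nonneg.2 M.gam_lt_one.le) (Finset.sum_nonneg fun a _ => M.rho_nonneg _))
  sum := fun s => by
    unfold MDP.pAux
    rw [Finset.sum_add_distrib, ← Finset.mul_sum, ← Finset.mul_sum, M.p_sum,
      ← Fintype.sum_prod_type', M.rho_sum]
    ring
  prim := fun f hf => by convert (hE f hf).2
  lip := by
    obtain ⟨L, h0, h⟩ := hL
    exact ⟨L, h0, fun f f' hf hf' => (le_max_right _ _).trans (h f f' hf hf')⟩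

theorem trans_nonneg (hq : GoodKernel M q) {f : M.S → ℝ} (hf : M.IsPositivePolicy f) (s s' : M.S) :
    0 ≤ M.trans q f s s' :=
  mul_nonneg (hq.nonneg _ _) (hf.1 s').le

theorem trans_sum (hq : GoodKernel M q) {f : M.S → ℝ} (hf : M.IsPositivePolicy f) (s : M.S) :
    ∑ s', M.trans q f s s' = 1 := by
  change ∑ s' : M.X × M.A, q s s'.1 * f s' = 1
  rw [Fintype.sum_prod_type]
  simp only [← Finset.mul_sum, hf.2, mul_one, hq.sum]

theorem isStationary (hq : GoodKernel M q) {f : M.S → ℝ} (hf : M.IsPositivePolicy f) :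
    IsStationary (M.trans q f) (stationary (M.trans q f)) :=
  have := M.nonempty_S
  isStationary_stationary (hq.trans_nonneg hf) (hq.trans_sum hf)

theorem stationary_mem (hq : GoodKernel M q) {f : M.S → ℝ} (hf : M.IsPositivePolicy f) (s : M.S) :
    stationary (M.trans q f) s ∈ Set.Icc (0 : ℝ) 1 := by
  have h := hq.isStationary hf
  refine ⟨h.1 s, ?_⟩
  rw [← h.2.1]
  exact Finset.single_le_sum (f := stationary (M.trans q f)) (fun s _ => h.1 s)
    (Finset.mem_univ s)

/-- Translates the total variation assumption to the supremum distance. The factors `1 / 2` on both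
sides cancel, and the sum over state-action pairs costs the factor `|S|`. -/
theorem stationary_bddLip (hq : GoodKernel M q) (s : M.S) :
    BddLip {f | M.IsPositivePolicy f} fun f => stationary (M.trans q f) s := by
  obtain ⟨L, hL0, hL⟩ := hq.lip
  refine BddLip.mk' (K := 1) (L := L * Fintype.card M.S) (fun f hf => ?_) fun f hf f' hf' => ?_
  · have := hq.stationary_mem hf s
    rw [abs_of_nonneg this.1]
    exact this.2
  · have h1 := hL f f' hf hf'
    unfold dTV at h1
    have h2 := Finset.single_le_sum
      (f := fun s => |stationary (M.trans q f) s - stationary (M.trans q f') s|)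
      (fun s _ => abs_nonneg _) (Finset.mem_univ s)
    have h3 : ∑ s, |f s - f' s| ≤ Fintype.card M.S * dist f f' := by
      rw [← Finset.card_univ, ← nsmul_eq_mul]
      refine Finset.sum_le_card_nsmul _ _ _ fun s _ => ?_
      rw [← Real.dist_eq]
      exact dist_le_pi_dist f f' s
    have h4 := mul_le_mul_of_nonneg_left h3 hL0.le
    linarith

theorem trans_bddLip (s s' : M.S) :
    BddLip {f | M.IsPositivePolicy f} fun f => M.trans q f s s' := by
  have h : BddLip {f | M.IsPositivePolicy f} fun f => f s' := by
    refine BddLip.mk' (K := 1) (L := 1) (fun f hf => ?_) fun f hf f' hf' => ?_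
    · rw [abs_of_nonneg (hf.1 s').le]
      exact hf.le_one s'
    · rw [← Real.dist_eq, one_mul]
      exact dist_le_pi_dist f f' s'
  exact (BddLip.const (q s s'.1)).mul h

theorem isCompact_policies {c : ℝ} (hc : 0 < c) : IsCompact (M.policies c) := by
  refine (isCompact_univ_pi fun _ : M.S => isCompact_Icc (a := (0 : ℝ)) (b := 1)).of_isClosed_subset
    ?_ fun f hf s _ => ⟨hc.le.trans (hf.1 s), (MDP.IsPositivePolicy.of_mem hc hf).le_one s⟩
  have : M.policies c = (⋂ s, {f : M.S → ℝ | c ≤ f s}) ∩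
      ⋂ x : M.X, {f : M.S → ℝ | ∑ a : M.A, f (x, a) = 1} := by
    ext f; simp [MDP.policies]
  rw [this]
  refine (isClosed_iInter fun s => isClosed_le continuous_const (continuous_apply s)).inter
    (isClosed_iInter fun x => isClosed_eq ?_ continuous_const)
  fun_prop

variable [DecidableEq M.S]

/-- Compactness replaces a quantitative mixing rate. The inverse is continuous on the policies
bounded below by `c > 0`, hence bounded there, and the resolvent identity transfers the Lipschitz
property of the matrix to its inverse. -/
theorem fundInv_inv_bddLip (hq : GoodKernel M q) {c : ℝ} (hc : 0 < c) (s s' : M.S) :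
    BddLip (M.policies c) fun f => (fundInv (M.trans q f))⁻¹ s s' := by
  have := M.nonempty_S
  have hsub : M.policies c ⊆ {f | M.IsPositivePolicy f} := fun f hf =>
    MDP.IsPositivePolicy.of_mem hc hf
  have hA : ∀ s s', BddLip (M.policies c) fun f => fundInv (M.trans q f) s s' := fun s s' =>
    (((BddLip.const _).sub (trans_bddLip s s')).add (hq.stationary_bddLip s')).mono hsub
  have hu : ∀ f ∈ M.policies c, IsUnit (fundInv (M.trans q f)).det := fun f hf =>
    isUnit_det_fundInv (hq.trans_sum (hsub hf)) (hq.prim f (hsub hf))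
  have hcont : ContinuousOn (fun f => fundInv (M.trans q f)) (M.policies c) :=
    continuousOn_pi.2 fun s => continuousOn_pi.2 fun s' => (hA s s').continuousOn
  have hinv : ∀ s s', ContinuousOn (fun f => (fundInv (M.trans q f))⁻¹ s s') (M.policies c) := by
    intro s s'
    have hdet : ContinuousOn (fun f => (fundInv (M.trans q f)).det) (M.policies c) :=
      continuous_id.matrix_det.comp_continuousOn hcont
    have hadj : ContinuousOn (fun f => (fundInv (M.trans q f)).adjugate) (M.policies c) :=
      continuous_id.matrix_adjugate.comp_continuousOn hcont
    have hadj' : ContinuousOn (fun f => (fundInv (M.trans q f)).adjugate s s') (M.policies c) :=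
      (continuous_apply_apply s s').comp_continuousOn hadj
    refine ((hdet.inv₀ fun f hf => (hu f hf).ne_zero).mul hadj').congr fun f hf => ?_
    -- By Cramer's rule the entry is a quotient of continuous functions with nonvanishing
    -- denominator.
    rw [Matrix.inv_def, Matrix.smul_apply, Ring.inverse_eq_inv', smul_eq_mul]
    rfl
  have hb : ∀ s s', ∃ K, ∀ f ∈ M.policies c, |(fundInv (M.trans q f))⁻¹ s s'| ≤ K := fun s s' =>
    (isCompact_policies hc).exists_bound_of_continuousOn (hinv s s')
  choose K hK using hb
  choose L hL0 _ hL using hA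
  refine BddLip.mk' (K := K s s') (L := ∑ a, ∑ b, K s a * L a b * K b s') (hK s s')
    fun f hf f' hf' => ?_
  -- Resolvent identity `A⁻¹ - B⁻¹ = A⁻¹ (B - A) B⁻¹`.
  have e : (fundInv (M.trans q f))⁻¹ - (fundInv (M.trans q f'))⁻¹ = (fundInv (M.trans q f))⁻¹ *
      ((fundInv (M.trans q f') - fundInv (M.trans q f)) * (fundInv (M.trans q f'))⁻¹) := by
    rw [Matrix.sub_mul, Matrix.mul_sub, Matrix.mul_nonsing_inv _ (hu f' hf'), ← Matrix.mul_assoc,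
      Matrix.nonsing_inv_mul _ (hu f hf), Matrix.one_mul, Matrix.mul_one]
  rw [← Matrix.sub_apply, e, Matrix.mul_apply, Finset.sum_mul]
  refine (Finset.abs_sum_le_sum_abs _ _).trans (Finset.sum_le_sum fun a _ => ?_)
  rw [Matrix.mul_apply, Finset.mul_sum, Finset.sum_mul]
  refine (Finset.abs_sum_le_sum_abs _ _).trans (Finset.sum_le_sum fun b _ => ?_)
  rw [abs_mul, abs_mul, Matrix.sub_apply, abs_sub_comm]
  have k0 : 0 ≤ K s a := (abs_nonneg _).trans (hK s a f hf)
  calc _ ≤ K s a * (L a b * dist f f' * K b s') :=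
        mul_le_mul (hK s a f hf) (mul_le_mul (hL a b f hf f' hf') (hK b s' f' hf') (abs_nonneg _)
          (mul_nonneg (hL0 a b) dist_nonneg)) (by positivity) k0
    _ = _ := by ring

end GoodKernel

/-- A source that depends on parameters in a bounded Lipschitz continuous way has a solution of the
Poisson equation with the same property. -/
theorem GoodKernel.exists_poisson {dx da : ℕ} {M : MDP dx da} {q : M.S → M.X → ℝ}
    (hq : GoodKernel M q) {Y : Type*} [PseudoMetricSpace Y] {D : Set Y} {c : ℝ} (hc : 0 < c)
    {g H : Y → M.S → ℝ} (hg : ∀ y ∈ D, g y ∈ M.policies c) (hgL : ∀ s, BddLip D fun y => g y s)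
    (hH : ∀ s, BddLip D fun y => H y s) :
    ∃ u : Y → M.S → ℝ, (∀ s, BddLip D fun y => u y s) ∧ ∀ y ∈ D, ∀ s,
      u y s - ∑ s', M.trans q (g y) s s' * u y s' =
        H y s - ∑ t, stationary (M.trans q (g y)) t * H y t := by
  classical
  have := M.nonempty_S
  have hpos : ∀ y ∈ D, M.IsPositivePolicy (g y) := fun y hy =>
    MDP.IsPositivePolicy.of_mem hc (hg y hy)
  refine ⟨fun y => poisson (M.trans q (g y)) (H y), fun s => ?_, fun y hy s =>
    poisson_eq (hq.trans_sum (hpos y hy)) (hq.prim _ (hpos y hy)) _ s⟩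
  refine BddLip.sum _ fun s' => ((hq.fundInv_inv_bddLip hc s s').comp_pi hg hgL).mul
    ((hH s').sub (BddLip.sum _ fun t => ?_))
  exact ((hq.stationary_bddLip t).comp_pi hpos hgL).mul (hH t)

/-! ### Exponential moments -/

/-- The linear term has coefficient one and no constant is lost, so for a centered variable bounded
by `b` the expectation of `exp x` is at most `exp (b ^ 2)`, a bound that multiplies well. -/
theorem exp_le_add_exp_sq (x : ℝ) : Real.exp x ≤ x + Real.exp (x ^ 2) := by
  have h2 := Real.add_one_le_exp (x ^ 2)
  rcases le_or_gt |x| 1 with h | h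
  · have h1 := abs_le.1 (Real.abs_exp_sub_one_sub_id_le h)
    linarith [h1.2]
  · rcases lt_abs.1 h with h | h
    · have : Real.exp x ≤ Real.exp (x ^ 2) := Real.exp_le_exp.2 (by nlinarith)
      linarith
    · have : Real.exp x ≤ 1 := Real.exp_le_one_iff.2 (by linarith)
      nlinarith

section

variable {Ω S : Type*} [Fintype S] {ξ : ℕ → Ω → S} {κ V : ℕ → Ω → S → ℝ} {b : ℝ}

/-- The increments of the martingale that compares a functional of the next state with its
conditional expectation. -/
def martIncr (ξ : ℕ → Ω → S) (κ V : ℕ → Ω → S → ℝ) (j : ℕ) (ω : Ω) : ℝ :=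
  V j ω (ξ (j + 1) ω) - ∑ s, κ j ω s * V j ω s

theorem martIncr_abs_le (hκ0 : ∀ k ω s, 0 ≤ κ k ω s) (hκ1 : ∀ k ω, ∑ s, κ k ω s = 1)
    (hb : ∀ k ω s, |V k ω s| ≤ b) (j : ℕ) (ω : Ω) : |martIncr ξ κ V j ω| ≤ 2 * b := by
  have h2 : |∑ s, κ j ω s * V j ω s| ≤ b := by
    calc |∑ s, κ j ω s * V j ω s| ≤ ∑ s, |κ j ω s * V j ω s| := Finset.abs_sum_le_sum_abs _ _
      _ ≤ ∑ s, κ j ω s * b := Finset.sum_le_sum fun s _ => by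
          rw [abs_mul, abs_of_nonneg (hκ0 j ω s)]
          exact mul_le_mul_of_nonneg_left (hb j ω s) (hκ0 j ω s)
      _ = b := by rw [← Finset.sum_mul, hκ1, one_mul]
  unfold martIncr
  have := abs_sub (V j ω (ξ (j + 1) ω)) (∑ s, κ j ω s * V j ω s)
  linarith [hb j ω (ξ (j + 1) ω)]

end

/-- Because `S` is finite, measurability of each section already gives joint measurability of the
evaluation. -/
theorem measurable_eval_of_finite {Ω S : Type*} [Finite S] [MeasurableSpace S]
    [MeasurableSingletonClass S] {m : MeasurableSpace Ω} {η : Ω → S} (hη : Measurable η)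
    {U : Ω → S → ℝ} (hU : ∀ s, Measurable fun ω => U ω s) : Measurable fun ω => U ω (η ω) := by
  have h : Measurable fun x : S × Ω => U x.2 x.1 := measurable_from_prod_countable_right hU
  exact h.comp (hη.prodMk measurable_id)

section

variable {Ω : Type*} [mΩ : MeasurableSpace Ω] {ℙ : Measure Ω}

/-- From `|x| ^ p ≤ p! * exp |x|` and `exp |x| ≤ exp x + exp (-x)`: two exponential moments control
all orders `p` at once. -/
theorem moment_le_of_integral_exp_le {X : Ω → ℝ} {A : ℝ} (hX : AEStronglyMeasurable X ℙ)
    (h1 : Integrable (fun ω => Real.exp (X ω)) ℙ) (h2 : Integrable (fun ω => Real.exp (-X ω)) ℙ)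
    (hA1 : ∫ ω, Real.exp (X ω) ∂ℙ ≤ A) (hA2 : ∫ ω, Real.exp (-X ω) ∂ℙ ≤ A) (p : ℕ) :
    Integrable (fun ω => |X ω| ^ p) ℙ ∧ ∫ ω, |X ω| ^ p ∂ℙ ≤ p.factorial * (A + A) := by
  have hle : ∀ ω, |X ω| ^ p ≤ p.factorial * (Real.exp (X ω) + Real.exp (-X ω)) := fun ω => by
    have h := Real.pow_div_factorial_le_exp (|X ω|) (abs_nonneg _) p
    rw [div_le_iff₀ (by positivity)] at h
    refine h.trans ?_
    rw [mul_comm]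
    gcongr
    rcases abs_choice (X ω) with h | h <;> rw [h] <;>
      linarith [Real.exp_pos (X ω), Real.exp_pos (-X ω)]
  have hint := (h1.add h2).const_mul (p.factorial : ℝ)
  have hi : Integrable (fun ω => |X ω| ^ p) ℙ := by
    refine hint.mono' ((continuous_abs.comp_aestronglyMeasurable hX).pow p)
      (Eventually.of_forall fun ω => ?_)
    rw [Real.norm_of_nonneg (by positivity)]
    exact hle ω
  refine ⟨hi, (integral_mono hi hint hle).trans ?_⟩
  simp only [Pi.add_apply]
  rw [integral_const_mul, integral_add h1 h2]
  gcongr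

variable [IsProbabilityMeasure ℙ] {F : Filtration ℕ mΩ} {S : Type*} [Fintype S] [MeasurableSpace S]
  [MeasurableSingletonClass S] {ξ : ℕ → Ω → S} {κ V : ℕ → Ω → S → ℝ} {b : ℝ}

theorem martIncr_measurable (hξ : ∀ k, Measurable[F k] (ξ k))
    (hκ : ∀ k s, Measurable[F k] fun ω => κ k ω s) (hV : ∀ k s, Measurable[F k] fun ω => V k ω s)
    (j : ℕ) : Measurable[F (j + 1)] (martIncr ξ κ V j) := by
  have hle := F.mono (Nat.le_succ j)
  refine Measurable.sub (measurable_eval_of_finite (hξ (j + 1)) fun s => (hV j s).mono hle le_rfl) ?_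
  exact Finset.measurable_sum _ fun s _ => ((hκ j s).mul (hV j s)).mono hle le_rfl

theorem sum_martIncr_measurable (hξ : ∀ k, Measurable[F k] (ξ k))
    (hκ : ∀ k s, Measurable[F k] fun ω => κ k ω s) (hV : ∀ k s, Measurable[F k] fun ω => V k ω s)
    (k : ℕ) : Measurable[F k] fun ω => ∑ j ∈ Finset.range k, martIncr ξ κ V j ω :=
  Finset.measurable_sum _ fun j hj =>
    (martIncr_measurable hξ hκ hV j).mono (F.mono (Finset.mem_range.1 hj)) le_rfl

theorem integral_mul_indicator_eq {m : MeasurableSpace Ω} (hm : m ≤ mΩ) {φ f ψ : Ω → ℝ} {c : ℝ}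
    (hφ : Measurable[m] φ) (hc : ∀ ω, |φ ω| ≤ c) (hf : Integrable f ℙ) (h : ℙ[f | m] =ᵐ[ℙ] ψ) :
    ∫ ω, φ ω * f ω ∂ℙ = ∫ ω, φ ω * ψ ω ∂ℙ := by
  have hφf : Integrable (φ * f) ℙ :=
    hf.bdd_mul (hφ.mono hm le_rfl).aestronglyMeasurable (Eventually.of_forall hc)
  have h1 := condExp_mul_of_stronglyMeasurable_left (μ := ℙ) (m := m) hφ.stronglyMeasurable hφf hf
  have h2 := integral_condExp (μ := ℙ) (f := φ * f) hm
  change ∫ ω, (φ * f) ω ∂ℙ = _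
  rw [← h2]
  refine integral_congr_ae (h1.trans ?_)
  filter_upwards [h] with ω hω
  simp [hω]

/-- The increment is expanded over the values of the next state. Each term is a bounded `F
k`-measurable weight times an indicator minus its conditional probability, and such a term has mean
zero. -/
theorem integral_mul_martIncr (hξ : ∀ k, Measurable[F k] (ξ k))
    (hκ : ∀ k s, Measurable[F k] fun ω => κ k ω s) (hV : ∀ k s, Measurable[F k] fun ω => V k ω s)
    (hκ0 : ∀ k ω s, 0 ≤ κ k ω s) (hκ1 : ∀ k ω, ∑ s, κ k ω s = 1)
    (hstep : ∀ k s, ℙ[Set.indicator {ω | ξ (k + 1) ω = s} (fun _ => (1 : ℝ)) | F k] =ᵐ[ℙ]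
      fun ω => κ k ω s) (hb : ∀ k ω s, |V k ω s| ≤ b) {k : ℕ} {W : Ω → ℝ} {c : ℝ}
    (hW : Measurable[F k] W) (hc : ∀ ω, |W ω| ≤ c) : ∫ ω, W ω * martIncr ξ κ V k ω ∂ℙ = 0 := by
  classical
  have hset : ∀ s, MeasurableSet {ω | ξ (k + 1) ω = s} := fun s =>
    (hξ (k + 1)).mono (F.le _) le_rfl (measurableSet_singleton s)
  have hκle : ∀ ω s, κ k ω s ≤ 1 := fun ω s => by
    rw [← hκ1 k ω]
    exact Finset.single_le_sum (f := κ k ω) (fun s _ => hκ0 k ω s) (Finset.mem_univ s)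
  have hWV : ∀ s, Measurable[F k] fun ω => W ω * V k ω s := fun s => hW.mul (hV k s)
  have hWVb : ∀ s ω, |W ω * V k ω s| ≤ c * b := fun s ω => by
    rw [abs_mul]
    exact mul_le_mul (hc ω) (hb k ω s) (abs_nonneg _) ((abs_nonneg _).trans (hc ω))
  have hind : ∀ s, Integrable (Set.indicator {ω | ξ (k + 1) ω = s} fun _ => (1 : ℝ)) ℙ := fun s =>
    (integrable_const 1).indicator (hset s)
  have hI1 : ∀ s, Integrable (fun ω => W ω * V k ω s *
      Set.indicator {ω | ξ (k + 1) ω = s} (fun _ => (1 : ℝ)) ω) ℙ := fun s =>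
    (hind s).bdd_mul ((hWV s).mono (F.le k) le_rfl).aestronglyMeasurable
      (Eventually.of_forall (hWVb s))
  have hI2 : ∀ s, Integrable (fun ω => W ω * V k ω s * κ k ω s) ℙ := fun s => by
    refine Integrable.bdd_mul (c := c * b) ?_ ((hWV s).mono (F.le k) le_rfl).aestronglyMeasurable
      (Eventually.of_forall (hWVb s))
    refine Integrable.of_bound ((hκ k s).mono (F.le k) le_rfl).aestronglyMeasurable 1
      (Eventually.of_forall fun ω => ?_)
    rw [Real.norm_of_nonneg (hκ0 k ω s)]
    exact hκle ω s
  have e : ∀ ω, W ω * martIncr ξ κ V k ω = ∑ s, (W ω * V k ω s *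
      Set.indicator {ω | ξ (k + 1) ω = s} (fun _ => (1 : ℝ)) ω - W ω * V k ω s * κ k ω s) := by
    intro ω
    rw [Finset.sum_sub_distrib, martIncr, mul_sub, Finset.mul_sum]
    congr 1
    · simp [Set.indicator_apply]
    · exact Finset.sum_congr rfl fun s _ => by ring
  simp_rw [e]
  have hI : ∀ s ∈ Finset.univ, Integrable (fun ω => W ω * V k ω s *
      Set.indicator {ω | ξ (k + 1) ω = s} (fun _ => (1 : ℝ)) ω - W ω * V k ω s * κ k ω s) ℙ :=
    fun s _ => (hI1 s).sub (hI2 s)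
  rw [integral_finsetSum _ hI]
  refine Finset.sum_eq_zero fun s _ => ?_
  rw [integral_sub (hI1 s) (hI2 s), sub_eq_zero]
  exact integral_mul_indicator_eq (F.le k) (hWV s) (hWVb s) (hind s) (hstep k s)

/-- An Azuma-type bound by induction on `k`: `exp_le_add_exp_sq` applied to the last increment
leaves a linear term, which is orthogonal to the past, and the factor `exp ((l * 2b) ^ 2)`. -/
theorem integral_exp_sum_martIncr_le (hξ : ∀ k, Measurable[F k] (ξ k))
    (hκ : ∀ k s, Measurable[F k] fun ω => κ k ω s) (hV : ∀ k s, Measurable[F k] fun ω => V k ω s)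
    (hκ0 : ∀ k ω s, 0 ≤ κ k ω s) (hκ1 : ∀ k ω, ∑ s, κ k ω s = 1)
    (hstep : ∀ k s, ℙ[Set.indicator {ω | ξ (k + 1) ω = s} (fun _ => (1 : ℝ)) | F k] =ᵐ[ℙ]
      fun ω => κ k ω s) (hb : ∀ k ω s, |V k ω s| ≤ b) (l : ℝ) (k : ℕ) :
    Integrable (fun ω => Real.exp (l * ∑ j ∈ Finset.range k, martIncr ξ κ V j ω)) ℙ ∧
    ∫ ω, Real.exp (l * ∑ j ∈ Finset.range k, martIncr ξ κ V j ω) ∂ℙ ≤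
      Real.exp (k * (l * (2 * b)) ^ 2) := by
  have hmeas := fun k => sum_martIncr_measurable hξ hκ hV k
  have hd := fun k ω => martIncr_abs_le (ξ := ξ) hκ0 hκ1 hb k ω
  have hWm : ∀ k, Measurable[F k]
      fun ω => Real.exp (l * ∑ j ∈ Finset.range k, martIncr ξ κ V j ω) := fun k =>
    Real.measurable_exp.comp ((hmeas k).const_mul l)
  have hWb : ∀ k ω, |Real.exp (l * ∑ j ∈ Finset.range k, martIncr ξ κ V j ω)| ≤
      Real.exp (|l| * (k * (2 * b))) := fun k ω => by
    rw [Real.abs_exp, Real.exp_le_exp]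
    refine (le_abs_self _).trans ?_
    rw [abs_mul]
    refine mul_le_mul_of_nonneg_left ((Finset.abs_sum_le_sum_abs _ _).trans ?_) (abs_nonneg _)
    refine (Finset.sum_le_card_nsmul _ _ _ fun j _ => hd j ω).trans ?_
    simp
  have hWi : ∀ k, Integrable
      (fun ω => Real.exp (l * ∑ j ∈ Finset.range k, martIncr ξ κ V j ω)) ℙ := fun k =>
    Integrable.of_bound ((hWm k).mono (F.le k) le_rfl).aestronglyMeasurable _
      (Eventually.of_forall (hWb k))
  refine ⟨hWi k, ?_⟩
  induction k with
  | zero => simp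
  | succ k ih =>
    have hle : ∀ ω, Real.exp (l * ∑ j ∈ Finset.range (k + 1), martIncr ξ κ V j ω) ≤
        l * (Real.exp (l * ∑ j ∈ Finset.range k, martIncr ξ κ V j ω) * martIncr ξ κ V k ω) +
          Real.exp ((l * (2 * b)) ^ 2) *
            Real.exp (l * ∑ j ∈ Finset.range k, martIncr ξ κ V j ω) := by
      intro ω
      rw [Finset.sum_range_succ, mul_add, Real.exp_add]
      have h1 := exp_le_add_exp_sq (l * martIncr ξ κ V k ω)
      have h2 : Real.exp ((l * martIncr ξ κ V k ω) ^ 2) ≤ Real.exp ((l * (2 * b)) ^ 2) := by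
        rw [Real.exp_le_exp, mul_pow, mul_pow l]
        refine mul_le_mul_of_nonneg_left ?_ (sq_nonneg l)
        rw [← sq_abs (martIncr ξ κ V k ω)]
        exact pow_le_pow_left₀ (abs_nonneg _) (hd k ω) 2
      have h3 := mul_le_mul_of_nonneg_left (h1.trans (add_le_add_right h2 _))
        (Real.exp_pos (l * ∑ j ∈ Finset.range k, martIncr ξ κ V j ω)).le
      refine h3.trans (le_of_eq ?_)
      ring
    have hWd : Integrable (fun ω => Real.exp (l * ∑ j ∈ Finset.range k, martIncr ξ κ V j ω) *
        martIncr ξ κ V k ω) ℙ := by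
      refine (hWi k).mul_bdd (c := 2 * b)
        ((martIncr_measurable hξ hκ hV k).mono (F.le _) le_rfl).aestronglyMeasurable
        (Eventually.of_forall (hd k))
    refine (integral_mono (hWi (k + 1)) ((hWd.const_mul l).add ((hWi k).const_mul _)) hle).trans ?_
    simp only [Pi.add_apply]
    rw [integral_add (hWd.const_mul l) ((hWi k).const_mul _), integral_const_mul,
      integral_const_mul, integral_mul_martIncr hξ hκ hV hκ0 hκ1 hstep hb (hWm k) (hWb k), mul_zero,
      zero_add]
    refine (mul_le_mul_of_nonneg_left ih (Real.exp_pos _).le).trans (le_of_eq ?_)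
    rw [← Real.exp_add]
    congr 1
    push_cast
    ring

theorem moment_sum_martIncr_le (hξ : ∀ k, Measurable[F k] (ξ k))
    (hκ : ∀ k s, Measurable[F k] fun ω => κ k ω s) (hV : ∀ k s, Measurable[F k] fun ω => V k ω s)
    (hκ0 : ∀ k ω s, 0 ≤ κ k ω s) (hκ1 : ∀ k ω, ∑ s, κ k ω s = 1)
    (hstep : ∀ k s, ℙ[Set.indicator {ω | ξ (k + 1) ω = s} (fun _ => (1 : ℝ)) | F k] =ᵐ[ℙ]
      fun ω => κ k ω s) (hb : ∀ k ω s, |V k ω s| ≤ b) (l : ℝ) (k : ℕ) (p : ℕ) :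
    Integrable (fun ω => |l * ∑ j ∈ Finset.range k, martIncr ξ κ V j ω| ^ p) ℙ ∧
    ∫ ω, |l * ∑ j ∈ Finset.range k, martIncr ξ κ V j ω| ^ p ∂ℙ ≤
      p.factorial * (Real.exp (k * (l * (2 * b)) ^ 2) + Real.exp (k * (l * (2 * b)) ^ 2)) := by
  have h1 := integral_exp_sum_martIncr_le hξ hκ hV hκ0 hκ1 hstep hb l k
  have h2 := integral_exp_sum_martIncr_le hξ hκ hV hκ0 hκ1 hstep hb (-l) k
  simp only [neg_mul, neg_sq] at h2
  exact moment_le_of_integral_exp_le (((sum_martIncr_measurable hξ hκ hV k).mono (F.le k)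
    le_rfl).const_mul l).aestronglyMeasurable h1.1 h2.1 h1.2 h2.2 p

end

/-- Independence factorizes the exponential moment; in each factor `exp_le_add_exp_sq` and the
vanishing mean leave only `exp ((l * b) ^ 2)`. -/
theorem integral_exp_sum_iid_le {E : Type*} [MeasurableSpace E] {ν : Measure E}
    [IsProbabilityMeasure ν] {d : E → ℝ} (hd : Measurable d) {b : ℝ} (hb : ∀ᵐ x ∂ν, |d x| ≤ b)
    (h0 : ∫ x, d x ∂ν = 0) (l : ℝ) (N : ℕ) :
    Integrable (fun x : Fin N → E => Real.exp (l * ∑ i, d (x i))) (Measure.pi fun _ => ν) ∧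
    ∫ x : Fin N → E, Real.exp (l * ∑ i, d (x i)) ∂(Measure.pi fun _ => ν) ≤
      Real.exp (N * (l * b) ^ 2) := by
  have hint : Integrable d ν := Integrable.of_bound hd.aestronglyMeasurable b hb
  have hexp : Integrable (fun x => Real.exp (l * d x)) ν := by
    refine Integrable.of_bound (Real.measurable_exp.comp (hd.const_mul l)).aestronglyMeasurable
      (Real.exp (|l| * b)) ?_
    filter_upwards [hb] with x hx
    rw [Real.norm_eq_abs, Real.abs_exp, Real.exp_le_exp]
    refine (le_abs_self _).trans ?_
    rw [abs_mul]
    exact mul_le_mul_of_nonneg_left hx (abs_nonneg l)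
  have e : ∀ x : Fin N → E, Real.exp (l * ∑ i, d (x i)) = ∏ i, Real.exp (l * d (x i)) := fun x => by
    rw [Finset.mul_sum, Real.exp_sum]
  simp_rw [e]
  refine ⟨Integrable.fintype_prod fun _ => hexp, ?_⟩
  rw [integral_fintype_prod_eq_prod (fun (_ : Fin N) x => Real.exp (l * d x)), Finset.prod_const,
    Finset.card_univ, Fintype.card_fin, Real.exp_nat_mul]
  refine pow_le_pow_left₀ (integral_nonneg fun x => (Real.exp_pos _).le) ?_ N
  have hle : ∀ᵐ x ∂ν, Real.exp (l * d x) ≤ l * d x + Real.exp ((l * b) ^ 2) := by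
    filter_upwards [hb] with x hx
    refine (exp_le_add_exp_sq _).trans (add_le_add_right (Real.exp_le_exp.2 ?_) _)
    rw [mul_pow, mul_pow]
    refine mul_le_mul_of_nonneg_left ?_ (sq_nonneg l)
    rw [← sq_abs (d x)]
    exact pow_le_pow_left₀ (abs_nonneg _) hx 2
  refine (integral_mono_ae hexp ((hint.const_mul l).add (integrable_const _)) hle).trans ?_
  simp only [Pi.add_apply]
  rw [integral_add (hint.const_mul l) (integrable_const _), integral_const_mul, h0]
  simp

theorem moment_sum_iid_le {E : Type*} [MeasurableSpace E] {ν : Measure E}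
    [IsProbabilityMeasure ν] {d : E → ℝ} (hd : Measurable d) {b : ℝ} (hb : ∀ᵐ x ∂ν, |d x| ≤ b)
    (h0 : ∫ x, d x ∂ν = 0) (l : ℝ) (N p : ℕ) :
    Integrable (fun x : Fin N → E => |l * ∑ i, d (x i)| ^ p) (Measure.pi fun _ => ν) ∧
    ∫ x : Fin N → E, |l * ∑ i, d (x i)| ^ p ∂(Measure.pi fun _ => ν) ≤
      p.factorial * (Real.exp (N * (l * b) ^ 2) + Real.exp (N * (l * b) ^ 2)) := by
  have h1 := integral_exp_sum_iid_le hd hb h0 l N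
  have h2 := integral_exp_sum_iid_le hd hb h0 (-l) N
  simp only [neg_mul, neg_sq] at h2
  refine moment_le_of_integral_exp_le (Measurable.aestronglyMeasurable ?_) h1.1 h2.1 h1.2 h2.2 p
  exact (Finset.measurable_sum _ fun i _ => hd.comp (measurable_pi_apply i)).const_mul l

/-! ### The limit equations -/

section Limit

variable {dx da : ℕ} (M : MDP dx da) (m : Model dx da)

/-- The right-hand side of the limit equation of the critic. -/
def fieldQ (t : ℝ) (q P : M.S → ℝ) (s : M.S) : ℝ :=
  m.alp * ∑ s' : M.S, ∑ s'' : M.S, (M.r s' + M.gam * q s'' - q s') * kerB M m m.nu s s' *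
    M.statPi (M.explore (eta t) (M.softmax P)) s' * M.explore (eta t) (M.softmax P) s'' *
      M.p s' s''.1

/-- The right-hand side of the limit equation of the actor. -/
def fieldP (t : ℝ) (q P : M.S → ℝ) (s : M.S) : ℝ :=
  ∑ s' : M.S, ∑ a'' : M.A, zeta t * q s' * (kerB M m m.mu s s' - kerB M m m.mu s (s'.1, a'')) *
    M.softmax P (s'.1, a'') * M.statSigma (M.explore (eta t) (M.softmax P)) s'

/-- Truncation of all coordinates to `[-R, R]`. -/
def clampV {ι : Type*} (R : ℝ) (q : ι → ℝ) (s : ι) : ℝ := clamp R (q s)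

theorem clampV_eq {ι : Type*} [Fintype ι] {R : ℝ} {q : ι → ℝ} (h : ‖q‖ ≤ R) : clampV R q = q := by
  ext s
  exact clamp_eq ((norm_le_pi_norm q s).trans h)

theorem norm_clampV_le {ι : Type*} [Fintype ι] {R : ℝ} (hR : 0 ≤ R) (q : ι → ℝ) :
    ‖clampV R q‖ ≤ ‖q‖ := by
  rw [pi_norm_le_iff_of_nonneg (norm_nonneg q)]
  exact fun s => (clamp_abs_le_abs hR _).trans (norm_le_pi_norm q s)

/-- Time and the values of the critic and of the actor, with time in `[0, T]`. -/
def timeDom (T : ℝ) : Set (ℝ × (M.S → ℝ) × (M.S → ℝ)) := {y | y.1 ∈ Set.Icc 0 T}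

/-- The exploration policy as a function of time and of the values of critic and actor. -/
def polY (y : ℝ × (M.S → ℝ) × (M.S → ℝ)) : M.S → ℝ := M.explore (eta y.1) (M.softmax y.2.2)

variable {M m} {T : ℝ}

theorem abs_fst_sub_le {X : Type*} [PseudoMetricSpace X] (y y' : ℝ × X) :
    |y.1 - y'.1| ≤ dist y y' := by
  rw [← Real.dist_eq, Prod.dist_eq]
  exact le_max_left _ _

theorem eta_bddLip : BddLip (timeDom M T) fun y => eta y.1 :=
  BddLip.mk' (K := 1) (L := 1)
    (fun y _ => by rw [abs_of_pos (eta_pos _)]; exact eta_le_one _)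
    fun y hy y' hy' => by
      rw [one_mul]; exact (eta_lipschitz hy.1 hy'.1).trans (abs_fst_sub_le y y')

theorem zeta_bddLip : BddLip (timeDom M T) fun y => zeta y.1 :=
  BddLip.mk' (K := 1) (L := 1) (fun y hy => zeta_abs_le_one hy.1)
    fun y hy y' hy' => by
      rw [one_mul]; exact (zeta_lipschitz hy.1 hy'.1).trans (abs_fst_sub_le y y')

theorem softmax_bddLip {D : Set (ℝ × (M.S → ℝ) × (M.S → ℝ))} (s : M.S) :
    BddLip D fun y => M.softmax y.2.2 s :=
  BddLip.mk' (K := 1) (L := 2)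
    (fun y _ => by rw [abs_of_pos (MDP.softmax_pos _ _)]; exact MDP.softmax_le_one _ _)
    fun y _ y' _ => (MDP.softmax_lipschitz _ _ s).trans (mul_le_mul_of_nonneg_left
      ((le_max_right _ _).trans (le_max_right _ _)) zero_le_two)

theorem clamp_bddLip {D : Set (ℝ × (M.S → ℝ) × (M.S → ℝ))} {R : ℝ} (hR : 0 ≤ R) (s : M.S) :
    BddLip D fun y => clampV R y.2.1 s :=
  BddLip.mk' (K := R) (L := 1) (fun y _ => clamp_abs_le hR _) fun y _ y' _ => by
    rw [one_mul]
    refine (clamp_lipschitz R _ _).trans ?_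
    rw [← Real.dist_eq]
    exact (dist_le_pi_dist y.2.1 y'.2.1 s).trans ((le_max_left _ _).trans (le_max_right _ _))

theorem polY_bddLip (s : M.S) : BddLip (timeDom M T) fun y => polY M y s := by
  have h := (eta_bddLip (M := M) (T := T)).mul (BddLip.const (1 / (Fintype.card M.A : ℝ)))
  have h' := ((BddLip.const 1).sub (eta_bddLip (M := M) (T := T))).mul (softmax_bddLip s)
  refine (h.add h').congr fun y _ => ?_
  simp [polY, MDP.explore, div_eq_mul_inv]

theorem polY_isPositivePolicy (y : ℝ × (M.S → ℝ) × (M.S → ℝ)) : M.IsPositivePolicy (polY M y) :=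
  MDP.explore_softmax_isPositivePolicy _ _

/-- `eta` is decreasing, so its value at `T` is a lower bound for the exploration on all of `[0,
T]`. This places all policies in one compact set. -/
theorem polY_mem_policies {y : ℝ × (M.S → ℝ) × (M.S → ℝ)} (hy : y ∈ timeDom M T) :
    polY M y ∈ M.policies (eta T / (Fintype.card M.A : ℝ)) :=
  MDP.explore_mem_policies (eta_anti hy.1 hy.2) (eta_le_one _) (MDP.softmax_isPositivePolicy _)

theorem stationary_polY_bddLip {q : M.S → M.X → ℝ} (hq : GoodKernel M q) (s : M.S) :
    BddLip (timeDom M T) fun y => stationary (M.trans q (polY M y)) s :=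
  (hq.stationary_bddLip s).comp_pi (fun y _ => polY_isPositivePolicy y) polY_bddLip

theorem fieldQ_bddLip (hp : GoodKernel M M.p) {R : ℝ} (hR : 0 ≤ R) (s : M.S) :
    BddLip (timeDom M T) fun y => fieldQ M m y.1 (clampV R y.2.1) y.2.2 s := by
  refine (BddLip.const _).mul (BddLip.sum _ fun s' => BddLip.sum _ fun s'' => ?_)
  exact ((((((BddLip.const _).add ((BddLip.const _).mul (clamp_bddLip hR s''))).sub
    (clamp_bddLip hR s')).mul (BddLip.const _)).mul (stationary_polY_bddLip hp s')).mul
    (polY_bddLip s'')).mul (BddLip.const _)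

theorem fieldP_bddLip (hp : GoodKernel M M.pAux) {R : ℝ} (hR : 0 ≤ R) (s : M.S) :
    BddLip (timeDom M T) fun y => fieldP M m y.1 (clampV R y.2.1) y.2.2 s := by
  refine BddLip.sum _ fun s' => BddLip.sum _ fun a'' => ?_
  exact (((zeta_bddLip.mul (clamp_bddLip hR s')).mul (BddLip.const _)).mul
    (softmax_bddLip _)).mul (stationary_polY_bddLip hp s')

/-- Linear growth in the critic, uniform in time and in the actor and without truncation; it is the
input of the Gronwall estimate that makes truncation harmless. -/
theorem fieldQ_abs_le (hp : GoodKernel M M.p) :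
    ∃ A : ℝ, 0 ≤ A ∧ ∀ t (q P : M.S → ℝ) s, |fieldQ M m t q P s| ≤ A * (1 + 2 * ‖q‖) := by
  refine ⟨m.alp * ∑ s, ∑ s', ∑ _s'' : M.S, |kerB M m m.nu s s'|,
    mul_nonneg m.alp_pos.le (by positivity), fun t q P s => ?_⟩
  unfold fieldQ
  rw [abs_mul, abs_of_pos m.alp_pos, mul_assoc]
  refine mul_le_mul_of_nonneg_left ?_ m.alp_pos.le
  have hq : 0 ≤ 1 + 2 * ‖q‖ := by positivity
  refine le_trans ?_ (mul_le_mul_of_nonneg_right (Finset.single_le_sum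
    (f := fun s => ∑ s', ∑ _s'' : M.S, |kerB M m m.nu s s'|)
    (fun s _ => by positivity) (Finset.mem_univ s)) hq)
  simp only [Finset.sum_mul]
  refine (Finset.abs_sum_le_sum_abs _ _).trans (Finset.sum_le_sum fun s' _ => ?_)
  refine (Finset.abs_sum_le_sum_abs _ _).trans (Finset.sum_le_sum fun s'' _ => ?_)
  have hpol := MDP.explore_softmax_isPositivePolicy t P
  have h1 : |M.r s' + M.gam * q s'' - q s'| ≤ 1 + 2 * ‖q‖ := by
    have a1 := abs_le.2 (M.r_mem s')
    have a2 := norm_le_pi_norm q s'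
    have a3 := norm_le_pi_norm q s''
    rw [Real.norm_eq_abs] at a2 a3
    have a4 : |M.gam * q s''| ≤ ‖q‖ := by
      rw [abs_mul, abs_of_pos M.gam_pos]
      exact (mul_le_of_le_one_left (abs_nonneg _) M.gam_lt_one.le).trans a3
    have a5 := abs_sub (M.r s' + M.gam * q s'') (q s')
    have a6 := abs_add_le (M.r s') (M.gam * q s'')
    linarith
  have h2 := hp.stationary_mem hpol s'
  have h3 := hpol.le_one s''
  have h3' := (hpol.1 s'').le
  have h4 : M.p s' s''.1 ≤ 1 := by
    rw [← M.p_sum s']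
    exact Finset.single_le_sum (f := M.p s') (fun y _ => M.p_nonneg s' y) (Finset.mem_univ _)
  have h4' := M.p_nonneg s' s''.1
  rw [abs_mul, abs_mul, abs_mul, abs_mul, abs_of_nonneg h4', abs_of_nonneg h3',
    abs_of_nonneg (show 0 ≤ M.statPi _ s' from h2.1)]
  calc _ ≤ (1 + 2 * ‖q‖) * |kerB M m m.nu s s'| * 1 * 1 * 1 := by
        gcongr
        · exact h2.1
        · exact h2.2
    _ = _ := by ring

theorem continuousOn_comp_of_dist_le {E : Type*} [PseudoMetricSpace E] {v : ℝ → E → E} {K : ℝ}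
    (hK0 : 0 ≤ K) (hK : ∀ t ∈ Set.Icc 0 T, ∀ u ∈ Set.Icc 0 T, ∀ x y,
      dist (v t x) (v u y) ≤ K * dist (t, x) (u, y)) {α : ℝ → E}
    (hα : ContinuousOn α (Set.Icc 0 T)) : ContinuousOn (fun t => v t (α t)) (Set.Icc 0 T) := by
  have h1 : LipschitzOnWith ⟨K, hK0⟩ (fun y : ℝ × E => v y.1 y.2) (Set.Icc 0 T ×ˢ Set.univ) :=
    LipschitzOnWith.of_dist_le_mul fun y hy y' hy' => hK _ hy.1 _ hy'.1 _ _
  exact h1.continuousOn.comp (continuousOn_id.prodMk hα) fun t ht => ⟨ht, Set.mem_univ _⟩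

/-- A field bounded by `K` everywhere cannot leave the ball of radius `K * T` before time `T`, so
the local Picard-Lindelöf theorem on that ball covers the whole interval. -/
theorem exists_global_solution {E : Type*} [NormedAddCommGroup E] [NormedSpace ℝ E]
    [CompleteSpace E] (hT : 0 ≤ T) {v : ℝ → E → E} {K : ℝ} (hK0 : 0 ≤ K)
    (hK : ∀ t ∈ Set.Icc 0 T, ∀ u ∈ Set.Icc 0 T, ∀ x y,
      dist (v t x) (v u y) ≤ K * dist (t, x) (u, y))
    (hL : ∀ t ∈ Set.Icc 0 T, ∀ x, ‖v t x‖ ≤ K) :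
    ∃ α : ℝ → E, α 0 = 0 ∧ ∀ t ∈ Set.Icc 0 T, HasDerivWithinAt α (v t (α t)) (Set.Icc 0 T) t := by
  lift K to NNReal using hK0
  lift T to NNReal using hT
  have h : IsPicardLindelof v (tmin := 0) (tmax := T) ⟨0, le_rfl, T.2⟩ 0 (K * T) 0 K K :=
    { lipschitzOnWith := fun t ht => LipschitzOnWith.of_dist_le_mul fun x _ y _ =>
        (hK t ht t ht x y).trans (by simp [Prod.dist_eq])
      continuousOn := fun x _ => continuousOn_comp_of_dist_le K.2 hK continuousOn_const
      norm_le := fun t ht x _ => hL t ht x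
      mul_max_le := by simp }
  exact h.exists_eq_forall_mem_Icc_hasDerivWithinAt₀

theorem eq_integral_of_hasDerivWithinAt {f f' : ℝ → ℝ} (h0 : f 0 = 0)
    (hf : ∀ t ∈ Set.Icc 0 T, HasDerivWithinAt f (f' t) (Set.Icc 0 T) t)
    (hf' : ContinuousOn f' (Set.Icc 0 T)) {t : ℝ} (ht : t ∈ Set.Icc 0 T) :
    f t = ∫ u in (0 : ℝ)..t, f' u := by
  have hsub : Set.Icc 0 t ⊆ Set.Icc 0 T := Set.Icc_subset_Icc_right ht.2
  rw [intervalIntegral.integral_eq_sub_of_hasDerivAt_of_le ht.1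
    (fun u hu => ((hf u (hsub hu)).mono hsub).continuousWithinAt)
    (fun u hu => (hf u (hsub (Set.Ioo_subset_Icc_self hu))).hasDerivAt
      (Icc_mem_nhds hu.1 (hu.2.trans_le ht.2)))
    ((hf'.mono hsub).intervalIntegrable_of_Icc ht.1), h0, sub_zero]

/-- The field is quadratic in critic and critic-independent factors at most, but only after
truncating the critic is it globally bounded and Lipschitz. The truncated equation is solved, and
its solution is shown to stay below the truncation level. -/
theorem exists_isLimit (hp : GoodKernel M M.p) (hp' : GoodKernel M M.pAux) (hT : 0 ≤ T) :
    ∃ Q P : ℝ → M.S → ℝ, IsLimit M m T Q P := by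
  obtain ⟨A, hA0, hA⟩ := fieldQ_abs_le (m := m) hp
  -- The level is the Gronwall bound for `‖Q'‖ ≤ A + 2 * A * ‖Q‖`. There is no circularity, since
  -- `A` does not depend on `R`.
  set R := |gronwallBound 0 (2 * A) A T| with hR
  have hR0 : 0 ≤ R := abs_nonneg _
  obtain ⟨K₁, hK₁0, hb₁, hl₁⟩ := BddLip.uniform fun s =>
    fieldQ_bddLip (m := m) (T := T) hp hR0 s
  obtain ⟨K₂, hK₂0, hb₂, hl₂⟩ := BddLip.uniform fun s =>
    fieldP_bddLip (m := m) (T := T) hp' hR0 s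
  have hK : 0 ≤ K₁ + K₂ := by positivity
  obtain ⟨v, hv1, hv2⟩ : ∃ v : ℝ → (M.S → ℝ) × (M.S → ℝ) → (M.S → ℝ) × (M.S → ℝ),
      (∀ t x s, (v t x).1 s = fieldQ M m t (clampV R x.1) x.2 s) ∧
      ∀ t x s, (v t x).2 s = fieldP M m t (clampV R x.1) x.2 s :=
    ⟨fun t x => (fun s => fieldQ M m t (clampV R x.1) x.2 s,
      fun s => fieldP M m t (clampV R x.1) x.2 s), fun _ _ _ => rfl, fun _ _ _ => rfl⟩
  have hdist : ∀ t ∈ Set.Icc 0 T, ∀ u ∈ Set.Icc 0 T, ∀ x y,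
      dist (v t x) (v u y) ≤ (K₁ + K₂) * dist (t, x) (u, y) := by
    intro t ht u hu x y
    have hd := dist_nonneg (x := (t, x)) (y := (u, y))
    rw [Prod.dist_eq, max_le_iff, dist_pi_le_iff (by positivity), dist_pi_le_iff (by positivity)]
    refine ⟨fun s => ?_, fun s => ?_⟩
    · rw [Real.dist_eq, hv1, hv1]
      exact (hl₁ s (t, x) ht (u, y) hu).trans (mul_le_mul_of_nonneg_right (by linarith) hd)
    · rw [Real.dist_eq, hv2, hv2]
      exact (hl₂ s (t, x) ht (u, y) hu).trans (mul_le_mul_of_nonneg_right (by linarith) hd)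
  obtain ⟨α, hα0, hα⟩ := exists_global_solution hT hK hdist (fun t ht x => by
      rw [Prod.norm_def, max_le_iff, pi_norm_le_iff_of_nonneg hK, pi_norm_le_iff_of_nonneg hK]
      refine ⟨fun s => ?_, fun s => ?_⟩
      · rw [Real.norm_eq_abs, hv1]
        exact (hb₁ s (t, x) ht).trans (by linarith)
      · rw [Real.norm_eq_abs, hv2]
        exact (hb₂ s (t, x) ht).trans (by linarith))
  have hαc : ContinuousOn α (Set.Icc 0 T) := fun t ht => (hα t ht).continuousWithinAt
  have hQ : ∀ t ∈ Set.Icc 0 T, HasDerivWithinAt (fun t => (α t).1) (v t (α t)).1 (Set.Icc 0 T) t :=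
    fun t ht => (hα t ht).fst
  have hP : ∀ t ∈ Set.Icc 0 T, HasDerivWithinAt (fun t => (α t).2) (v t (α t)).2 (Set.Icc 0 T) t :=
    fun t ht => (hα t ht).snd
  have hbound : ∀ t ∈ Set.Icc 0 T, ‖(α t).1‖ ≤ R := by
    intro t ht
    have h := norm_le_gronwallBound_of_norm_deriv_right_le (f := fun t => (α t).1)
      (f' := fun t => (v t (α t)).1) (δ := 0) (K := 2 * A) (ε := A) (a := 0) (b := T)
      (fun t ht => (hQ t ht).continuousWithinAt)
      (fun u hu => (hQ u (Set.Ico_subset_Icc_self hu)).mono_of_mem_nhdsWithin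
        (Icc_mem_nhdsGE_of_mem hu))
      (by simp [hα0]) (fun u hu => by
        rw [pi_norm_le_iff_of_nonneg (by positivity)]
        intro s
        rw [Real.norm_eq_abs, hv1]
        refine (hA u _ _ s).trans ?_
        -- Truncation only decreases the norm, so the truncated equation satisfies the same
        -- differential inequality.
        have := mul_le_mul_of_nonneg_left (norm_clampV_le hR0 (α u).1) hA0
        linarith) t ht
    refine h.trans ((gronwallBound_mono le_rfl hA0 (by positivity) ?_).trans (le_abs_self _))
    linarith [ht.2]
  refine ⟨fun t => (α t).1, fun t => (α t).2, continuous_fst.comp_continuousOn hαc,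
    continuous_snd.comp_continuousOn hαc, fun t ht s => ?_, fun t ht s => ?_⟩
  · have h := eq_integral_of_hasDerivWithinAt (f := fun t => (α t).1 s)
      (f' := fun t => (v t (α t)).1 s) (by simp [hα0])
      (fun u hu => (hasDerivWithinAt_pi.1 (hQ u hu)) s)
      ((continuous_apply s).comp_continuousOn
        (continuous_fst.comp_continuousOn (continuousOn_comp_of_dist_le hK hdist hαc))) ht
    rw [h, ← intervalIntegral.integral_const_mul]
    refine intervalIntegral.integral_congr fun u hu => ?_
    rw [Set.uIcc_of_le ht.1] at hu
    rw [hv1, clampV_eq (hbound u ⟨hu.1, hu.2.trans ht.2⟩)]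
    rfl
  · have h := eq_integral_of_hasDerivWithinAt (f := fun t => (α t).2 s)
      (f' := fun t => (v t (α t)).2 s) (by simp [hα0])
      (fun u hu => (hasDerivWithinAt_pi.1 (hP u hu)) s)
      ((continuous_apply s).comp_continuousOn
        (continuous_snd.comp_continuousOn (continuousOn_comp_of_dist_le hK hdist hαc))) ht
    rw [h]
    refine intervalIntegral.integral_congr fun u hu => ?_
    rw [Set.uIcc_of_le ht.1] at hu
    rw [hv2, clampV_eq (hbound u ⟨hu.1, hu.2.trans ht.2⟩)]
    rfl

end Limit

/-! ### Deterministic estimates along a training path -/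

section Network

variable {dx da : ℕ} (M : MDP dx da) (m : Model dx da)

/-- The activation of a unit with weight `w` at a state-action pair. -/
def actAt (w : Feat dx da) (s : M.S) : ℝ := m.act (inner ℝ w (M.feat s))

/-- The derivative of the activation of a unit with weight `w` at a state-action pair. -/
def derAt (w : Feat dx da) (s : M.S) : ℝ := deriv m.act (inner ℝ w (M.feat s))

/-- `K` bounds the inputs, the activation function and its derivatives. -/
structure ActBound (K : ℝ) : Prop where
  one_le : 1 ≤ K
  feat_le : ∀ s, ‖M.feat s‖ ≤ K
  act_le : ∀ w s, |actAt M m w s| ≤ K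
  der_le : ∀ w s, |derAt M m w s| ≤ K
  act_sub : ∀ w w' s, |actAt M m w' s - actAt M m w s| ≤ K * ‖w' - w‖
  der_sub : ∀ w w' s, |derAt M m w' s - derAt M m w s| ≤ K * ‖w' - w‖
  taylor : ∀ w w' s, |actAt M m w' s - actAt M m w s -
    derAt M m w s * inner ℝ (w' - w) (M.feat s)| ≤ K * ‖w' - w‖ ^ 2

theorem abs_sub_le_of_deriv_le {f : ℝ → ℝ} {K : ℝ} (hf : Differentiable ℝ f)
    (hK : ∀ x, |deriv f x| ≤ K) (x y : ℝ) : |f y - f x| ≤ K * |y - x| :=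
  convex_univ.norm_image_sub_le_of_norm_deriv_le (fun x _ => hf x) (fun x _ => hK x)
    (Set.mem_univ x) (Set.mem_univ y)

/-- Mean value inequality for `z ↦ f z - f' x * z` on the segment, whose derivative is at most `K *
|y - x|`. The missing factor `1 / 2` is immaterial. -/
theorem abs_taylor_le_of_deriv_lipschitz {f : ℝ → ℝ} {K : ℝ} (hf : Differentiable ℝ f)
    (hK : ∀ x y, |deriv f y - deriv f x| ≤ K * |y - x|) (x y : ℝ) :
    |f y - f x - deriv f x * (y - x)| ≤ K * |y - x| ^ 2 := by
  have hK0 : 0 ≤ K := by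
    have := hK 0 1
    simp only [sub_zero, abs_one, mul_one] at this
    exact (abs_nonneg _).trans this
  have hg : ∀ z, HasDerivAt (fun z => f z - deriv f x * z) (deriv f z - deriv f x) z := fun z => by
    have h := (hf z).hasDerivAt.sub ((hasDerivAt_id z).const_mul (deriv f x))
    rw [mul_one] at h
    exact h
  have h := (convex_uIcc x y).norm_image_sub_le_of_norm_hasDerivWithin_le
    (C := K * |y - x|) (fun z _ => (hg z).hasDerivWithinAt)
    (fun z hz => (hK x z).trans (mul_le_mul_of_nonneg_left
      (Set.abs_sub_left_of_mem_uIcc hz) hK0)) Set.left_mem_uIcc Set.right_mem_uIcc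
  rw [Real.norm_eq_abs, Real.norm_eq_abs] at h
  calc _ = |f y - deriv f x * y - (f x - deriv f x * x)| := by congr 1; ring
    _ ≤ _ := h
    _ = _ := by ring

theorem exists_actBound : ∃ K, ActBound M m K := by
  obtain ⟨K, hK⟩ := m.act_bdd
  have hd0 : Differentiable ℝ m.act := m.act_contDiff.differentiable (by norm_num)
  have hd1 : Differentiable ℝ (deriv m.act) := by
    have h : ContDiff ℝ 1 (deriv m.act) :=
      (contDiff_succ_iff_deriv.1 (m.act_contDiff.of_le (m := 1 + 1) (by norm_num))).2.2
    exact h.differentiable (by norm_num)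
  have hK0 : ∀ x, |m.act x| ≤ K := fun x => by simpa using hK 0 (by norm_num) x
  have hK1 : ∀ x, |deriv m.act x| ≤ K := fun x => by
    simpa [iteratedDeriv_one] using hK 1 (by norm_num) x
  have hK2 : ∀ x, |deriv (deriv m.act) x| ≤ K := fun x => by
    simpa [iteratedDeriv_succ, iteratedDeriv_one] using hK 2 (by norm_num) x
  have hKn : 0 ≤ K := (abs_nonneg _).trans (hK0 0)
  set F := 1 + ∑ s, ‖M.feat s‖ with hF
  have hF1 : 1 ≤ F := le_add_of_nonneg_right (Finset.sum_nonneg fun _ _ => norm_nonneg _)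
  have hFs : ∀ s, ‖M.feat s‖ ≤ F := fun s =>
    (Finset.single_le_sum (f := fun s => ‖M.feat s‖) (fun _ _ => norm_nonneg _)
      (Finset.mem_univ s)).trans (by linarith)
  have hin : ∀ w w' s, |inner ℝ w' (M.feat s) - inner ℝ w (M.feat s)| ≤ ‖w' - w‖ * F := by
    intro w w' s
    rw [← inner_sub_left]
    exact (abs_real_inner_le_norm _ _).trans (mul_le_mul_of_nonneg_left (hFs s) (norm_nonneg _))
  have hF2 : F ≤ F ^ 2 := by nlinarith
  have hKF : K * F ≤ K * F ^ 2 := mul_le_mul_of_nonneg_left hF2 hKn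
  have hKF2 : 0 ≤ K * F ^ 2 := by positivity
  have hK' : K ≤ F + K * F ^ 2 := by nlinarith
  -- `F ≥ 1` bounds the inputs and makes the constant at least `1`; `K * F ^ 2` covers the Taylor
  -- remainder, in which the input norm enters squared.
  refine ⟨F + K * F ^ 2, ?_, fun s => ?_, fun w s => (hK0 _).trans hK',
    fun w s => (hK1 _).trans hK', fun w w' s => ?_, fun w w' s => ?_, fun w w' s => ?_⟩
  · linarith
  · linarith [hFs s]
  · refine (abs_sub_le_of_deriv_le hd0 hK1 _ _).trans ?_
    have := mul_le_mul_of_nonneg_left (hin w w' s) hKn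
    have := mul_le_mul_of_nonneg_right (show K * F ≤ F + K * F ^ 2 by linarith)
      (norm_nonneg (w' - w))
    linarith
  · refine (abs_sub_le_of_deriv_le hd1 hK2 _ _).trans ?_
    have := mul_le_mul_of_nonneg_left (hin w w' s) hKn
    have := mul_le_mul_of_nonneg_right (show K * F ≤ F + K * F ^ 2 by linarith)
      (norm_nonneg (w' - w))
    linarith
  · unfold actAt derAt
    rw [inner_sub_left]
    refine (abs_taylor_le_of_deriv_lipschitz hd0
      (fun x y => abs_sub_le_of_deriv_le hd1 hK2 x y) _ _).trans ?_
    have h1 := pow_le_pow_left₀ (abs_nonneg _) (hin w w' s) 2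
    have h2 := mul_le_mul_of_nonneg_left h1 hKn
    have h3 := mul_nonneg (zero_le_one.trans hF1) (sq_nonneg ‖w' - w‖)
    nlinarith

/-- The integrand of the kernel `kerB`. -/
def kerFun (s s' : M.S) (z : ℝ × Feat dx da) : ℝ :=
  actAt M m z.2 s * actAt M m z.2 s' +
    z.1 ^ 2 * derAt M m z.2 s * derAt M m z.2 s' * inner ℝ (M.feat s) (M.feat s')

/-- The kernel for the empirical distribution of the parameters. -/
def kerN {N : ℕ} (th : Params dx da N) (s s' : M.S) : ℝ := 1 / (N : ℝ) * ∑ i, kerFun M m s s' (th i)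

/-- A gradient step with step size `κ` for the signed measure `μ` on the state-action pairs. -/
def gradStep {N : ℕ} (κ : ℝ) (μ : M.S → ℝ) (th : Params dx da N) : Params dx da N := fun i =>
  ((th i).1 + κ * ∑ s, μ s * actAt M m (th i).2 s,
   (th i).2 + κ • ∑ s, μ s • (((th i).1 * derAt M m (th i).2 s) • M.feat s))

open Classical in
/-- The weights of the policy gradient at `s` for the softmax of `P`. -/
def actorWeight (P : M.S → ℝ) (s s' : M.S) : ℝ :=
  (if s' = s then 1 else 0) - if s'.1 = s.1 then M.softmax P s' else 0

variable {M m}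

/-- Rewrites "value minus mean under the current policy" as integration against one signed measure.
It is stated for modules because it is needed both for scalars and for the inner weights. -/
theorem sum_actorWeight {E : Type*} [AddCommGroup E] [Module ℝ E] (P : M.S → ℝ) (s : M.S)
    (h : M.S → E) : ∑ s', actorWeight M P s s' • h s' =
      h s - ∑ a : M.A, M.softmax P (s.1, a) • h (s.1, a) := by
  classical
  simp only [actorWeight, sub_smul, Finset.sum_sub_distrib, ite_smul, one_smul, zero_smul]
  congr 1
  · simp
  · rw [Fintype.sum_prod_type]
    have : ∀ x : M.X, (∑ a : M.A, if x = s.1 then M.softmax P (x, a) • h (x, a) else 0) =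
        if x = s.1 then ∑ a : M.A, M.softmax P (x, a) • h (x, a) else 0 := fun x => by
      split_ifs <;> simp
    simp only [this, Finset.sum_ite_eq', Finset.mem_univ, if_true]

theorem sum_abs_actorWeight (P : M.S → ℝ) (s : M.S) : ∑ s', |actorWeight M P s s'| ≤ 2 := by
  classical
  have h1 : ∀ s', |actorWeight M P s s'| ≤
      (if s' = s then (1 : ℝ) else 0) + if s'.1 = s.1 then M.softmax P s' else 0 := fun s' => by
    unfold actorWeight
    refine (abs_sub _ _).trans (add_le_add ?_ ?_)
    · split_ifs <;> simp
    · split_ifs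
      · rw [abs_of_pos (MDP.softmax_pos P s')]
      · simp
  refine (Finset.sum_le_sum fun s' _ => h1 s').trans ?_
  rw [Finset.sum_add_distrib, Fintype.sum_prod_type (f := fun s' : M.X × M.A =>
    if s'.1 = s.1 then M.softmax P s' else 0)]
  have : ∀ x : M.X, (∑ a : M.A, if x = s.1 then M.softmax P (x, a) else 0) =
      if x = s.1 then ∑ a : M.A, M.softmax P (x, a) else 0 := fun x => by
    split_ifs <;> simp
  simp only [this, MDP.softmax_sum]
  simp
  norm_num

/-- Critic and actor updates are both instances of `gradStep`, with a point mass and with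
`actorWeight` as signed measure; a single analysis covers the two. -/
theorem criticStep_eq {N : ℕ} [DecidableEq M.S] (om : Params dx da N) (s s' : M.S) :
    criticStep M m om s s' = gradStep M m (m.rateCritic N / (N : ℝ) ^ m.bet *
      (M.r s + M.gam * netOn M m om s' - netOn M m om s)) (Pi.single s 1) om := by
  funext i
  simp [criticStep, gradStep, actAt, derAt, Pi.single_apply, smul_smul, mul_assoc]

theorem actorStep_eq {N : ℕ} (k : ℕ) (om th : Params dx da N) (s : M.S) :
    actorStep M m k om th s = gradStep M m (m.rateActor N k / (N : ℝ) ^ m.bet * netOn M m om s)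
      (actorWeight M (netOn M m th) s) th := by
  funext i
  have h1 := sum_actorWeight (netOn M m th) s fun s' => actAt M m (th i).2 s'
  have h2 := sum_actorWeight (netOn M m th) s fun s' =>
    ((th i).1 * derAt M m (th i).2 s') • M.feat s'
  simp only [smul_eq_mul] at h1
  simp only [gradStep, h1, h2]
  simp [actorStep, actorModel, actAt, derAt, smul_smul]

variable {K : ℝ}

theorem abs_net_le (hK : ActBound M m K) {N : ℕ} {th : Params dx da N} {c : ℝ}
    (hc : ∀ i, |(th i).1| ≤ c) (s : M.S) :
    |netOn M m th s| ≤ 1 / (N : ℝ) ^ m.bet * (N * (c * K)) := by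
  unfold netOn Model.net
  rw [abs_mul, abs_of_nonneg (by positivity : (0 : ℝ) ≤ 1 / (N : ℝ) ^ m.bet)]
  refine mul_le_mul_of_nonneg_left ((Finset.abs_sum_le_sum_abs _ _).trans ?_) (by positivity)
  refine (Finset.sum_le_card_nsmul _ _ (c * K) fun i _ => ?_).trans (by simp)
  rw [abs_mul]
  exact mul_le_mul (hc i) (hK.act_le (th i).2 s) (abs_nonneg _) ((abs_nonneg _).trans (hc i))

theorem abs_kerFun_sub_le (hK : ActBound M m K) {c : ℝ} {z z' : ℝ × Feat dx da} (hz : |z.1| ≤ c)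
    (hz' : |z'.1| ≤ c) (s s' : M.S) : |kerFun M m s s' z' - kerFun M m s s' z| ≤
      (2 * K ^ 2 + 2 * c * K ^ 4 + 2 * c ^ 2 * K ^ 4) * (|z'.1 - z.1| + ‖z'.2 - z.2‖) := by
  have hK0 : 0 ≤ K := zero_le_one.trans hK.one_le
  have hc : 0 ≤ c := (abs_nonneg _).trans hz
  have hi : |inner ℝ (M.feat s) (M.feat s')| ≤ K ^ 2 := by
    rw [sq]
    exact (abs_real_inner_le_norm _ _).trans
      (mul_le_mul (hK.feat_le s) (hK.feat_le s') (norm_nonneg _) hK0)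
  have hprod : ∀ {a b a' b' : ℝ}, |a'| ≤ K → |b| ≤ K → |a' - a| ≤ K * ‖z'.2 - z.2‖ →
      |b' - b| ≤ K * ‖z'.2 - z.2‖ → |a' * b' - a * b| ≤ 2 * K ^ 2 * ‖z'.2 - z.2‖ := by
    intro a b a' b' h1 h2 h3 h4
    have e : a' * b' - a * b = a' * (b' - b) + (a' - a) * b := by ring
    rw [e]
    refine (abs_add_le _ _).trans ?_
    rw [abs_mul, abs_mul]
    have := mul_le_mul h1 h4 (abs_nonneg _) hK0
    have := mul_le_mul h3 h2 (abs_nonneg _) (by positivity)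
    linarith
  have h1 := hprod (hK.act_le z'.2 s) (hK.act_le z.2 s') (hK.act_sub z.2 z'.2 s)
    (hK.act_sub z.2 z'.2 s')
  have h2 := hprod (hK.der_le z'.2 s) (hK.der_le z.2 s') (hK.der_sub z.2 z'.2 s)
    (hK.der_sub z.2 z'.2 s')
  have h3 : |derAt M m z.2 s * derAt M m z.2 s'| ≤ K ^ 2 := by
    rw [abs_mul, sq]
    exact mul_le_mul (hK.der_le _ _) (hK.der_le _ _) (abs_nonneg _) hK0
  have h4 : |z'.1 ^ 2 - z.1 ^ 2| ≤ 2 * c * |z'.1 - z.1| := by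
    have e : z'.1 ^ 2 - z.1 ^ 2 = (z'.1 + z.1) * (z'.1 - z.1) := by ring
    rw [e, abs_mul]
    refine mul_le_mul_of_nonneg_right ((abs_add_le _ _).trans (by linarith)) (abs_nonneg _)
  have h5 : |z'.1 ^ 2| ≤ c ^ 2 := by
    rw [abs_pow]
    exact pow_le_pow_left₀ (abs_nonneg _) hz' 2
  have e : kerFun M m s s' z' - kerFun M m s s' z =
      (actAt M m z'.2 s * actAt M m z'.2 s' - actAt M m z.2 s * actAt M m z.2 s') +
      (z'.1 ^ 2 * (derAt M m z'.2 s * derAt M m z'.2 s' - derAt M m z.2 s * derAt M m z.2 s') +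
        (z'.1 ^ 2 - z.1 ^ 2) * (derAt M m z.2 s * derAt M m z.2 s')) *
        inner ℝ (M.feat s) (M.feat s') := by
    unfold kerFun
    ring
  rw [e]
  refine (abs_add_le _ _).trans ?_
  rw [abs_mul]
  have h6 := (abs_add_le (z'.1 ^ 2 * (derAt M m z'.2 s * derAt M m z'.2 s' -
    derAt M m z.2 s * derAt M m z.2 s')) ((z'.1 ^ 2 - z.1 ^ 2) *
      (derAt M m z.2 s * derAt M m z.2 s')))
  rw [abs_mul (z'.1 ^ 2), abs_mul (z'.1 ^ 2 - z.1 ^ 2)] at h6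
  have h7 := mul_le_mul h5 h2 (abs_nonneg _) (by positivity)
  have h8 := mul_le_mul h4 h3 (abs_nonneg _) (by positivity)
  have h9 := mul_le_mul (h6.trans (add_le_add h7 h8)) hi (abs_nonneg _) (by positivity)
  have h10 : 0 ≤ |z'.1 - z.1| := abs_nonneg _
  have h11 : 0 ≤ ‖z'.2 - z.2‖ := norm_nonneg _
  have h12 : 0 ≤ 2 * K ^ 2 * |z'.1 - z.1| := by positivity
  have h13 : 0 ≤ 2 * c * K ^ 4 * ‖z'.2 - z.2‖ := by positivity
  have h14 : 0 ≤ 2 * c ^ 2 * K ^ 4 * |z'.1 - z.1| := by positivity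
  nlinarith

theorem gradStep_fst_sub_le (hK : ActBound M m K) {N : ℕ} {κ κ0 : ℝ} {μ : M.S → ℝ}
    (hκ : |κ| ≤ κ0) (hμ : ∑ s, |μ s| ≤ 2) (th : Params dx da N) (i : Fin N) :
    |(gradStep M m κ μ th i).1 - (th i).1| ≤ 2 * K * κ0 := by
  have hK0 : 0 ≤ K := zero_le_one.trans hK.one_le
  simp only [gradStep, add_sub_cancel_left, abs_mul]
  have h : |∑ s, μ s * actAt M m (th i).2 s| ≤ 2 * K := by
    refine (Finset.abs_sum_le_sum_abs _ _).trans ?_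
    calc _ ≤ ∑ s, |μ s| * K := Finset.sum_le_sum fun s _ => by
          rw [abs_mul]
          exact mul_le_mul_of_nonneg_left (hK.act_le _ _) (abs_nonneg _)
      _ ≤ 2 * K := by
          rw [← Finset.sum_mul]
          exact mul_le_mul_of_nonneg_right hμ hK0
  calc _ ≤ κ0 * (2 * K) := mul_le_mul hκ h (abs_nonneg _) ((abs_nonneg _).trans hκ)
    _ = _ := by ring

theorem gradStep_snd_sub_le (hK : ActBound M m K) {N : ℕ} {κ κ0 c : ℝ} {μ : M.S → ℝ}
    (hκ : |κ| ≤ κ0) (hμ : ∑ s, |μ s| ≤ 2) {th : Params dx da N} {i : Fin N} (hc : |(th i).1| ≤ c) :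
    ‖(gradStep M m κ μ th i).2 - (th i).2‖ ≤ 2 * c * K ^ 2 * κ0 := by
  have hK0 : 0 ≤ K := zero_le_one.trans hK.one_le
  have hc0 : 0 ≤ c := (abs_nonneg _).trans hc
  simp only [gradStep, add_sub_cancel_left, norm_smul, Real.norm_eq_abs]
  have h : ‖∑ s, μ s • (((th i).1 * derAt M m (th i).2 s) • M.feat s)‖ ≤ 2 * (c * K * K) := by
    refine (norm_sum_le _ _).trans ?_
    calc _ ≤ ∑ s, |μ s| * (c * K * K) := Finset.sum_le_sum fun s _ => by
          rw [norm_smul, norm_smul, Real.norm_eq_abs, Real.norm_eq_abs, abs_mul]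
          refine mul_le_mul_of_nonneg_left ?_ (abs_nonneg _)
          exact mul_le_mul (mul_le_mul hc (hK.der_le _ _) (abs_nonneg _) hc0) (hK.feat_le s)
            (norm_nonneg _) (by positivity)
      _ ≤ 2 * (c * K * K) := by
          rw [← Finset.sum_mul]
          exact mul_le_mul_of_nonneg_right hμ (by positivity)
  calc _ ≤ κ0 * (2 * (c * K * K)) := mul_le_mul hκ h (norm_nonneg _) ((abs_nonneg _).trans hκ)
    _ = _ := by ring

theorem net_sub_eq {N : ℕ} (th th' : Params dx da N) (s : M.S) :
    netOn M m th' s - netOn M m th s = 1 / (N : ℝ) ^ m.bet *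
      ∑ i, ((th' i).1 * actAt M m (th' i).2 s - (th i).1 * actAt M m (th i).2 s) := by
  rw [Finset.sum_sub_distrib, mul_sub]
  rfl

theorem gradStep_net_sub_le (hK : ActBound M m K) {N : ℕ} {κ κ0 c : ℝ} {μ : M.S → ℝ}
    (hκ : |κ| ≤ κ0) (hμ : ∑ s, |μ s| ≤ 2) {th : Params dx da N} (hc : ∀ i, |(th i).1| ≤ c)
    (s : M.S) : |netOn M m (gradStep M m κ μ th) s - netOn M m th s| ≤
      1 / (N : ℝ) ^ m.bet * (N * ((2 * K ^ 2 + 2 * c ^ 2 * K ^ 3) * κ0)) := by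
  have hK0 : 0 ≤ K := zero_le_one.trans hK.one_le
  rw [net_sub_eq, abs_mul, abs_of_nonneg (by positivity : (0 : ℝ) ≤ 1 / (N : ℝ) ^ m.bet)]
  refine mul_le_mul_of_nonneg_left ((Finset.abs_sum_le_sum_abs _ _).trans ?_) (by positivity)
  refine (Finset.sum_le_card_nsmul _ _ ((2 * K ^ 2 + 2 * c ^ 2 * K ^ 3) * κ0)
    fun i _ => ?_).trans (by simp)
  have h1 := gradStep_fst_sub_le hK hκ hμ th i
  have h2 := gradStep_snd_sub_le hK hκ hμ (hc i)
  have h3 := hK.act_sub (th i).2 (gradStep M m κ μ th i).2 s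
  have h4 := hK.act_le (gradStep M m κ μ th i).2 s
  set c' := (gradStep M m κ μ th i).1
  set w' := (gradStep M m κ μ th i).2
  have e : c' * actAt M m w' s - (th i).1 * actAt M m (th i).2 s =
      (c' - (th i).1) * actAt M m w' s +
        (th i).1 * (actAt M m w' s - actAt M m (th i).2 s) := by ring
  rw [e]
  refine (abs_add_le _ _).trans ?_
  rw [abs_mul, abs_mul]
  have hc0 : 0 ≤ c := (abs_nonneg _).trans (hc i)
  have h5 := mul_le_mul h1 h4 (abs_nonneg _) ((abs_nonneg _).trans h1)
  have h6 := mul_le_mul (hc i) (h3.trans (mul_le_mul_of_nonneg_left h2 hK0)) (abs_nonneg _) hc0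
  linarith

/-- To first order in the step the output of a unit moves by `Δc * σ + c * σ' * (Δw · s)`. Inserting
the step turns this into the kernel integrand, the two summands of `kerFun` coming from the outer
and the inner weights. The cross term and the Taylor remainder are quadratic in `κ0`. -/
theorem gradStep_linearization (hK : ActBound M m K) {N : ℕ} (hN : 1 ≤ N) {κ κ0 c : ℝ}
    {μ : M.S → ℝ} (hκ : |κ| ≤ κ0) (hμ : ∑ s, |μ s| ≤ 2) {th : Params dx da N}
    (hc : ∀ i, |(th i).1| ≤ c) (s : M.S) :
    |netOn M m (gradStep M m κ μ th) s - netOn M m th s -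
        1 / (N : ℝ) ^ m.bet * (N * (κ * ∑ s', μ s' * kerN M m th s s'))| ≤
      1 / (N : ℝ) ^ m.bet * (N * ((4 * c * K ^ 4 + 4 * c ^ 3 * K ^ 5) * κ0 ^ 2)) := by
  have hK0 : 0 ≤ K := zero_le_one.trans hK.one_le
  have hN0 : (N : ℝ) ≠ 0 := by positivity
  have e1 : (N : ℝ) * (κ * ∑ s', μ s' * kerN M m th s s') =
      ∑ i, κ * ∑ s', μ s' * kerFun M m s s' (th i) := by
    rw [← Finset.mul_sum, Finset.sum_comm]
    simp only [kerN, ← Finset.mul_sum]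
    rw [mul_left_comm, Finset.mul_sum]
    congr 1
    refine Finset.sum_congr rfl fun s' _ => ?_
    field_simp
  rw [net_sub_eq, e1, ← mul_sub, ← Finset.sum_sub_distrib, abs_mul,
    abs_of_nonneg (by positivity : (0 : ℝ) ≤ 1 / (N : ℝ) ^ m.bet)]
  refine mul_le_mul_of_nonneg_left ((Finset.abs_sum_le_sum_abs _ _).trans ?_) (by positivity)
  refine (Finset.sum_le_card_nsmul _ _ ((4 * c * K ^ 4 + 4 * c ^ 3 * K ^ 5) * κ0 ^ 2)
    fun i _ => ?_).trans (by simp)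
  have h1 := gradStep_fst_sub_le hK hκ hμ th i
  have h2 := gradStep_snd_sub_le hK hκ hμ (hc i)
  have h3 := hK.act_sub (th i).2 (gradStep M m κ μ th i).2 s
  have h4 := hK.taylor (th i).2 (gradStep M m κ μ th i).2 s
  have e2 : κ * ∑ s', μ s' * kerFun M m s s' (th i) =
      ((gradStep M m κ μ th i).1 - (th i).1) * actAt M m (th i).2 s + (th i).1 *
        (derAt M m (th i).2 s * inner ℝ ((gradStep M m κ μ th i).2 - (th i).2) (M.feat s)) := by
    simp only [gradStep, add_sub_cancel_left, real_inner_smul_left, sum_inner, kerFun]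
    simp only [Finset.mul_sum, Finset.sum_mul]
    rw [← Finset.sum_add_distrib]
    refine Finset.sum_congr rfl fun s' _ => ?_
    rw [real_inner_comm (M.feat s) (M.feat s')]
    ring
  rw [e2]
  set c' := (gradStep M m κ μ th i).1
  set w' := (gradStep M m κ μ th i).2
  have e : c' * actAt M m w' s - (th i).1 * actAt M m (th i).2 s -
      ((c' - (th i).1) * actAt M m (th i).2 s + (th i).1 *
        (derAt M m (th i).2 s * inner ℝ (w' - (th i).2) (M.feat s))) =
      (c' - (th i).1) * (actAt M m w' s - actAt M m (th i).2 s) +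
        (th i).1 * (actAt M m w' s - actAt M m (th i).2 s -
          derAt M m (th i).2 s * inner ℝ (w' - (th i).2) (M.feat s)) := by ring
  rw [e]
  refine (abs_add_le _ _).trans ?_
  rw [abs_mul, abs_mul]
  have hc0 : 0 ≤ c := (abs_nonneg _).trans (hc i)
  have h5 := mul_le_mul h1 (h3.trans (mul_le_mul_of_nonneg_left h2 hK0)) (abs_nonneg _)
    ((abs_nonneg _).trans h1)
  have h6 := mul_le_mul (hc i) (h4.trans (mul_le_mul_of_nonneg_left
    (pow_le_pow_left₀ (norm_nonneg _) h2 2) hK0)) (abs_nonneg _) hc0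
  have h7 : 2 * K * κ0 * (K * (2 * c * K ^ 2 * κ0)) = 4 * c * K ^ 4 * κ0 ^ 2 := by ring
  have h8 : c * (K * (2 * c * K ^ 2 * κ0) ^ 2) = 4 * c ^ 3 * K ^ 5 * κ0 ^ 2 := by ring
  linarith

end Network

/-! ### Training paths: step sizes, parameter drift and the a priori bound on the critic -/

section Path

variable {dx da : ℕ} {M : MDP dx da} {m : Model dx da}

theorem scale_pos {N : ℕ} (hN : 1 ≤ N) : 0 < (N : ℝ) ^ (m.bet - 1) :=
  Real.rpow_pos_of_pos (by positivity) _

theorem scale_le_one {N : ℕ} (hN : 1 ≤ N) : (N : ℝ) ^ (m.bet - 1) ≤ 1 :=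
  Real.rpow_le_one_of_one_le_of_nonpos (Nat.one_le_cast.2 hN) (by linarith [m.bet_mem.2])

theorem inv_le_scale {N : ℕ} (hN : 1 ≤ N) : 1 / (N : ℝ) ≤ (N : ℝ) ^ (m.bet - 1) := by
  rw [one_div, ← Real.rpow_neg_one]
  exact Real.rpow_le_rpow_of_exponent_le (Nat.one_le_cast.2 hN) (by linarith [m.bet_mem.1])

theorem rpow_bet {N : ℕ} (hN : 1 ≤ N) : (N : ℝ) ^ m.bet = N * (N : ℝ) ^ (m.bet - 1) := by
  have hN0 : (0 : ℝ) < N := by positivity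
  rw [Real.rpow_sub hN0, Real.rpow_one, mul_div_cancel₀ _ hN0.ne']

/-- With `e = N ^ (bet - 1)` the learning rate scales as `e ^ 2` and the network prefactor is `1 /
(N * e)`, so the step size is of order `e / N`. All later powers of `N` are expressed through `e` in
this way. -/
theorem rpow_rate {N : ℕ} (hN : 1 ≤ N) :
    (N : ℝ) ^ (2 - 2 * m.bet) = 1 / ((N : ℝ) ^ (m.bet - 1)) ^ 2 := by
  have hN0 : (0 : ℝ) < N := by positivity
  rw [one_div, ← Real.rpow_natCast, ← Real.rpow_mul hN0.le, ← Real.rpow_neg hN0.le]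
  congr 1
  push_cast
  ring

theorem critic_rate {N : ℕ} (hN : 1 ≤ N) :
    m.rateCritic N / (N : ℝ) ^ m.bet = m.alp * (N : ℝ) ^ (m.bet - 1) / N := by
  have hN0 : (0 : ℝ) < N := by positivity
  have he := scale_pos (m := m) hN
  rw [Model.rateCritic, rpow_rate hN, rpow_bet hN]
  field_simp

theorem actor_rate {N : ℕ} (hN : 1 ≤ N) (k : ℕ) :
    m.rateActor N k / (N : ℝ) ^ m.bet = zeta ((k : ℝ) / N) * (N : ℝ) ^ (m.bet - 1) / N := by
  have hN0 : (0 : ℝ) < N := by positivity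
  have he := scale_pos (m := m) hN
  have hk : 0 < 1 + (k : ℝ) / N := by positivity
  rw [Model.rateActor, rpow_rate hN, rpow_bet hN, zeta]
  generalize 1 + (k : ℝ) / N = x at *
  field_simp

variable {K : ℝ}

theorem abs_kerN_sub_le (hK : ActBound M m K) {N : ℕ} (hN : 1 ≤ N) {c δ : ℝ}
    {th th' : Params dx da N} (hc : ∀ i, |(th i).1| ≤ c) (hc' : ∀ i, |(th' i).1| ≤ c)
    (hδ : ∀ i, |(th' i).1 - (th i).1| + ‖(th' i).2 - (th i).2‖ ≤ δ) (hc0 : 0 ≤ c) (s s' : M.S) :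
    |kerN M m th' s s' - kerN M m th s s'| ≤
      (2 * K ^ 2 + 2 * c * K ^ 4 + 2 * c ^ 2 * K ^ 4) * δ := by
  have hK0 : 0 ≤ K := zero_le_one.trans hK.one_le
  have hN0 : (0 : ℝ) < N := by positivity
  unfold kerN
  rw [← mul_sub, ← Finset.sum_sub_distrib, abs_mul, abs_of_nonneg (by positivity : 0 ≤ 1 / (N : ℝ)),
    one_div, inv_mul_le_iff₀ hN0]
  refine (Finset.abs_sum_le_sum_abs _ _).trans ((Finset.sum_le_card_nsmul _ _
    ((2 * K ^ 2 + 2 * c * K ^ 4 + 2 * c ^ 2 * K ^ 4) * δ) fun i _ => ?_).trans (by simp))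
  exact (abs_kerFun_sub_le hK (hc i) (hc' i) s s').trans
    (mul_le_mul_of_nonneg_left (hδ i) (by positivity))

/-- Networks trained by `gradStep` with small step sizes: the parameters stay close to their initial
values, and the outputs move according to the kernel. -/
theorem exists_gradPath_bound (hK : ActBound M m K) {T κ1 K0 : ℝ} (hT : 0 ≤ T) (hκ1 : 0 ≤ κ1)
    (hK0 : 0 ≤ K0) : ∃ C : ℝ, 0 ≤ C ∧ ∀ N : ℕ, 1 ≤ N → ∀ (th : ℕ → Params dx da N) (κ : ℕ → ℝ)
      (μ : ℕ → M.S → ℝ), (∀ k, th (k + 1) = gradStep M m (κ k) (μ k) (th k)) →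
      (∀ k : ℕ, (k : ℝ) ≤ N * T → |κ k| ≤ κ1 * (N : ℝ) ^ (m.bet - 1) / N) →
      (∀ k, ∑ s, |μ k s| ≤ 2) → (∀ i, |(th 0 i).1| ≤ K0) →
      ∀ (ker : M.S → M.S → ℝ) (E : ℝ), (∀ s s', |kerN M m (th 0) s s' - ker s s'| ≤ E) →
      ∀ k : ℕ, (k : ℝ) ≤ N * T → ∀ s,
        |netOn M m (th (k + 1)) s - netOn M m (th k) s| ≤ C / N ∧
        |netOn M m (th (k + 1)) s - netOn M m (th k) s -
          1 / (N : ℝ) ^ (m.bet - 1) * (κ k * ∑ s', μ k s' * ker s s')| ≤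
            C / N * ((N : ℝ) ^ (m.bet - 1) + E) := by
  have hKn : 0 ≤ K := zero_le_one.trans hK.one_le
  -- `c` bounds the outer weights up to time `T`, `D * e` the total drift of a unit, `L` is the
  -- Lipschitz constant of the kernel, and `A`, `B` are the first- and second-order constants of a
  -- step.
  obtain ⟨c, hc⟩ : ∃ c, c = K0 + 2 * K * κ1 * T := ⟨_, rfl⟩
  have hc0 : 0 ≤ c := hc ▸ by positivity
  obtain ⟨D, hD⟩ : ∃ D, D = (2 * K * κ1 + 2 * c * K ^ 2 * κ1) * T := ⟨_, rfl⟩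
  have hD0 : 0 ≤ D := hD ▸ by positivity
  obtain ⟨L, hL⟩ : ∃ L, L = 2 * K ^ 2 + 2 * c * K ^ 4 + 2 * c ^ 2 * K ^ 4 := ⟨_, rfl⟩
  have hL0 : 0 ≤ L := hL ▸ by positivity
  obtain ⟨A, hA⟩ : ∃ A, A = 2 * K ^ 2 + 2 * c ^ 2 * K ^ 3 := ⟨_, rfl⟩
  have hA0 : 0 ≤ A := hA ▸ by positivity
  obtain ⟨B, hB⟩ : ∃ B, B = 4 * c * K ^ 4 + 4 * c ^ 3 * K ^ 5 := ⟨_, rfl⟩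
  have hB0 : 0 ≤ B := hB ▸ by positivity
  refine ⟨A * κ1 + B * κ1 ^ 2 + 2 * κ1 * (L * D + 1), by positivity,
    fun N hN th κ μ hstep hκ hμ h0 ker E hE => ?_⟩
  have hN0 : (0 : ℝ) < N := by positivity
  have hNb := rpow_bet (m := m) hN
  have he0 := scale_pos (m := m) hN
  have he1 := scale_le_one (m := m) hN
  set e := (N : ℝ) ^ (m.bet - 1)
  have hκ0 : 0 ≤ κ1 * e / N := by positivity
  have hcT : ∀ k : ℕ, (k : ℝ) ≤ N * T → (k : ℝ) * (2 * K * (κ1 * e / N)) ≤ 2 * K * κ1 * T * e := by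
    intro k hk
    calc _ ≤ (N * T) * (2 * K * (κ1 * e / N)) := by gcongr
      _ = _ := by field_simp
  have hfst : ∀ k : ℕ, (k : ℝ) ≤ N * T → ∀ i,
      |(th k i).1 - (th 0 i).1| ≤ k * (2 * K * (κ1 * e / N)) := by
    intro k
    induction k with
    | zero => intro _ i; simp
    | succ k ih =>
      intro hk i
      have hk' : (k : ℝ) ≤ N * T := by push_cast at hk; linarith
      have h1 := gradStep_fst_sub_le hK (hκ k hk') (hμ k) (th k) i
      rw [← hstep k] at h1
      have := abs_sub_le (th (k + 1) i).1 (th k i).1 (th 0 i).1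
      have := ih hk' i
      push_cast
      linarith
  have hcb : ∀ k : ℕ, (k : ℝ) ≤ N * T → ∀ i, |(th k i).1| ≤ c := by
    intro k hk i
    have h1 := (hfst k hk i).trans (hcT k hk)
    have h2 : 2 * K * κ1 * T * e ≤ 2 * K * κ1 * T := mul_le_of_le_one_right (by positivity) he1
    have h3 := abs_sub_abs_le_abs_sub (th k i).1 (th 0 i).1
    linarith [h0 i]
  have hsnd : ∀ k : ℕ, (k : ℝ) ≤ N * T → ∀ i,
      ‖(th k i).2 - (th 0 i).2‖ ≤ k * (2 * c * K ^ 2 * (κ1 * e / N)) := by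
    intro k
    induction k with
    | zero => intro _ i; simp
    | succ k ih =>
      intro hk i
      have hk' : (k : ℝ) ≤ N * T := by push_cast at hk; linarith
      have h1 := gradStep_snd_sub_le hK (hκ k hk') (hμ k) (hcb k hk' i)
      rw [← hstep k] at h1
      have := norm_sub_le_norm_sub_add_norm_sub (th (k + 1) i).2 (th k i).2 (th 0 i).2
      have := ih hk' i
      push_cast
      linarith
  intro k hk s
  have hdrift : ∀ i, |(th k i).1 - (th 0 i).1| + ‖(th k i).2 - (th 0 i).2‖ ≤ D * e := by
    intro i
    have h1 := (hfst k hk i).trans (hcT k hk)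
    have h2 : (k : ℝ) * (2 * c * K ^ 2 * (κ1 * e / N)) ≤ 2 * c * K ^ 2 * κ1 * T * e := by
      calc _ ≤ (N * T) * (2 * c * K ^ 2 * (κ1 * e / N)) := by gcongr
        _ = _ := by field_simp
    rw [hD]
    linarith [hsnd k hk i]
  have hker : ∀ s', |kerN M m (th k) s s' - ker s s'| ≤ L * (D * e) + E := by
    intro s'
    have h1 := abs_kerN_sub_le hK hN (hcb 0 (by simp; positivity)) (hcb k hk) hdrift hc0 s s'
    rw [← hL] at h1
    have := abs_sub_le (kerN M m (th k) s s') (kerN M m (th 0) s s') (ker s s')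
    linarith [hE s s']
  have hE0 : 0 ≤ E := (abs_nonneg _).trans (hE s s)
  constructor
  · have h := gradStep_net_sub_le hK (hκ k hk) (hμ k) (hcb k hk) s
    rw [← hstep k, ← hA, hNb] at h
    refine h.trans ?_
    have h1 : 1 / (N * e) * (N * (A * (κ1 * e / N))) = A * κ1 / N := by field_simp
    rw [h1]
    gcongr
    linarith [show 0 ≤ B * κ1 ^ 2 + 2 * κ1 * (L * D + 1) by positivity]
  · have h := gradStep_linearization hK hN (hκ k hk) (hμ k) (hcb k hk) s
    rw [← hstep k, ← hB, hNb] at h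
    -- The left side is smaller by a further factor `1 / N`, which is simply dropped.
    have h1 : 1 / (N * e) * (N * (B * (κ1 * e / N) ^ 2)) ≤ B * κ1 ^ 2 / N * e := by
      have : 1 / (N * e) * (N * (B * (κ1 * e / N) ^ 2)) = B * κ1 ^ 2 / N * e * (1 / N) := by
        field_simp
      rw [this]
      refine mul_le_of_le_one_right (by positivity) ?_
      rw [div_le_one hN0]
      exact Nat.one_le_cast.2 hN
    have h2 : 1 / (N * e) * (N * (κ k * ∑ s', μ k s' * kerN M m (th k) s s')) -
        1 / e * (κ k * ∑ s', μ k s' * ker s s') =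
        1 / e * (κ k * ∑ s', μ k s' * (kerN M m (th k) s s' - ker s s')) := by
      simp only [mul_sub, Finset.sum_sub_distrib]
      field_simp
    have h3 : |1 / e * (κ k * ∑ s', μ k s' * (kerN M m (th k) s s' - ker s s'))| ≤
        2 * κ1 / N * (L * (D * e) + E) := by
      rw [abs_mul, abs_mul, abs_of_pos (by positivity : 0 < 1 / e)]
      have h4 : |∑ s', μ k s' * (kerN M m (th k) s s' - ker s s')| ≤ 2 * (L * (D * e) + E) := by
        refine (Finset.abs_sum_le_sum_abs _ _).trans ?_
        calc _ ≤ ∑ s', |μ k s'| * (L * (D * e) + E) := Finset.sum_le_sum fun s' _ => by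
              rw [abs_mul]
              exact mul_le_mul_of_nonneg_left (hker s') (abs_nonneg _)
          _ ≤ _ := by
              rw [← Finset.sum_mul]
              exact mul_le_mul_of_nonneg_right (hμ k) (by positivity)
      calc _ ≤ 1 / e * (κ1 * e / N * (2 * (L * (D * e) + E))) := by
            gcongr
            exact hκ k hk
        _ = _ := by field_simp
    have h5 := abs_add_le (netOn M m (th (k + 1)) s - netOn M m (th k) s -
      1 / (N * e) * (N * (κ k * ∑ s', μ k s' * kerN M m (th k) s s')))
      (1 / e * (κ k * ∑ s', μ k s' * (kerN M m (th k) s s' - ker s s')))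
    have h6 : netOn M m (th (k + 1)) s - netOn M m (th k) s -
      1 / (N * e) * (N * (κ k * ∑ s', μ k s' * kerN M m (th k) s s')) +
      (1 / e * (κ k * ∑ s', μ k s' * (kerN M m (th k) s s' - ker s s'))) =
      netOn M m (th (k + 1)) s - netOn M m (th k) s - 1 / e * (κ k * ∑ s', μ k s' * ker s s') := by
      rw [← h2]; ring
    rw [h6] at h5
    have h7 : B * κ1 ^ 2 / N * e + 2 * κ1 / N * (L * (D * e) + E) ≤
        (A * κ1 + B * κ1 ^ 2 + 2 * κ1 * (L * D + 1)) / N * (e + E) := by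
      have e1 : (A * κ1 + B * κ1 ^ 2 + 2 * κ1 * (L * D + 1)) / N * (e + E) -
        (B * κ1 ^ 2 / N * e + 2 * κ1 / N * (L * (D * e) + E)) =
        (A * κ1) / N * (e + E) + B * κ1 ^ 2 / N * E + 2 * κ1 * L * D / N * E + 2 * κ1 / N * e := by
        ring
      have : 0 ≤ (A * κ1) / N * (e + E) + B * κ1 ^ 2 / N * E + 2 * κ1 * L * D / N * E +
        2 * κ1 / N * e := by positivity
      linarith
    linarith

theorem one_add_div_pow_le {a T : ℝ} (ha : 0 ≤ a) {N k : ℕ} (hN : 1 ≤ N) (hk : (k : ℝ) ≤ N * T) :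
    (1 + a / N) ^ k ≤ Real.exp (a * T) := by
  have hN0 : (0 : ℝ) < N := by positivity
  calc (1 + a / N) ^ k ≤ Real.exp (a / N) ^ k := by
        gcongr
        linarith [Real.add_one_le_exp (a / N)]
    _ = Real.exp (k * (a / N)) := (Real.exp_nat_mul _ _).symm
    _ ≤ Real.exp (a * T) := by
        rw [Real.exp_le_exp]
        calc _ ≤ (N * T) * (a / N) := by gcongr
          _ = _ := by field_simp

/-- The temporal difference error. -/
def tdError (M : MDP dx da) (q : M.S → ℝ) (s s' : M.S) : ℝ := M.r s + M.gam * q s' - q s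

theorem abs_tdError_le {q : M.S → ℝ} {b : ℝ} (hq : ∀ s, |q s| ≤ b) (s s' : M.S) :
    |tdError M q s s'| ≤ 1 + 2 * b := by
  have a1 := abs_le.2 (M.r_mem s)
  have a4 : |M.gam * q s'| ≤ b := by
    rw [abs_mul, abs_of_pos M.gam_pos]
    exact (mul_le_of_le_one_left (abs_nonneg _) M.gam_lt_one.le).trans (hq s')
  have a5 := abs_sub (M.r s + M.gam * q s') (q s)
  have a6 := abs_add_le (M.r s) (M.gam * q s')
  unfold tdError
  linarith [hq s]

theorem trained_fst_succ [DecidableEq M.S] {N : ℕ} (hN : 1 ≤ N)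
    (init : Params dx da N × Params dx da N) (xi xt : ℕ → M.S) (k : ℕ) :
    (trained M m init xi xt (k + 1)).1 = gradStep M m (m.alp * (N : ℝ) ^ (m.bet - 1) / N *
      tdError M (netOn M m (trained M m init xi xt k).1) (xi k) (xi (k + 1)))
      (Pi.single (xi k) 1) (trained M m init xi xt k).1 := by
  rw [← critic_rate hN]
  exact criticStep_eq _ _ _

theorem trained_snd_succ {N : ℕ} (hN : 1 ≤ N)
    (init : Params dx da N × Params dx da N) (xi xt : ℕ → M.S) (k : ℕ) :
    (trained M m init xi xt (k + 1)).2 = gradStep M m (zeta ((k : ℝ) / N) *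
      (N : ℝ) ^ (m.bet - 1) / N * netOn M m (trained M m init xi xt k).1 (xt k))
      (actorWeight M (netOn M m (trained M m init xi xt k).2) (xt k))
      (trained M m init xi xt k).2 := by
  rw [← actor_rate hN]
  exact actorStep_eq _ _ _ _

theorem sum_abs_single_le [DecidableEq M.S] (s : M.S) :
    ∑ s', |(Pi.single s 1 : M.S → ℝ) s'| ≤ 2 := by
  have : ∀ s', |(Pi.single s 1 : M.S → ℝ) s'| = if s' = s then 1 else 0 := fun s' => by
    rw [Pi.single_apply]
    split_ifs <;> simp
  simp only [this, Finset.sum_ite_eq', Finset.mem_univ, if_true]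
  norm_num

/-- A two-stage bootstrap, since outputs and weights control each other. The crude bound of the
output by `K * x / e`, with `x` bounding the outer weights, is large, but the step size `e / N`
compensates it, so the weights grow at most geometrically with ratio `1 + a / N`. With bounded
weights the outputs grow with ratio `1 + b / N`, and both are bounded after `N * T` steps. -/
theorem exists_critic_bound (hK : ActBound M m K) {T K0 : ℝ} (hK0 : 0 ≤ K0) :
    ∃ C : ℝ, 0 ≤ C ∧ ∀ N : ℕ, 1 ≤ N → ∀ (init : Params dx da N × Params dx da N)
      (xi xt : ℕ → M.S), (∀ i, |(init.1 i).1| ≤ K0) → (∀ s, |netOn M m init.1 s| ≤ 1) →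
      ∀ k : ℕ, (k : ℝ) ≤ N * T → ∀ s, |netOn M m (trained M m init xi xt k).1 s| ≤ C := by
  classical
  have hKn : 0 ≤ K := zero_le_one.trans hK.one_le
  have hal := m.alp_pos
  obtain ⟨a, ha⟩ : ∃ a, a = m.alp * (1 + 2 * K) * (2 * K) := ⟨_, rfl⟩
  have ha0 : 0 ≤ a := ha ▸ by positivity
  obtain ⟨c, hc⟩ : ∃ c, c = (K0 + 1) * Real.exp (a * T) := ⟨_, rfl⟩
  have hc0 : 0 ≤ c := hc ▸ by positivity
  obtain ⟨b, hb⟩ : ∃ b, b = 2 * (2 * K ^ 2 + 2 * c ^ 2 * K ^ 3) * m.alp := ⟨_, rfl⟩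
  have hb0 : 0 ≤ b := hb ▸ by positivity
  refine ⟨3 * Real.exp (b * T), by positivity, fun N hN init xi xt h0 hq0 => ?_⟩
  have hN0 : (0 : ℝ) < N := by positivity
  have hNb := rpow_bet (m := m) hN
  have he0 := scale_pos (m := m) hN
  have he1 := scale_le_one (m := m) hN
  have hstep := trained_fst_succ (m := m) hN init xi xt
  set e := (N : ℝ) ^ (m.bet - 1)
  set om : ℕ → Params dx da N := fun k => (trained M m init xi xt k).1 with hom
  have hκ : ∀ (k : ℕ) (x : ℝ), (∀ s, |netOn M m (om k) s| ≤ x) →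
      |m.alp * e / N * tdError M (netOn M m (om k)) (xi k) (xi (k + 1))| ≤
        m.alp * e / N * (1 + 2 * x) := by
    intro k x hx
    rw [abs_mul, abs_of_pos (by positivity : 0 < m.alp * e / N)]
    exact mul_le_mul_of_nonneg_left (abs_tdError_le hx _ _) (by positivity)
  have hC : ∀ k i, |(om k i).1| + 1 ≤ (K0 + 1) * (1 + a / N) ^ k := by
    intro k
    induction k with
    | zero => intro i; simpa [hom, trained] using h0 i
    | succ k ih =>
      intro i
      set x := (K0 + 1) * (1 + a / N) ^ k with hx
      have hx1 : 1 ≤ x := by linarith [ih i, abs_nonneg (om k i).1]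
      have hnet : ∀ s, |netOn M m (om k) s| ≤ K * x / e := by
        intro s
        refine (abs_net_le hK (c := x) (fun i => by linarith [ih i]) s).trans (le_of_eq ?_)
        rw [hNb]
        field_simp
      have h1 := gradStep_fst_sub_le hK (hκ k _ hnet) (sum_abs_single_le (xi k)) (om k) i
      rw [← hstep k] at h1
      have h2 := abs_sub_abs_le_abs_sub (om (k + 1) i).1 (om k i).1
      have h3 : 2 * K * (m.alp * e / N * (1 + 2 * (K * x / e))) ≤ a / N * x := by
        have e1 : 2 * K * (m.alp * e / N * (1 + 2 * (K * x / e))) =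
          2 * K * m.alp / N * (e + 2 * K * x) := by field_simp
        have e2 : a / N * x = 2 * K * m.alp / N * (x + 2 * K * x) := by rw [ha]; ring
        rw [e1, e2]
        gcongr
        exact he1.trans hx1
      have h4 : (K0 + 1) * (1 + a / N) ^ (k + 1) = x + a / N * x := by rw [hx]; ring
      rw [h4]
      have h5 : |(om (k + 1) i).1 - (om k i).1| ≤
        2 * K * (m.alp * e / N * (1 + 2 * (K * x / e))) := h1
      linarith [ih i]
  have hCb : ∀ k : ℕ, (k : ℝ) ≤ N * T → ∀ i, |(om k i).1| ≤ c := by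
    intro k hk i
    have := mul_le_mul_of_nonneg_left (one_add_div_pow_le ha0 hN hk) (by positivity : 0 ≤ K0 + 1)
    linarith [hC k i]
  -- The combination `2 * |Q| + 1` bounds the temporal difference error, so the recursion for it
  -- closes; its initial value is at most `3`.
  have hQ : ∀ k : ℕ, (k : ℝ) ≤ N * T → ∀ s,
      2 * |netOn M m (om k) s| + 1 ≤ 3 * (1 + b / N) ^ k := by
    intro k
    induction k with
    | zero =>
      intro _ s
      have := hq0 s
      simp only [hom, trained, pow_zero]
      linarith
    | succ k ih =>
      intro hk s
      have hk' : (k : ℝ) ≤ N * T := by push_cast at hk; linarith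
      set y := 3 * (1 + b / N) ^ k with hy
      have h1 := gradStep_net_sub_le hK (hκ k ((y - 1) / 2) fun s => by linarith [ih hk' s])
        (sum_abs_single_le (xi k)) (hCb k hk') s
      rw [← hstep k, hNb] at h1
      have h2 : 1 / (N * e) * (N * ((2 * K ^ 2 + 2 * c ^ 2 * K ^ 3) *
          (m.alp * e / N * (1 + 2 * ((y - 1) / 2))))) = b / N * y / 2 := by
        rw [hb]
        field_simp
        ring
      rw [h2] at h1
      have h3 := abs_sub_abs_le_abs_sub (netOn M m (om (k + 1)) s) (netOn M m (om k) s)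
      have h4 : |netOn M m (om (k + 1)) s - netOn M m (om k) s| ≤ b / N * y / 2 := h1
      have h5 : 3 * (1 + b / N) ^ (k + 1) = y + b / N * y := by rw [hy]; ring
      rw [h5]
      linarith [ih hk' s]
  intro k hk s
  have h1 := hQ k hk s
  have h2 := one_add_div_pow_le hb0 hN hk
  linarith [abs_nonneg (netOn M m (om k) s)]

/-- The increments of critic and actor along a training path, in terms of the limit kernels. -/
theorem exists_path_bound (m : Model dx da) (hK : ActBound M m K) {T K0 : ℝ} (hT : 0 ≤ T)
    (hK0 : 0 ≤ K0) : ∃ C : ℝ, 0 ≤ C ∧ ∀ N : ℕ, 1 ≤ N →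
      ∀ (init : Params dx da N × Params dx da N) (xi xt : ℕ → M.S) (E : ℝ),
      (∀ i, |(init.1 i).1| ≤ K0) → (∀ i, |(init.2 i).1| ≤ K0) → (∀ s, |netOn M m init.1 s| ≤ 1) →
      (∀ s s', |kerN M m init.1 s s' - kerB M m m.nu s s'| ≤ E) →
      (∀ s s', |kerN M m init.2 s s' - kerB M m m.mu s s'| ≤ E) →
      ∀ (Q P : ℕ → M.S → ℝ), Q = (fun k => netOn M m (trained M m init xi xt k).1) →
      P = (fun k => netOn M m (trained M m init xi xt k).2) →
      ∀ k : ℕ, (k : ℝ) ≤ N * T → ∀ s, |Q k s| ≤ C ∧ |Q (k + 1) s - Q k s| ≤ C / N ∧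
        |P (k + 1) s - P k s| ≤ C / N ∧
        |Q (k + 1) s - Q k s - 1 / N * (m.alp * tdError M (Q k) (xi k) (xi (k + 1)) *
          kerB M m m.nu s (xi k))| ≤ C / N * ((N : ℝ) ^ (m.bet - 1) + E) ∧
        |P (k + 1) s - P k s - 1 / N * (zeta ((k : ℝ) / N) * Q k (xt k) *
          (kerB M m m.mu s (xt k) - ∑ a : M.A, M.softmax (P k) ((xt k).1, a) *
            kerB M m m.mu s ((xt k).1, a)))| ≤ C / N * ((N : ℝ) ^ (m.bet - 1) + E) := by
  classical
  obtain ⟨C1, hC1, hb⟩ := exists_critic_bound hK (T := T) hK0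
  have hal := m.alp_pos
  -- The bound on the critic gives `1 + 2 * C1` for the temporal difference error; the actor step
  -- involves the critic directly and has `κ1 = C1`.
  obtain ⟨C2, hC2, hcr⟩ := exists_gradPath_bound hK hT (κ1 := m.alp * (1 + 2 * C1))
    (by positivity) hK0
  obtain ⟨C3, hC3, hac⟩ := exists_gradPath_bound hK hT (κ1 := C1) hC1 hK0
  refine ⟨C1 + C2 + C3, by positivity, fun N hN init xi xt E h1 h2 hq hE1 hE2 Q P hQ hP => ?_⟩
  have hN0 : (0 : ℝ) < N := by positivity
  have he0 := scale_pos (m := m) hN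
  have hb' := hb N hN init xi xt h1 hq
  have h3 := hcr N hN (fun k => (trained M m init xi xt k).1) _ _
    (trained_fst_succ hN init xi xt) (fun k hk => by
      rw [abs_mul, abs_of_pos (by positivity : 0 < m.alp * (N : ℝ) ^ (m.bet - 1) / N)]
      refine (mul_le_mul_of_nonneg_left (abs_tdError_le (hb' k hk) _ _)
        (by positivity)).trans (le_of_eq ?_)
      ring) (fun k => sum_abs_single_le _) h1 (kerB M m m.nu) E hE1
  have h4 := hac N hN (fun k => (trained M m init xi xt k).2) _ _
    (trained_snd_succ hN init xi xt) (fun k hk => by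
      rw [abs_mul, abs_div, abs_mul, abs_of_pos he0, abs_of_pos hN0]
      have hz := zeta_abs_le_one (t := (k : ℝ) / N) (by positivity)
      calc _ ≤ 1 * (N : ℝ) ^ (m.bet - 1) / N * C1 := by
            gcongr
            exact hb' k hk _
        _ = _ := by ring) (fun k => sum_abs_actorWeight _ _) h2 (kerB M m m.mu) E hE2
  intro k hk s
  have h5 := h3 k hk s
  have h6 := h4 k hk s
  have hE0 : 0 ≤ E := (abs_nonneg _).trans (hE1 s s)
  have le2 : C2 / N ≤ (C1 + C2 + C3) / N := by gcongr; linarith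
  have le3 : C3 / N ≤ (C1 + C2 + C3) / N := by gcongr; linarith
  subst hQ hP
  refine ⟨(hb' k hk s).trans (by linarith), h5.1.trans le2, h6.1.trans le3, ?_, ?_⟩
  · refine le_trans (le_of_eq ?_) (h5.2.trans (mul_le_mul_of_nonneg_right le2 (by positivity)))
    congr 2
    simp only [Pi.single_apply, ite_mul, one_mul, zero_mul, Finset.sum_ite_eq', Finset.mem_univ,
      if_true]
    field_simp
  · refine le_trans (le_of_eq ?_) (h6.2.trans (mul_le_mul_of_nonneg_right le3 (by positivity)))
    congr 2
    have h7 := sum_actorWeight (netOn M m (trained M m init xi xt k).2) (xt k)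
      fun s' => kerB M m m.mu s s'
    simp only [smul_eq_mul] at h7
    simp only [h7]
    field_simp

end Path

/-! ### Averaging along the Markov chain, Riemann sums and a discrete Gronwall inequality -/

section Averaging

variable {dx da : ℕ} {M : MDP dx da} {m : Model dx da} {T : ℝ}

theorem trans_polY_bddLip (q : M.S → M.X → ℝ) (s s' : M.S) :
    BddLip (timeDom M T) fun y => M.trans q (polY M y) s s' :=
  (BddLip.const (q s s'.1)).mul (polY_bddLip s')

/-- The difference of a function of a transition from `s` to `s'` and its conditional expectation
given `s`. -/
def centered (q : M.S → M.X → ℝ) (v : ℝ × (M.S → ℝ) × (M.S → ℝ) → M.S → M.S → ℝ)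
    (y : ℝ × (M.S → ℝ) × (M.S → ℝ)) (s s' : M.S) : ℝ :=
  v y s s' - ∑ t, M.trans q (polY M y) s t * v y s t

/-- The mean of a function of a transition in the stationary regime. -/
def statMean (q : M.S → M.X → ℝ) (h : ℝ × (M.S → ℝ) × (M.S → ℝ) → M.S → M.S → ℝ)
    (y : ℝ × (M.S → ℝ) × (M.S → ℝ)) : ℝ :=
  ∑ s, stationary (M.trans q (polY M y)) s * ∑ s', M.trans q (polY M y) s s' * h y s s'

/-- Along a slowly varying sequence of parameters, a functional of the transitions of the chain
differs from its stationary mean by a martingale and a bounded error. -/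
theorem exists_averaging {q : M.S → M.X → ℝ} (hq : GoodKernel M q)
    {h : ℝ × (M.S → ℝ) × (M.S → ℝ) → M.S → M.S → ℝ}
    (hh : ∀ s s', BddLip (timeDom M T) fun y => h y s s') :
    ∃ v : ℝ × (M.S → ℝ) × (M.S → ℝ) → M.S → M.S → ℝ,
      (∀ s s', BddLip (timeDom M T) fun y => v y s s') ∧ ∃ K : ℝ, 0 ≤ K ∧
      ∀ (y : ℕ → ℝ × (M.S → ℝ) × (M.S → ℝ)) (ξ : ℕ → M.S) (δ : ℝ) (k : ℕ),
      (∀ j ≤ k, y j ∈ timeDom M T) → (∀ j < k, dist (y (j + 1)) (y j) ≤ δ) →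
      |∑ j ∈ Finset.range k, (h (y j) (ξ j) (ξ (j + 1)) - statMean q h (y j)) -
        ∑ j ∈ Finset.range k, centered q v (y j) (ξ j) (ξ (j + 1))| ≤ K * (2 + k * δ) := by
  -- The source of the Poisson equation is the conditional mean of `h` given the current state.
  obtain ⟨u, hu, hpo⟩ := hq.exists_poisson (D := timeDom M T) (c := eta T / Fintype.card M.A)
    (div_pos (eta_pos T) MDP.card_A_pos) (g := polY M)
    (H := fun y s => ∑ s', M.trans q (polY M y) s s' * h y s s')
    (fun y hy => polY_mem_policies hy) polY_bddLip
    (fun s => BddLip.sum _ fun s' => (trans_polY_bddLip q s s').mul (hh s s'))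
  obtain ⟨K, hK, hb, hl⟩ := BddLip.uniform hu
  -- Centering `h` together with `u` at the next state makes the remainder exactly `u (ξ j) - u (ξ
  -- (j + 1))` at the parameter `y j`.
  refine ⟨fun y s s' => h y s s' + u y s', fun s s' => (hh s s').add (hu s'), K, hK,
    fun y ξ δ k hy hδ => ?_⟩
  have key : ∀ k, (∀ j ≤ k, y j ∈ timeDom M T) →
      ∑ j ∈ Finset.range k, (h (y j) (ξ j) (ξ (j + 1)) - statMean q h (y j)) -
        ∑ j ∈ Finset.range k, centered q (fun y s s' => h y s s' + u y s') (y j) (ξ j) (ξ (j + 1)) =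
      ∑ j ∈ Finset.range k, (u (y j) (ξ j) - u (y j) (ξ (j + 1))) := by
    intro k hy
    rw [← Finset.sum_sub_distrib]
    refine Finset.sum_congr rfl fun j hj => ?_
    have h1 := hpo (y j) (hy j (Finset.mem_range.1 hj).le) (ξ j)
    unfold statMean centered
    simp only [mul_add, Finset.sum_add_distrib]
    linarith
  rw [key k hy]
  -- The sum would telescope for a fixed parameter; each change of `y` costs at most `K * δ`.
  have htel : |∑ j ∈ Finset.range k, (u (y j) (ξ j) - u (y j) (ξ (j + 1))) -
      (u (y 0) (ξ 0) - u (y k) (ξ k))| ≤ k * (K * δ) := by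
    clear key
    induction k with
    | zero => simp
    | succ k ih =>
      have h1 := ih (fun j hj => hy j (by lia)) (fun j hj => hδ j (by lia))
      have h2 := hl (ξ (k + 1)) (y (k + 1)) (hy _ le_rfl) (y k) (hy _ (by lia))
      have h3 := mul_le_mul_of_nonneg_left (hδ k (by lia)) hK
      rw [Finset.sum_range_succ]
      have e : ∑ j ∈ Finset.range k, (u (y j) (ξ j) - u (y j) (ξ (j + 1))) +
          (u (y k) (ξ k) - u (y k) (ξ (k + 1))) - (u (y 0) (ξ 0) - u (y (k + 1)) (ξ (k + 1))) =
          (∑ j ∈ Finset.range k, (u (y j) (ξ j) - u (y j) (ξ (j + 1))) -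
            (u (y 0) (ξ 0) - u (y k) (ξ k))) +
          (u (y (k + 1)) (ξ (k + 1)) - u (y k) (ξ (k + 1))) := by ring
      rw [e]
      refine (abs_add_le _ _).trans ?_
      push_cast
      linarith
  have h1 := hb (ξ 0) (y 0) (hy 0 (by lia))
  have h2 := hb (ξ k) (y k) (hy k le_rfl)
  have h3 := abs_sub (u (y 0) (ξ 0)) (u (y k) (ξ k))
  have h4 := abs_sub_abs_le_abs_sub (∑ j ∈ Finset.range k, (u (y j) (ξ j) - u (y j) (ξ (j + 1))))
    (u (y 0) (ξ 0) - u (y k) (ξ k))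
  have e : K * (2 + k * δ) = 2 * K + k * (K * δ) := by ring
  rw [e]
  linarith

/-- The increment of the critic at `s`, for the truncated critic. -/
def incrQ (M : MDP dx da) (m : Model dx da) (R : ℝ) (s : M.S)
    (y : ℝ × (M.S → ℝ) × (M.S → ℝ)) (s₁ s₂ : M.S) : ℝ :=
  m.alp * tdError M (clampV R y.2.1) s₁ s₂ * kerB M m m.nu s s₁

/-- The increment of the actor at `s`, for the truncated critic. -/
def incrP (M : MDP dx da) (m : Model dx da) (R : ℝ) (s : M.S)
    (y : ℝ × (M.S → ℝ) × (M.S → ℝ)) (s₁ _s₂ : M.S) : ℝ :=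
  zeta y.1 * clampV R y.2.1 s₁ * (kerB M m m.mu s s₁ -
    ∑ a : M.A, M.softmax y.2.2 (s₁.1, a) * kerB M m m.mu s (s₁.1, a))

theorem incrQ_bddLip {R : ℝ} (hR : 0 ≤ R) (s s₁ s₂ : M.S) :
    BddLip (timeDom M T) fun y => incrQ M m R s y s₁ s₂ :=
  ((BddLip.const m.alp).mul (((BddLip.const (M.r s₁)).add ((BddLip.const M.gam).mul
    (clamp_bddLip hR s₂))).sub (clamp_bddLip hR s₁))).mul (BddLip.const _)

theorem incrP_bddLip {R : ℝ} (hR : 0 ≤ R) (s s₁ s₂ : M.S) :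
    BddLip (timeDom M T) fun y => incrP M m R s y s₁ s₂ :=
  (zeta_bddLip.mul (clamp_bddLip hR s₁)).mul ((BddLip.const _).sub
    (BddLip.sum _ fun _ => (softmax_bddLip _).mul (BddLip.const _)))

theorem statMean_incrQ (R : ℝ) (s : M.S) (y : ℝ × (M.S → ℝ) × (M.S → ℝ)) :
    statMean M.p (incrQ M m R s) y = fieldQ M m y.1 (clampV R y.2.1) y.2.2 s := by
  unfold statMean fieldQ
  rw [Finset.mul_sum]
  refine Finset.sum_congr rfl fun s' _ => ?_
  rw [Finset.mul_sum, Finset.mul_sum]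
  refine Finset.sum_congr rfl fun s'' _ => ?_
  unfold incrQ tdError MDP.trans MDP.statPi polY
  rw [Matrix.of_apply]
  simp only [MDP.trans]
  ring

/-- The actor increment ignores the next state, so the inner mean is trivial. Writing `1` as a sum
of softmax weights brings the remaining expression into the form with a difference of kernels. -/
theorem statMean_incrP (hp : GoodKernel M M.pAux) (R : ℝ) (s : M.S)
    (y : ℝ × (M.S → ℝ) × (M.S → ℝ)) :
    statMean M.pAux (incrP M m R s) y = fieldP M m y.1 (clampV R y.2.1) y.2.2 s := by
  unfold statMean fieldP incrP
  refine Finset.sum_congr rfl fun s' _ => ?_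
  rw [← Finset.sum_mul, hp.trans_sum (polY_isPositivePolicy y), one_mul]
  have e : kerB M m m.mu s s' = ∑ a : M.A, M.softmax y.2.2 (s'.1, a) * kerB M m m.mu s s' := by
    rw [← Finset.sum_mul, MDP.softmax_sum, one_mul]
  rw [e, ← Finset.sum_sub_distrib, Finset.mul_sum, Finset.mul_sum]
  refine Finset.sum_congr rfl fun a _ => ?_
  rw [← e]
  unfold MDP.statSigma polY
  ring

/-- On each cell of length `1 / N` the integrand varies by at most `L / N`; the cells are added by
induction. -/
theorem riemann_sum_le {f : ℝ → ℝ} {L : ℝ}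
    (hf : ∀ t ∈ Set.Icc 0 T, ∀ u ∈ Set.Icc 0 T, |f t - f u| ≤ L * |t - u|) (hL : 0 ≤ L) {N : ℕ}
    (hN : 1 ≤ N) (k : ℕ) (hk : (k : ℝ) / N ≤ T) :
    |(∫ u in (0 : ℝ)..(k : ℝ) / N, f u) - 1 / N * ∑ j ∈ Finset.range k, f ((j : ℝ) / N)| ≤
      k / N * (L / N) := by
  have hN0 : (0 : ℝ) < N := by positivity
  have hcont : ContinuousOn f (Set.Icc 0 T) := by
    have : LipschitzOnWith ⟨L, hL⟩ f (Set.Icc 0 T) := LipschitzOnWith.of_dist_le_mul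
      fun t ht u hu => by rw [Real.dist_eq, Real.dist_eq]; exact hf t ht u hu
    exact this.continuousOn
  induction k with
  | zero => simp
  | succ k ih =>
    have hle : (k : ℝ) / N ≤ ((k + 1 : ℕ) : ℝ) / N := by gcongr; simp
    have h0 : 0 ≤ (k : ℝ) / N := by positivity
    have hkT : (k : ℝ) / N ≤ T := hle.trans hk
    have h1 := ih hkT
    have hi1 : IntervalIntegrable f volume 0 ((k : ℝ) / N) :=
      (hcont.mono (Set.Icc_subset_Icc_right hkT)).intervalIntegrable_of_Icc h0
    have hi2 : IntervalIntegrable f volume ((k : ℝ) / N) (((k + 1 : ℕ) : ℝ) / N) :=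
      (hcont.mono (Set.Icc_subset_Icc h0 hk)).intervalIntegrable_of_Icc hle
    have hlen : ((k + 1 : ℕ) : ℝ) / N - (k : ℝ) / N = 1 / N := by push_cast; ring
    have h2 : |(∫ u in (k : ℝ) / N..((k + 1 : ℕ) : ℝ) / N, f u) - 1 / N * f ((k : ℝ) / N)| ≤
        L / N * (1 / N) := by
      have e : 1 / N * f ((k : ℝ) / N) =
          ∫ _u in (k : ℝ) / N..((k + 1 : ℕ) : ℝ) / N, f ((k : ℝ) / N) := by
        rw [intervalIntegral.integral_const, hlen, smul_eq_mul]
      rw [e, ← intervalIntegral.integral_sub hi2 intervalIntegrable_const]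
      have h3 := intervalIntegral.norm_integral_le_of_norm_le_const (a := (k : ℝ) / N)
        (b := ((k + 1 : ℕ) : ℝ) / N) (C := L / N) (f := fun u => f u - f ((k : ℝ) / N))
        (fun u hu => by
          rw [Set.uIoc_of_le hle] at hu
          refine (hf u ⟨h0.trans hu.1.le, hu.2.trans hk⟩ _ ⟨h0, hkT⟩).trans ?_
          rw [div_eq_mul_one_div L]
          refine mul_le_mul_of_nonneg_left ?_ hL
          rw [abs_of_nonneg (by linarith [hu.1]), ← hlen]
          linarith [hu.2])
      rw [hlen, abs_of_nonneg (by positivity : 0 ≤ 1 / (N : ℝ))] at h3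
      exact h3
    rw [← intervalIntegral.integral_add_adjacent_intervals hi1 hi2, Finset.sum_range_succ, mul_add]
    have e : ((∫ u in (0 : ℝ)..(k : ℝ) / N, f u) +
        ∫ u in (k : ℝ) / N..((k + 1 : ℕ) : ℝ) / N, f u) -
        (1 / N * ∑ j ∈ Finset.range k, f ((j : ℝ) / N) + 1 / N * f ((k : ℝ) / N)) =
        ((∫ u in (0 : ℝ)..(k : ℝ) / N, f u) - 1 / N * ∑ j ∈ Finset.range k, f ((j : ℝ) / N)) +
        ((∫ u in (k : ℝ) / N..((k + 1 : ℕ) : ℝ) / N, f u) - 1 / N * f ((k : ℝ) / N)) := by ring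
    rw [e]
    refine (abs_add_le _ _).trans ((add_le_add h1 h2).trans (le_of_eq ?_))
    push_cast
    ring

/-- A Gronwall inequality in summed form. The inhomogeneity `a` is neither constant nor monotone; it
enters by its current value and its average, so only moments at fixed times are needed and no
maximal inequality for the martingales. -/
theorem gronwall_sum {ε a : ℕ → ℝ} {L : ℝ} (hL : 0 ≤ L) {N : ℕ} (hN : 1 ≤ N) (ha : ∀ k, 0 ≤ a k)
    (h : ∀ k : ℕ, (k : ℝ) ≤ N * T → ε k ≤ a k + L / N * ∑ j ∈ Finset.range k, ε j) (k : ℕ)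
    (hk : (k : ℝ) ≤ N * T) :
    ε k ≤ a k + L * Real.exp (L * T) * (1 / N * ∑ j ∈ Finset.range k, a j) := by
  have hN0 : (0 : ℝ) < N := by positivity
  have key : ∀ k : ℕ, (k : ℝ) ≤ N * T →
      ∑ j ∈ Finset.range k, ε j ≤ (1 + L / N) ^ k * ∑ j ∈ Finset.range k, a j := by
    intro k
    induction k with
    | zero => simp
    | succ k ih =>
      intro hk
      have hk' : (k : ℝ) ≤ N * T := by push_cast at hk; linarith
      rw [Finset.sum_range_succ, Finset.sum_range_succ]
      have h1 := h k hk'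
      have h2 := mul_le_mul_of_nonneg_left (ih hk') (by positivity : 0 ≤ 1 + L / N)
      have h3 : a k ≤ (1 + L / N) ^ (k + 1) * a k := le_mul_of_one_le_left (ha k)
        (one_le_pow₀ (by linarith [show 0 ≤ L / N by positivity]))
      have e : (1 + L / N) ^ (k + 1) * (∑ j ∈ Finset.range k, a j + a k) =
        (1 + L / N) * ((1 + L / N) ^ k * ∑ j ∈ Finset.range k, a j) +
          (1 + L / N) ^ (k + 1) * a k := by ring
      rw [e]
      linarith
  have h1 := h k hk
  have hs : 0 ≤ ∑ j ∈ Finset.range k, a j := Finset.sum_nonneg fun j _ => ha j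
  have h2 := (key k hk).trans (mul_le_mul_of_nonneg_right (one_add_div_pow_le hL hN hk) hs)
  have h3 := mul_le_mul_of_nonneg_left h2 (by positivity : 0 ≤ L / N)
  have e : L / N * (Real.exp (L * T) * ∑ j ∈ Finset.range k, a j) =
    L * Real.exp (L * T) * (1 / N * ∑ j ∈ Finset.range k, a j) := by ring
  linarith

/-- Splits the error into the initial value, the linearization error `A`, the averaging remainder
`B`, the martingale `Z`, the Riemann error `D`, and the difference of the fields `G` and `G'` at the
two trajectories, which is left to Gronwall. -/
theorem abs_sub_le_of_increments {X h G G' ε : ℕ → ℝ} {x A B D L Z : ℝ} {N k : ℕ} (hN : 1 ≤ N)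
    (hX : ∀ j < k, |X (j + 1) - X j - 1 / N * h j| ≤ A / N) {S : ℝ}
    (hS : |∑ j ∈ Finset.range k, (h j - G j) - S| ≤ B) (hSZ : |1 / N * S| ≤ Z)
    (hx : |x - 1 / N * ∑ j ∈ Finset.range k, G' j| ≤ D) (hG : ∀ j < k, |G j - G' j| ≤ L * ε j) :
    |X k - x| ≤ |X 0| + k / N * A + B / N + Z + D + L / N * ∑ j ∈ Finset.range k, ε j := by
  have hN0 : (0 : ℝ) < N := by positivity
  have h1 : |X k - X 0 - 1 / N * ∑ j ∈ Finset.range k, h j| ≤ k / N * A := by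
    have e : X k - X 0 - 1 / N * ∑ j ∈ Finset.range k, h j =
        ∑ j ∈ Finset.range k, (X (j + 1) - X j - 1 / N * h j) := by
      rw [Finset.sum_sub_distrib, Finset.sum_range_sub, Finset.mul_sum]
    rw [e]
    refine (Finset.abs_sum_le_sum_abs _ _).trans ((Finset.sum_le_card_nsmul _ _ (A / N)
      fun j hj => hX j (Finset.mem_range.1 hj)).trans (le_of_eq ?_))
    rw [Finset.card_range, nsmul_eq_mul]
    ring
  have h2 : |1 / N * (∑ j ∈ Finset.range k, (h j - G j) - S)| ≤ B / N := by
    rw [abs_mul, abs_of_pos (by positivity : 0 < 1 / (N : ℝ)), one_div, inv_mul_eq_div]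
    gcongr
  have h3 : |1 / N * ∑ j ∈ Finset.range k, (G j - G' j)| ≤ L / N * ∑ j ∈ Finset.range k, ε j := by
    rw [abs_mul, abs_of_pos (by positivity : 0 < 1 / (N : ℝ))]
    have : |∑ j ∈ Finset.range k, (G j - G' j)| ≤ L * ∑ j ∈ Finset.range k, ε j := by
      rw [Finset.mul_sum]
      exact (Finset.abs_sum_le_sum_abs _ _).trans
        (Finset.sum_le_sum fun j hj => hG j (Finset.mem_range.1 hj))
    calc _ ≤ 1 / N * (L * ∑ j ∈ Finset.range k, ε j) := by gcongr
      _ = _ := by ring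
  have e : X k - x = X 0 + (X k - X 0 - 1 / N * ∑ j ∈ Finset.range k, h j) +
      1 / N * (∑ j ∈ Finset.range k, (h j - G j) - S) + 1 / N * S -
      (x - 1 / N * ∑ j ∈ Finset.range k, G' j) + 1 / N * ∑ j ∈ Finset.range k, (G j - G' j) := by
    simp only [Finset.sum_sub_distrib]
    ring
  rw [e]
  rw [abs_le] at *
  have h4 := neg_abs_le (X 0)
  have h5 := le_abs_self (X 0)
  constructor <;> linarith [h1.1, h1.2, h2.1, h2.2, h3.1, h3.2, hSZ.1, hSZ.2, hx.1, hx.2]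

end Averaging

/-! ### Regularity of the limit and pathwise comparison -/

section Comparison

variable {dx da : ℕ} {M : MDP dx da} {m : Model dx da} {T : ℝ}

theorem lipschitz_of_eq_integral {f F : ℝ → ℝ} {K : ℝ} (hF : ContinuousOn F (Set.Icc 0 T))
    (hb : ∀ t ∈ Set.Icc 0 T, |F t| ≤ K) (hf : ∀ t ∈ Set.Icc 0 T, f t = ∫ u in (0 : ℝ)..t, F u) :
    ∀ t ∈ Set.Icc 0 T, ∀ u ∈ Set.Icc 0 T, |f t - f u| ≤ K * |t - u| := by
  have hi : ∀ t ∈ Set.Icc 0 T, IntervalIntegrable F volume 0 t := fun t ht =>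
    (hF.mono (Set.Icc_subset_Icc_right ht.2)).intervalIntegrable_of_Icc ht.1
  intro t ht u hu
  rw [hf t ht, hf u hu, intervalIntegral.integral_interval_sub_left (hi t ht) (hi u hu)]
  exact intervalIntegral.norm_integral_le_of_norm_le_const (C := K) (f := F) fun x hx =>
    hb x ((Set.uIcc_subset_Icc hu ht) (Set.uIoc_subset_uIcc hx))

section Curve

variable {Y ι : Type*} [PseudoMetricSpace Y] {D : Set Y} {F : ι → Y → ℝ}
  {w : ℝ → ι → ℝ} {z : ℝ → Y}

theorem dist_le_of_eq_integral_comp [Fintype ι] {K : ℝ} (hK : 0 ≤ K) (hb : ∀ i, ∀ y ∈ D, |F i y| ≤ K)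
    (hF : ∀ i, BddLip D (F i)) (hz : ∀ t ∈ Set.Icc 0 T, z t ∈ D)
    (hzc : ContinuousOn z (Set.Icc 0 T))
    (hw : ∀ t ∈ Set.Icc 0 T, ∀ i, w t i = ∫ u in (0 : ℝ)..t, F i (z u)) :
    ∀ t ∈ Set.Icc 0 T, ∀ u ∈ Set.Icc 0 T, dist (w t) (w u) ≤ K * |t - u| := by
  intro t ht u hu
  rw [dist_pi_le_iff (by positivity)]
  intro i
  exact lipschitz_of_eq_integral (F := fun u => F i (z u)) (f := fun t => w t i)
    ((hF i).continuousOn.comp hzc hz)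
    (fun t ht => hb i (z t) (hz t ht)) (fun t ht => hw t ht i) t ht u hu

theorem riemann_of_eq_integral_comp {K L : ℝ} (hK : 0 ≤ K) (hL : 0 ≤ L)
    (hl : ∀ i, ∀ y ∈ D, ∀ y' ∈ D, |F i y - F i y'| ≤ K * dist y y')
    (hz : ∀ t ∈ Set.Icc 0 T, z t ∈ D)
    (hzL : ∀ t ∈ Set.Icc 0 T, ∀ u ∈ Set.Icc 0 T, dist (z t) (z u) ≤ L * |t - u|)
    (hw : ∀ t ∈ Set.Icc 0 T, ∀ i, w t i = ∫ u in (0 : ℝ)..t, F i (z u))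
    {N : ℕ} (hN : 1 ≤ N) {k : ℕ} (hk : (k : ℝ) / N ≤ T) (i : ι) :
    |w ((k : ℝ) / N) i - 1 / N * ∑ j ∈ Finset.range k, F i (z ((j : ℝ) / N))| ≤
      T * (K * L) / N := by
  rw [hw _ ⟨by positivity, hk⟩]
  refine (riemann_sum_le (f := fun u => F i (z u)) (L := K * L) (fun t ht u hu => ?_)
    (by positivity) hN k hk).trans ?_
  · rw [mul_assoc]
    exact (hl i _ (hz t ht) _ (hz u hu)).trans (mul_le_mul_of_nonneg_left (hzL t ht u hu) hK)
  · rw [← mul_div_assoc]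
    gcongr

end Curve

theorem IsLimit.eq_integral {Q P : ℝ → M.S → ℝ} (h : IsLimit M m T Q P) {R : ℝ}
    (hR : ∀ t ∈ Set.Icc 0 T, ‖Q t‖ ≤ R) : ∀ t ∈ Set.Icc 0 T, ∀ s,
    Q t s = (∫ u in (0 : ℝ)..t, fieldQ M m u (clampV R (Q u)) (P u) s) ∧
    P t s = ∫ u in (0 : ℝ)..t, fieldP M m u (clampV R (Q u)) (P u) s := by
  intro t ht s
  constructor
  · rw [h.eqQ t ht s, ← intervalIntegral.integral_const_mul]
    refine intervalIntegral.integral_congr fun u hu => ?_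
    rw [Set.uIcc_of_le ht.1] at hu
    rw [clampV_eq (hR u ⟨hu.1, hu.2.trans ht.2⟩)]
    rfl
  · rw [h.eqP t ht s]
    refine intervalIntegral.integral_congr fun u hu => ?_
    rw [Set.uIcc_of_le ht.1] at hu
    rw [clampV_eq (hR u ⟨hu.1, hu.2.trans ht.2⟩)]
    rfl

/-- The truncated fields are bounded, so a solution is Lipschitz in time; being Lipschitz in all
variables, the fields are then Lipschitz along the solution, and left Riemann sums have error `O(1 /
N)`. -/
theorem IsLimit.exists_riemann (hp : GoodKernel M M.p) (hp' : GoodKernel M M.pAux) (hT : 0 ≤ T)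
    {Q P : ℝ → M.S → ℝ} (h : IsLimit M m T Q P) {R : ℝ} (hR0 : 0 ≤ R)
    (hR : ∀ t ∈ Set.Icc 0 T, ‖Q t‖ ≤ R) :
    ∃ D : ℝ, 0 ≤ D ∧ (∀ t ∈ Set.Icc 0 T, ∀ u ∈ Set.Icc 0 T, dist (P t) (P u) ≤ D * |t - u|) ∧
      ∀ N : ℕ, 1 ≤ N → ∀ k : ℕ, (k : ℝ) / N ≤ T → ∀ s,
      |Q ((k : ℝ) / N) s - 1 / N * ∑ j ∈ Finset.range k, fieldQ M m ((j : ℝ) / N)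
        (clampV R (Q ((j : ℝ) / N))) (P ((j : ℝ) / N)) s| ≤ D / N ∧
      |P ((k : ℝ) / N) s - 1 / N * ∑ j ∈ Finset.range k, fieldP M m ((j : ℝ) / N)
        (clampV R (Q ((j : ℝ) / N))) (P ((j : ℝ) / N)) s| ≤ D / N := by
  obtain ⟨z, hz⟩ : ∃ z : ℝ → ℝ × (M.S → ℝ) × (M.S → ℝ), z = fun u => (u, Q u, P u) := ⟨_, rfl⟩
  obtain ⟨FQ, hFQ⟩ : ∃ FQ : M.S → ℝ × (M.S → ℝ) × (M.S → ℝ) → ℝ,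
      FQ = fun s y => fieldQ M m y.1 (clampV R y.2.1) y.2.2 s := ⟨_, rfl⟩
  obtain ⟨FP, hFP⟩ : ∃ FP : M.S → ℝ × (M.S → ℝ) × (M.S → ℝ) → ℝ,
      FP = fun s y => fieldP M m y.1 (clampV R y.2.1) y.2.2 s := ⟨_, rfl⟩
  have hbQ : ∀ s, BddLip (timeDom M T) (FQ s) := fun s => by rw [hFQ]; exact fieldQ_bddLip hp hR0 s
  have hbP : ∀ s, BddLip (timeDom M T) (FP s) := fun s => by rw [hFP]; exact fieldP_bddLip hp' hR0 s
  have hQ : ∀ t ∈ Set.Icc 0 T, ∀ s, Q t s = ∫ u in (0 : ℝ)..t, FQ s (z u) := fun t ht s => by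
    rw [hFQ, hz]; exact (h.eq_integral hR t ht s).1
  have hP : ∀ t ∈ Set.Icc 0 T, ∀ s, P t s = ∫ u in (0 : ℝ)..t, FP s (z u) := fun t ht s => by
    rw [hFP, hz]; exact (h.eq_integral hR t ht s).2
  have hzm : ∀ t ∈ Set.Icc 0 T, z t ∈ timeDom M T := fun t ht => by rw [hz]; exact ht
  have hzc : ContinuousOn z (Set.Icc 0 T) := by
    rw [hz]; exact continuousOn_id.prodMk (h.contQ.prodMk h.contP)
  obtain ⟨K₁, hK₁0, hb₁, hl₁⟩ := BddLip.uniform hbQ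
  obtain ⟨K₂, hK₂0, hb₂, hl₂⟩ := BddLip.uniform hbP
  have hQL := dist_le_of_eq_integral_comp hK₁0 hb₁ hbQ hzm hzc hQ
  have hPL := dist_le_of_eq_integral_comp hK₂0 hb₂ hbP hzm hzc hP
  have hzL : ∀ t ∈ Set.Icc 0 T, ∀ u ∈ Set.Icc 0 T, dist (z t) (z u) ≤ (1 + K₁ + K₂) * |t - u| := by
    intro t ht u hu
    have h0 := abs_nonneg (t - u)
    have h1 : 0 ≤ K₁ * |t - u| := by positivity
    have h2 : 0 ≤ K₂ * |t - u| := by positivity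
    have h3 := hQL t ht u hu
    have h4 := hPL t ht u hu
    have h5 : dist (z t) (z u) = max |t - u| (max (dist (Q t) (Q u)) (dist (P t) (P u))) := by
      rw [hz]; rfl
    rw [h5, max_le_iff, max_le_iff]
    exact ⟨by linarith, by linarith, by linarith⟩
  have hA : 0 ≤ T * (K₁ * (1 + K₁ + K₂)) := by positivity
  have hB : 0 ≤ T * (K₂ * (1 + K₁ + K₂)) := by positivity
  refine ⟨K₂ + T * (K₁ * (1 + K₁ + K₂)) + T * (K₂ * (1 + K₁ + K₂)), by positivity,
    fun t ht u hu => (hPL t ht u hu).trans (mul_le_mul_of_nonneg_right (by linarith)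
      (abs_nonneg _)), fun N hN k hk s => ⟨?_, ?_⟩⟩
  · have h1 := riemann_of_eq_integral_comp hK₁0 (by positivity) hl₁ hzm hzL hQ hN hk s
    rw [hFQ, hz] at h1
    refine h1.trans ?_
    gcongr
    linarith
  · have h1 := riemann_of_eq_integral_comp hK₂0 (by positivity) hl₂ hzm hzL hP hN hk s
    rw [hFP, hz] at h1
    refine h1.trans ?_
    gcongr
    linarith

/-- Rescaled time, critic and actor after `j` steps. -/
def yPath (N : ℕ) (Q P : ℕ → M.S → ℝ) (j : ℕ) : ℝ × (M.S → ℝ) × (M.S → ℝ) := ((j : ℝ) / N, Q j, P j)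

/-- The distance of the actor from its limit, along a training path, in terms of the initial values,
of the deviation of the initial kernels, and of two martingales. -/
theorem exists_pathwise (hp : GoodKernel M M.p) (hp' : GoodKernel M M.pAux) {K : ℝ}
    (hK : ActBound M m K) (hT : 0 ≤ T) {K0 : ℝ} (hK0 : 0 ≤ K0) {Ql Pl : ℝ → M.S → ℝ}
    (hlim : IsLimit M m T Ql Pl) :
    ∃ vQ vP : M.S → ℝ × (M.S → ℝ) × (M.S → ℝ) → M.S → M.S → ℝ,
      (∀ s s₁ s₂, BddLip (timeDom M T) fun y => vQ s y s₁ s₂) ∧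
      (∀ s s₁ s₂, BddLip (timeDom M T) fun y => vP s y s₁ s₂) ∧ ∃ C : ℝ, 0 ≤ C ∧
      ∀ N : ℕ, 1 ≤ N → ∀ (init : Params dx da N × Params dx da N) (xi xt : ℕ → M.S) (E q0 : ℝ),
      (∀ i, |(init.1 i).1| ≤ K0) → (∀ i, |(init.2 i).1| ≤ K0) → (∀ s, |netOn M m init.1 s| ≤ 1) →
      (∀ s, |netOn M m init.1 s| ≤ q0) → (∀ s, |netOn M m init.2 s| ≤ q0) →
      (∀ s s', |kerN M m init.1 s s' - kerB M m m.nu s s'| ≤ E) →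
      (∀ s s', |kerN M m init.2 s s' - kerB M m m.mu s s'| ≤ E) →
      ∀ (Q P : ℕ → M.S → ℝ), Q = (fun k => netOn M m (trained M m init xi xt k).1) →
      P = (fun k => netOn M m (trained M m init xi xt k).2) →
      ∀ Z : ℕ → ℝ, (∀ k, 0 ≤ Z k) → (∀ k : ℕ, (k : ℝ) ≤ N * T → ∀ s,
        |1 / N * ∑ j ∈ Finset.range k, centered M.p (vQ s) (yPath N Q P j) (xi j) (xi (j + 1))| ≤
          Z k) →
      (∀ k : ℕ, (k : ℝ) ≤ N * T → ∀ s,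
        |1 / N * ∑ j ∈ Finset.range k, centered M.pAux (vP s) (yPath N Q P j) (xt j) (xt (j + 1))| ≤
          Z k) →
      ∀ k : ℕ, (k : ℝ) ≤ N * T → dist (P k) (Pl ((k : ℝ) / N)) ≤
        C * ((N : ℝ) ^ (m.bet - 1) + E + q0 + Z k + 1 / N * ∑ j ∈ Finset.range k, Z j) := by
  obtain ⟨C1, hC1, hpath⟩ := exists_path_bound m hK hT hK0
  obtain ⟨R1, hR1⟩ := isCompact_Icc.exists_bound_of_continuousOn hlim.contQ
  -- A level above both the discrete critic and its limit, so that truncation acts on neither.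
  obtain ⟨R, hR⟩ : ∃ R, R = C1 + |R1| := ⟨_, rfl⟩
  have hR0 : 0 ≤ R := hR ▸ by positivity
  have hRl : ∀ t ∈ Set.Icc 0 T, ‖Ql t‖ ≤ R := fun t ht =>
    (hR1 t ht).trans (by linarith [le_abs_self R1])
  obtain ⟨D, hD0, -, hrie⟩ := hlim.exists_riemann hp hp' hT hR0 hRl
  choose vQ hvQ KQ hKQ hQ using fun s => exists_averaging (T := T) hp (h := incrQ M m R s)
    fun s₁ s₂ => incrQ_bddLip hR0 s s₁ s₂
  choose vP hvP KP hKP hP using fun s => exists_averaging (T := T) hp' (h := incrP M m R s)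
    fun s₁ s₂ => incrP_bddLip hR0 s s₁ s₂
  obtain ⟨L₁, hL₁0, -, hl₁⟩ := BddLip.uniform fun s =>
    fieldQ_bddLip (m := m) (T := T) hp hR0 s
  obtain ⟨L₂, hL₂0, -, hl₂⟩ := BddLip.uniform fun s =>
    fieldP_bddLip (m := m) (T := T) hp' hR0 s
  obtain ⟨L, hL⟩ : ∃ L, L = L₁ + L₂ := ⟨_, rfl⟩
  have hL0 : 0 ≤ L := hL ▸ by positivity
  obtain ⟨Ka, hKa⟩ : ∃ Ka, Ka = ∑ s, (KQ s + KP s) := ⟨_, rfl⟩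
  have hKs : ∀ s, KQ s + KP s ≤ Ka := fun s => hKa ▸ Finset.single_le_sum
    (f := fun s => KQ s + KP s) (fun s _ => add_nonneg (hKQ s) (hKP s)) (Finset.mem_univ s)
  have hKa0 : 0 ≤ Ka := hKa ▸ Finset.sum_nonneg fun s _ => add_nonneg (hKQ s) (hKP s)
  obtain ⟨B, hB⟩ : ∃ B, B = Ka * (2 + T * (1 + C1)) := ⟨_, rfl⟩
  have hB0 : 0 ≤ B := hB ▸ by positivity
  -- The factor `2` accounts for adding the errors of critic and actor, which are coupled and must
  -- be estimated together; for the same reason Gronwall runs with `2 * L`.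
  obtain ⟨C4, hC4⟩ : ∃ C4, C4 = 2 * (1 + T * C1 + B + D) := ⟨_, rfl⟩
  have hC40 : 0 ≤ C4 := hC4 ▸ by positivity
  obtain ⟨G, hG⟩ : ∃ G, G = (2 * L) * Real.exp ((2 * L) * T) := ⟨_, rfl⟩
  have hG0 : 0 ≤ G := hG ▸ by positivity
  refine ⟨vQ, vP, hvQ, hvP, C4 * (1 + G * (T + 1)), by positivity,
    fun N hN init xi xt E q0 h1 h2 hq1 hq hq' hE1 hE2 Q P hQd hPd Z hZ0 hZQ hZP => ?_⟩
  have hN0 : (0 : ℝ) < N := by positivity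
  have he0 := scale_pos (m := m) hN
  have hle := inv_le_scale (m := m) hN
  have hpt := hpath N hN init xi xt E h1 h2 hq1 hE1 hE2 Q P hQd hPd
  set e := (N : ℝ) ^ (m.bet - 1)
  obtain ⟨s0⟩ := M.nonempty_S
  have hE0 : 0 ≤ E := (abs_nonneg _).trans (hE1 s0 s0)
  have hq00 : 0 ≤ q0 := (abs_nonneg _).trans (hq s0)
  have hdiv : ∀ k : ℕ, (k : ℝ) ≤ N * T → (k : ℝ) / N ≤ T := fun k hk => by
    rw [div_le_iff₀ hN0]; linarith
  have hlt : ∀ {j k : ℕ}, j < k → (k : ℝ) ≤ N * T → (j : ℝ) ≤ N * T := fun hj hk =>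
    le_trans (by exact_mod_cast hj.le) hk
  set ε : ℕ → ℝ := fun k => dist (Q k) (Ql ((k : ℝ) / N)) + dist (P k) (Pl ((k : ℝ) / N)) with hε
  have hclamp : ∀ j : ℕ, (j : ℝ) ≤ N * T → clampV R (Q j) = Q j := fun j hj => by
    refine clampV_eq ((pi_norm_le_iff_of_nonneg hR0).2 fun s => ?_)
    exact (hpt j hj s).1.trans (by linarith [abs_nonneg R1])
  have hy : ∀ j : ℕ, (j : ℝ) ≤ N * T → yPath N Q P j ∈ timeDom M T := fun j hj =>
    ⟨by unfold yPath; positivity, hdiv j hj⟩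
  have hyd : ∀ j : ℕ, (j : ℝ) ≤ N * T →
      dist (yPath N Q P (j + 1)) (yPath N Q P j) ≤ (1 + C1) / N := by
    intro j hj
    have e1 : C1 / N ≤ (1 + C1) / N := by gcongr; linarith
    have e2 : 0 ≤ (1 + C1) / N := by positivity
    rw [Prod.dist_eq, Prod.dist_eq, max_le_iff, max_le_iff]
    refine ⟨?_, (dist_pi_le_iff e2).2 fun s => (hpt j hj s).2.1.trans e1,
      (dist_pi_le_iff e2).2 fun s => (hpt j hj s).2.2.1.trans e1⟩
    change |((j + 1 : ℕ) : ℝ) / N - (j : ℝ) / N| ≤ _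
    have : ((j + 1 : ℕ) : ℝ) / N - (j : ℝ) / N = 1 / N := by push_cast; ring
    rw [this, abs_of_pos (by positivity)]
    gcongr
    linarith
  have hzd : ∀ j : ℕ, dist (yPath N Q P j) ((j : ℝ) / N, Ql ((j : ℝ) / N), Pl ((j : ℝ) / N)) ≤
      ε j := by
    intro j
    have d1 := dist_nonneg (x := Q j) (y := Ql ((j : ℝ) / N))
    have d2 := dist_nonneg (x := P j) (y := Pl ((j : ℝ) / N))
    rw [Prod.dist_eq, Prod.dist_eq, max_le_iff, max_le_iff]
    simp only [yPath, dist_self, hε]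
    exact ⟨by linarith, by linarith, by linarith⟩
  have hav : ∀ {k : ℕ} {κ : ℝ}, (k : ℝ) ≤ N * T → 0 ≤ κ → κ ≤ Ka →
      κ * (2 + k * ((1 + C1) / N)) ≤ B := by
    intro k κ hk hκ0 hκ
    have : (k : ℝ) * ((1 + C1) / N) ≤ T * (1 + C1) := by
      calc _ = (k : ℝ) / N * (1 + C1) := by ring
        _ ≤ _ := by gcongr; exact hdiv k hk
    rw [hB]
    gcongr
  have hmain : ∀ k : ℕ, (k : ℝ) ≤ N * T →
      ε k ≤ C4 * (e + E + q0 + Z k) + 2 * L / N * ∑ j ∈ Finset.range k, ε j := by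
    intro k hk
    have hsum : 0 ≤ L / N * ∑ j ∈ Finset.range k, ε j :=
      mul_nonneg (by positivity) (Finset.sum_nonneg fun j _ => add_nonneg dist_nonneg dist_nonneg)
    have hfin : ∀ {x : ℝ}, x ≤ q0 → x + k / N * (C1 * (e + E)) + B / N + Z k + D / N +
        L / N * ∑ j ∈ Finset.range k, ε j ≤
        C4 / 2 * (e + E + q0 + Z k) + L / N * ∑ j ∈ Finset.range k, ε j := by
      intro x hx
      have f1 : (k : ℝ) / N * (C1 * (e + E)) ≤ T * C1 * (e + E) := by
        rw [mul_assoc T]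
        gcongr
        exact hdiv k hk
      have f2 : B / N ≤ B * e := by
        rw [div_eq_mul_one_div]; gcongr
      have f3 : D / N ≤ D * e := by
        rw [div_eq_mul_one_div]; gcongr
      have f4 : C4 / 2 * (e + E + q0 + Z k) - (q0 + T * C1 * (e + E) + B * e + Z k + D * e) =
          e + E + (T * C1) * (q0 + Z k) + B * (E + q0 + Z k) + D * (E + q0 + Z k) := by
        rw [hC4]; ring
      have f5 : 0 ≤ e + E + (T * C1) * (q0 + Z k) + B * (E + q0 + Z k) + D * (E + q0 + Z k) := by
        have := hZ0 k
        positivity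
      linarith
    have hbQ : ∀ s, |Q k s - Ql ((k : ℝ) / N) s| ≤
        C4 / 2 * (e + E + q0 + Z k) + L / N * ∑ j ∈ Finset.range k, ε j := by
      intro s
      refine le_trans (abs_sub_le_of_increments (X := fun k => Q k s)
        (h := fun j => incrQ M m R s (yPath N Q P j) (xi j) (xi (j + 1)))
        (G := fun j => statMean M.p (incrQ M m R s) (yPath N Q P j)) (A := C1 * (e + E)) (B := B)
        (L := L) (ε := ε) hN (fun j hj => ?_) ((hQ s (yPath N Q P) xi ((1 + C1) / N) k
          (fun j hj => hy j (le_trans (by exact_mod_cast hj) hk))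
          (fun j hj => hyd j (hlt hj hk))).trans (hav hk (hKQ s) (by linarith [hKs s, hKP s])))
        (hZQ k hk s) (hrie N hN k (hdiv k hk) s).1 fun j hj => ?_) (hfin ?_)
      · have h := (hpt j (hlt hj hk) s).2.2.2.1
        simp only [incrQ, yPath, hclamp j (hlt hj hk)]
        exact h.trans (le_of_eq (by ring))
      · rw [statMean_incrQ]
        refine (hl₁ s (yPath N Q P j) (hy j (hlt hj hk))
          ((j : ℝ) / N, Ql ((j : ℝ) / N), Pl ((j : ℝ) / N)) (hy j (hlt hj hk))).trans ?_
        exact mul_le_mul (by linarith) (hzd j) dist_nonneg hL0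
      · rw [hQd]
        exact hq s
    have hbP : ∀ s, |P k s - Pl ((k : ℝ) / N) s| ≤
        C4 / 2 * (e + E + q0 + Z k) + L / N * ∑ j ∈ Finset.range k, ε j := by
      intro s
      refine le_trans (abs_sub_le_of_increments (X := fun k => P k s)
        (h := fun j => incrP M m R s (yPath N Q P j) (xt j) (xt (j + 1)))
        (G := fun j => statMean M.pAux (incrP M m R s) (yPath N Q P j)) (A := C1 * (e + E)) (B := B)
        (L := L) (ε := ε) hN (fun j hj => ?_) ((hP s (yPath N Q P) xt ((1 + C1) / N) k
          (fun j hj => hy j (le_trans (by exact_mod_cast hj) hk))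
          (fun j hj => hyd j (hlt hj hk))).trans (hav hk (hKP s) (by linarith [hKs s, hKQ s])))
        (hZP k hk s) (hrie N hN k (hdiv k hk) s).2 fun j hj => ?_) (hfin ?_)
      · have h := (hpt j (hlt hj hk) s).2.2.2.2
        simp only [incrP, yPath, hclamp j (hlt hj hk)]
        exact h.trans (le_of_eq (by ring))
      · rw [statMean_incrP hp']
        refine (hl₂ s (yPath N Q P j) (hy j (hlt hj hk))
          ((j : ℝ) / N, Ql ((j : ℝ) / N), Pl ((j : ℝ) / N)) (hy j (hlt hj hk))).trans ?_
        exact mul_le_mul (by linarith) (hzd j) dist_nonneg hL0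
      · rw [hPd]
        exact hq' s
    have hn : 0 ≤ C4 / 2 * (e + E + q0 + Z k) + L / N * ∑ j ∈ Finset.range k, ε j :=
      (abs_nonneg _).trans (hbQ s0)
    have g1 : dist (Q k) (Ql ((k : ℝ) / N)) ≤ _ := (dist_pi_le_iff hn).2 hbQ
    have g2 : dist (P k) (Pl ((k : ℝ) / N)) ≤ _ := (dist_pi_le_iff hn).2 hbP
    have g3 : 2 * L / N * ∑ j ∈ Finset.range k, ε j =
      L / N * ∑ j ∈ Finset.range k, ε j + L / N * ∑ j ∈ Finset.range k, ε j := by ring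
    rw [g3]
    simp only [hε] at g1 g2 ⊢
    linarith
  intro k hk
  have hgr := gronwall_sum (ε := ε) (L := 2 * L) (by positivity) hN
    (fun k => mul_nonneg hC40 (add_nonneg (by positivity) (hZ0 k))) hmain k hk
  rw [← hG, ← Finset.mul_sum, Finset.sum_add_distrib, Finset.sum_const, Finset.card_range,
    nsmul_eq_mul] at hgr
  have hdP : dist (P k) (Pl ((k : ℝ) / N)) ≤ ε k := le_add_of_nonneg_left dist_nonneg
  have hS : 0 ≤ 1 / N * ∑ j ∈ Finset.range k, Z j :=
    mul_nonneg (by positivity) (Finset.sum_nonneg fun j _ => hZ0 j)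
  have f1 : G * (1 / N * (C4 * (k * (e + E + q0) + ∑ j ∈ Finset.range k, Z j))) ≤
      G * C4 * (T * (e + E + q0) + 1 / N * ∑ j ∈ Finset.range k, Z j) := by
    have : G * (1 / N * (C4 * (k * (e + E + q0) + ∑ j ∈ Finset.range k, Z j))) =
      G * C4 * (k / N * (e + E + q0) + 1 / N * ∑ j ∈ Finset.range k, Z j) := by ring
    rw [this]
    gcongr
    exact hdiv k hk
  have f2 : C4 * (1 + G * (T + 1)) *
      (e + E + q0 + Z k + 1 / N * ∑ j ∈ Finset.range k, Z j) -
      (C4 * (e + E + q0 + Z k) + G * C4 * (T * (e + E + q0) + 1 / N * ∑ j ∈ Finset.range k, Z j)) =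
      C4 * (1 / N * ∑ j ∈ Finset.range k, Z j) + C4 * G * (e + E + q0) +
        C4 * G * (T + 1) * Z k + C4 * G * T * (1 / N * ∑ j ∈ Finset.range k, Z j) := by ring
  have f3 : 0 ≤ C4 * (1 / N * ∑ j ∈ Finset.range k, Z j) + C4 * G * (e + E + q0) +
        C4 * G * (T + 1) * Z k + C4 * G * T * (1 / N * ∑ j ∈ Finset.range k, Z j) := by
    have := hZ0 k
    positivity
  linarith

end Comparison

/-! ### Moments -/

section Moments

variable {Ω : Type*} [MeasurableSpace Ω] {ℙ : Measure Ω} {p : ℕ}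

/-- The `p`-th absolute moment of `Z` is at most `A`. -/
def MomLE (ℙ : Measure Ω) (p : ℕ) (Z : Ω → ℝ) (A : ℝ) : Prop :=
  AEStronglyMeasurable Z ℙ ∧ Integrable (fun ω => |Z ω| ^ p) ℙ ∧ ∫ ω, |Z ω| ^ p ∂ℙ ≤ A

namespace MomLE

variable {Z : Ω → ℝ} {A B : ℝ}

theorem mono (h : MomLE ℙ p Z A) (hAB : A ≤ B) : MomLE ℙ p Z B := ⟨h.1, h.2.1, h.2.2.trans hAB⟩

theorem const [IsProbabilityMeasure ℙ] (c : ℝ) : MomLE ℙ p (fun _ => c) (|c| ^ p) :=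
  ⟨aestronglyMeasurable_const, integrable_const _, by simp⟩

theorem abs (h : MomLE ℙ p Z A) : MomLE ℙ p (fun ω => |Z ω|) A :=
  ⟨continuous_abs.comp_aestronglyMeasurable h.1, by simpa only [abs_abs] using h.2⟩

theorem const_mul (h : MomLE ℙ p Z A) (c : ℝ) : MomLE ℙ p (fun ω => c * Z ω) (|c| ^ p * A) := by
  refine ⟨h.1.const_mul c, ?_⟩
  simp only [abs_mul, mul_pow]
  refine ⟨h.2.1.const_mul _, ?_⟩
  rw [integral_const_mul]
  exact mul_le_mul_of_nonneg_left h.2.2 (by positivity)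

/-- Jensen's inequality for the power function. For averages the factor `card ^ p` is cancelled by
the normalization. -/
theorem sum {ι : Type*} {s : Finset ι} {Z : ι → Ω → ℝ} (hp : 1 ≤ p)
    (h : ∀ i ∈ s, MomLE ℙ p (Z i) A) :
    MomLE ℙ p (fun ω => ∑ i ∈ s, Z i ω) ((s.card : ℝ) ^ p * A) := by
  obtain ⟨n, rfl⟩ : ∃ n, p = n + 1 := ⟨p - 1, by lia⟩
  have hm : AEStronglyMeasurable (fun ω => ∑ i ∈ s, Z i ω) ℙ :=
    Finset.aestronglyMeasurable_fun_sum s fun i hi => (h i hi).1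
  have hle : ∀ ω, |∑ i ∈ s, Z i ω| ^ (n + 1) ≤
      (s.card : ℝ) ^ n * ∑ i ∈ s, |Z i ω| ^ (n + 1) := by
    intro ω
    refine (pow_le_pow_left₀ (abs_nonneg _) (Finset.abs_sum_le_sum_abs _ _) _).trans ?_
    rcases s.eq_empty_or_nonempty with rfl | hs
    · simp
    · have := pow_sum_div_card_le_sum_pow (s := s) (f := fun i => |Z i ω|)
        (fun i _ => abs_nonneg _) n
      rw [div_le_iff₀ (by have := hs.card_pos; positivity)] at this
      linarith
  have hint : Integrable (fun ω => (s.card : ℝ) ^ n * ∑ i ∈ s, |Z i ω| ^ (n + 1)) ℙ :=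
    (integrable_finsetSum s fun i hi => (h i hi).2.1).const_mul _
  have hi : Integrable (fun ω => |∑ i ∈ s, Z i ω| ^ (n + 1)) ℙ := by
    refine hint.mono' ((continuous_abs.comp_aestronglyMeasurable hm).pow _)
      (Eventually.of_forall fun ω => ?_)
    rw [Real.norm_of_nonneg (by positivity)]
    exact hle ω
  refine ⟨hm, hi, (integral_mono hi hint hle).trans ?_⟩
  rw [integral_const_mul, integral_finsetSum s fun i hi => (h i hi).2.1]
  have := Finset.sum_le_card_nsmul s (fun i => ∫ ω, |Z i ω| ^ (n + 1) ∂ℙ) A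
    fun i hi => (h i hi).2.2
  rw [nsmul_eq_mul] at this
  calc _ ≤ (s.card : ℝ) ^ n * (s.card * A) := by gcongr
    _ = _ := by ring

end MomLE

/-- In the regime `N * l ^ 2 ≤ 1` of the central limit theorem the exponential moment is bounded
uniformly in `N`. -/
theorem momLE_iid {E : Type*} [MeasurableSpace E] {ν : Measure E} [IsProbabilityMeasure ν]
    {d : E → ℝ} (hd : Measurable d) {b : ℝ} (hb : ∀ᵐ x ∂ν, |d x| ≤ b) (h0 : ∫ x, d x ∂ν = 0)
    {N : ℕ} {X : Ω → Fin N → E} (hX : MeasurePreserving X ℙ (Measure.pi fun _ => ν)) {l : ℝ}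
    (hl : N * l ^ 2 ≤ 1) :
    MomLE ℙ p (fun ω => l * ∑ i, d (X ω i)) (p.factorial * (2 * Real.exp (b ^ 2))) := by
  have hm : Measurable fun x : Fin N → E => l * ∑ i, d (x i) :=
    (Finset.measurable_sum _ fun i _ => hd.comp (measurable_pi_apply i)).const_mul l
  have hm' : Measurable fun x : Fin N → E => |l * ∑ i, d (x i)| ^ p :=
    ((continuous_abs.measurable.comp hm).pow_const p)
  obtain ⟨h1, h2⟩ := moment_sum_iid_le hd hb h0 l N p
  refine ⟨(hm.comp hX.measurable).aestronglyMeasurable,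
    hX.integrable_comp_of_integrable h1, ?_⟩
  have e : ∫ ω, |l * ∑ i, d (X ω i)| ^ p ∂ℙ =
      ∫ x, |l * ∑ i, d (x i)| ^ p ∂(Measure.pi fun _ : Fin N => ν) := by
    rw [← hX.map_eq, integral_map hX.measurable.aemeasurable hm'.aestronglyMeasurable]
  rw [e]
  refine h2.trans ?_
  rw [← two_mul]
  gcongr
  calc (N : ℝ) * (l * b) ^ 2 = N * l ^ 2 * b ^ 2 := by ring
    _ ≤ 1 * b ^ 2 := by gcongr
    _ = b ^ 2 := one_mul _

end Moments

/-! ### Measurability -/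

section Measurability

variable {dx da : ℕ} {M : MDP dx da} {m : Model dx da}

theorem continuous_act : Continuous m.act := m.act_contDiff.continuous

theorem continuous_deriv_act : Continuous (deriv m.act) :=
  m.act_contDiff.continuous_deriv (by norm_num)

theorem continuous_actAt (s : M.S) : Continuous fun w => actAt M m w s :=
  continuous_act.comp (continuous_id.inner continuous_const)

theorem continuous_derAt (s : M.S) : Continuous fun w => derAt M m w s :=
  continuous_deriv_act.comp (continuous_id.inner continuous_const)

theorem continuous_kerFun (s s' : M.S) : Continuous (kerFun M m s s') := by
  have h1 := continuous_actAt (M := M) (m := m)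
  have h2 := continuous_derAt (M := M) (m := m)
  unfold kerFun
  exact (((h1 s).comp continuous_snd).mul ((h1 s').comp continuous_snd)).add
    (((((continuous_fst.pow 2).mul ((h2 s).comp continuous_snd))).mul
      ((h2 s').comp continuous_snd)).mul continuous_const)

theorem continuous_netOn {N : ℕ} (s : M.S) :
    Continuous fun th : Params dx da N => netOn M m th s := by
  refine continuous_const.mul (continuous_finsetSum _ fun i _ => ?_)
  exact (continuous_fst.comp (continuous_apply i)).mul
    ((continuous_actAt s).comp (continuous_snd.comp (continuous_apply i)))

theorem continuous_softmax (s : M.S) : Continuous fun P : M.S → ℝ => M.softmax P s := by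
  refine Continuous.div (by fun_prop) (by fun_prop) fun P => (MDP.sum_exp_pos P s.1).ne'

theorem continuous_gradStep {N : ℕ} {X : Type*} [TopologicalSpace X] {κ : X → ℝ} {μ : X → M.S → ℝ}
    {th : X → Params dx da N} (hκ : Continuous κ) (hμ : Continuous μ) (hth : Continuous th) :
    Continuous fun x => gradStep M m (κ x) (μ x) (th x) := by
  have h1 := continuous_actAt (M := M) (m := m)
  have h2 := continuous_derAt (M := M) (m := m)
  refine continuous_pi fun i => ?_
  have hi : Continuous fun x => th x i := (continuous_apply i).comp hth
  have hμs : ∀ s, Continuous fun x => μ x s := fun s => (continuous_apply s).comp hμ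
  refine Continuous.prodMk ?_ ?_
  · exact (continuous_fst.comp hi).add (hκ.mul (continuous_finsetSum _ fun s _ =>
      (hμs s).mul ((h1 s).comp (continuous_snd.comp hi))))
  · exact (continuous_snd.comp hi).add (hκ.smul (continuous_finsetSum _ fun s _ =>
      (hμs s).smul (((continuous_fst.comp hi).mul
        ((h2 s).comp (continuous_snd.comp hi))).smul continuous_const)))

theorem continuous_criticStep {N : ℕ} (s s' : M.S) :
    Continuous fun om : Params dx da N => criticStep M m om s s' := by
  classical
  simp only [criticStep_eq]
  refine continuous_gradStep (continuous_const.mul ?_) continuous_const continuous_id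
  exact (continuous_const.add (continuous_const.mul (continuous_netOn s'))).sub (continuous_netOn s)

theorem continuous_actorStep {N : ℕ} (k : ℕ) (s : M.S) :
    Continuous fun q : Params dx da N × Params dx da N => actorStep M m k q.1 q.2 s := by
  simp only [actorStep_eq]
  refine continuous_gradStep (continuous_const.mul ((continuous_netOn s).comp continuous_fst)) ?_
    continuous_snd
  refine continuous_pi fun s' => ?_
  unfold actorWeight
  refine continuous_const.sub ?_
  split_ifs
  · exact (continuous_softmax s').comp
      (continuous_pi fun s => (continuous_netOn s).comp continuous_snd)
  · exact continuous_const

variable {N : ℕ} {Ω : Type*} [mΩ : MeasurableSpace Ω] {ℙ : Measure Ω} (R : Run M m N ℙ)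

/-- The parameters of critic and actor after `k` steps of a run. -/
def Run.params (k : ℕ) (ω : Ω) : Params dx da N × Params dx da N :=
  trained M m (R.init ω) (fun j => R.xi j ω) (fun j => R.xt j ω) k

theorem Run.params_measurable (k : ℕ) : Measurable[R.F k] (R.params k) := by
  induction k with
  | zero => exact R.init_meas
  | succ k ih =>
    have hle := R.F.mono (Nat.le_succ k)
    have ih' : Measurable[R.F (k + 1)] (R.params k) := ih.mono hle le_rfl
    have h1 : Measurable[R.F (k + 1)] fun ω => (R.xi k ω, R.xi (k + 1) ω) :=
      ((R.xi_meas k).mono hle le_rfl).prodMk (R.xi_meas (k + 1))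
    have h2 : Measurable[R.F (k + 1)] (R.xt k) := (R.xt_meas k).mono hle le_rfl
    -- For fixed samples the update is continuous in the parameters, and there are only finitely
    -- many samples.
    have hc : Measurable fun z : (M.S × M.S) × Params dx da N => criticStep M m z.2 z.1.1 z.1.2 :=
      measurable_from_prod_countable_right fun s => (continuous_criticStep s.1 s.2).measurable
    have ha : Measurable fun z : M.S × Params dx da N × Params dx da N =>
        actorStep M m k z.2.1 z.2.2 z.1 :=
      measurable_from_prod_countable_right fun s => (continuous_actorStep k s).measurable
    exact (hc.comp (h1.prodMk (measurable_fst.comp ih'))).prodMk (ha.comp (h2.prodMk ih'))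

/-- The critic after `k` steps of a run. -/
def Run.Q (k : ℕ) (ω : Ω) : M.S → ℝ := netOn M m (R.params k ω).1

/-- The actor network after `k` steps of a run. -/
def Run.P (k : ℕ) (ω : Ω) : M.S → ℝ := netOn M m (R.params k ω).2

theorem measurable_netOn : Measurable fun th : Params dx da N => netOn M m th :=
  (continuous_pi fun s => continuous_netOn s).measurable

theorem Run.Q_measurable (k : ℕ) : Measurable[R.F k] (R.Q k) :=
  measurable_netOn.comp (measurable_fst.comp (R.params_measurable k))

theorem Run.P_measurable (k : ℕ) : Measurable[R.F k] (R.P k) :=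
  measurable_netOn.comp (measurable_snd.comp (R.params_measurable k))

/-- A function that is bounded Lipschitz on `timeDom` is measurable in the two networks. -/
theorem BddLip.measurable_slice {T : ℝ} {f : ℝ × (M.S → ℝ) × (M.S → ℝ) → ℝ}
    (hf : BddLip (timeDom M T) f) {t : ℝ} (ht : t ∈ Set.Icc 0 T) :
    Measurable fun x : (M.S → ℝ) × (M.S → ℝ) => f (t, x) := by
  have h : Continuous fun x : (M.S → ℝ) × (M.S → ℝ) => f (t, x) :=
    hf.continuousOn.comp_continuous (continuous_const.prodMk continuous_id) fun x => ht
  exact h.measurable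

end Measurability

/-! ### Moments of the initial errors and of the martingale averages -/

section RunMoments

variable {dx da : ℕ} {M : MDP dx da} {m : Model dx da}

instance isProbabilityMeasure_nu : IsProbabilityMeasure m.nu := by
  have := m.probC
  have := m.probW
  unfold Model.nu
  infer_instance

instance isProbabilityMeasure_mu : IsProbabilityMeasure m.mu := by
  have := m.probB
  have := m.probU
  unfold Model.mu
  infer_instance

/-- A law of a real and a weight that is a product, with a bounded centered first factor. -/
structure CenteredLaw (dx da : ℕ) (ν : Measure (ℝ × Feat dx da)) (K0 : ℝ) : Prop where
  prob : IsProbabilityMeasure ν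
  bdd : ∀ᵐ z ∂ν, |z.1| ≤ K0
  mean : ∀ g : Feat dx da → ℝ, ∫ z, z.1 * g z.2 ∂ν = 0

/-- Independence splits off the mean-zero outer weight; the product formula holds without
integrability, so `g` is arbitrary. -/
theorem exists_centeredLaw (m : Model dx da) :
    ∃ K0 : ℝ, 0 ≤ K0 ∧ CenteredLaw dx da m.nu K0 ∧ CenteredLaw dx da m.mu K0 := by
  have := m.probC
  have := m.probW
  have := m.probB
  have := m.probU
  obtain ⟨K1, h1⟩ := m.bddC
  obtain ⟨K2, h2⟩ := m.bddB
  refine ⟨max 0 (max K1 K2), le_max_left _ _, ⟨inferInstance, ?_, fun g => ?_⟩,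
    ⟨inferInstance, ?_, fun g => ?_⟩⟩
  · filter_upwards [(Measure.quasiMeasurePreserving_fst (μ := m.lawC) (ν := m.lawW)).ae h1]
      with z hz
    exact hz.trans ((le_max_left _ _).trans (le_max_right _ _))
  · rw [Model.nu, integral_prod_mul (fun c => c) g, m.meanC, zero_mul]
  · filter_upwards [(Measure.quasiMeasurePreserving_fst (μ := m.lawB) (ν := m.lawU)).ae h2]
      with z hz
    exact hz.trans ((le_max_right _ _).trans (le_max_right _ _))
  · rw [Model.mu, integral_prod_mul (fun c => c) g, m.meanB, zero_mul]

theorem abs_kerFun_le {K K0 : ℝ} (hK : ActBound M m K) {z : ℝ × Feat dx da} (hz : |z.1| ≤ K0)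
    (s s' : M.S) : |kerFun M m s s' z| ≤ K ^ 2 + K0 ^ 2 * K ^ 4 := by
  have hKn : 0 ≤ K := zero_le_one.trans hK.one_le
  have hi : |inner ℝ (M.feat s) (M.feat s')| ≤ K * K :=
    (abs_real_inner_le_norm _ _).trans
      (mul_le_mul (hK.feat_le s) (hK.feat_le s') (norm_nonneg _) hKn)
  have h0 : |z.1 ^ 2| ≤ K0 ^ 2 := by
    rw [abs_pow]
    exact pow_le_pow_left₀ (abs_nonneg _) hz 2
  unfold kerFun
  refine (abs_add_le _ _).trans ?_
  simp only [abs_mul]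
  have h1 := hK.act_le z.2 s
  have h2 := hK.act_le z.2 s'
  have h3 := hK.der_le z.2 s
  have h4 := hK.der_le z.2 s'
  calc _ ≤ K * K + K0 ^ 2 * K * K * (K * K) := by gcongr
    _ = _ := by ring

variable {Ω : Type*} [mΩ : MeasurableSpace Ω] {ℙ : Measure Ω} [IsProbabilityMeasure ℙ] {N p : ℕ}

theorem rpow_neg_half_sq (hN : 1 ≤ N) : (N : ℝ) ^ (-(1 / 2) : ℝ) * (N : ℝ) ^ (-(1 / 2) : ℝ) =
    1 / N := by
  have hN0 : (0 : ℝ) < N := by positivity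
  rw [← Real.rpow_add hN0, one_div (N : ℝ), ← Real.rpow_neg_one]
  norm_num

theorem natCast_mul_rpow_neg_half_sq (hN : 1 ≤ N) : N * ((N : ℝ) ^ (-(1 / 2) : ℝ)) ^ 2 ≤ 1 := by
  have hN0 : (0 : ℝ) < N := by positivity
  rw [sq, rpow_neg_half_sq hN, mul_one_div_cancel hN0.ne']

theorem rpow_neg_half_le (hN : 1 ≤ N) : (N : ℝ) ^ (-(1 / 2) : ℝ) ≤ (N : ℝ) ^ (1 / 2 - m.bet) :=
  Real.rpow_le_rpow_of_exponent_le (Nat.one_le_cast.2 hN) (by linarith [m.bet_mem.2])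

/-- The outputs of the initial network, and the deviation of its kernel from the limit, are of order
`N ^ (1 / 2 - bet)`. -/
theorem exists_init_moment {K : ℝ} (hK : ActBound M m K) {ν : Measure (ℝ × Feat dx da)} {K0 : ℝ}
    (hν : CenteredLaw dx da ν K0) (p : ℕ) : ∃ A : ℝ, 0 ≤ A ∧ ∀ N : ℕ, 1 ≤ N →
      ∀ {Ω : Type*} [MeasurableSpace Ω] {ℙ : Measure Ω} [IsProbabilityMeasure ℙ]
      {X : Ω → Params dx da N}, MeasurePreserving X ℙ (Measure.pi fun _ => ν) → ∀ s s',
      MomLE ℙ p (fun ω => netOn M m (X ω) s) (A * ((N : ℝ) ^ (1 / 2 - m.bet)) ^ p) ∧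
      MomLE ℙ p (fun ω => kerN M m (X ω) s s' - kerB M m ν s s')
        (A * ((N : ℝ) ^ (1 / 2 - m.bet)) ^ p) := by
  have := hν.prob
  have hKn : 0 ≤ K := zero_le_one.trans hK.one_le
  have hK0 : 0 ≤ K0 := by
    obtain ⟨z, hz⟩ := hν.bdd.exists
    exact (abs_nonneg _).trans hz
  -- The first term bounds the output of a unit, the second one the centered kernel integrand; the
  -- sum serves both claims.
  obtain ⟨b, hb⟩ : ∃ b, b = K0 * K + 2 * (K ^ 2 + K0 ^ 2 * K ^ 4) := ⟨_, rfl⟩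
  refine ⟨p.factorial * (2 * Real.exp (b ^ 2)), by positivity,
    fun N hN Ω _ ℙ _ X hX s s' => ⟨?_, ?_⟩⟩
  · have hN0 : (0 : ℝ) < N := by positivity
    have hm : Measurable fun z : ℝ × Feat dx da => z.1 * actAt M m z.2 s :=
      (continuous_fst.mul ((continuous_actAt s).comp continuous_snd)).measurable
    have h := (momLE_iid (p := p) hm (b := b) (by
      filter_upwards [hν.bdd] with z hz
      rw [abs_mul]
      refine (mul_le_mul hz (hK.act_le z.2 s) (abs_nonneg _) hK0).trans ?_
      rw [hb]
      exact le_add_of_nonneg_right (by positivity)) (hν.mean fun w => actAt M m w s) hX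
      (natCast_mul_rpow_neg_half_sq hN)).const_mul ((N : ℝ) ^ (1 / 2 - m.bet))
    -- The scaling is split into the factor `N ^ (-1 / 2)` of the central limit theorem and the rate
    -- that remains.
    have e : ∀ ω, netOn M m (X ω) s = (N : ℝ) ^ (1 / 2 - m.bet) *
        ((N : ℝ) ^ (-(1 / 2) : ℝ) * ∑ i, (X ω i).1 * actAt M m (X ω i).2 s) := by
      intro ω
      rw [← mul_assoc, ← Real.rpow_add hN0]
      have : 1 / 2 - m.bet + -(1 / 2) = -m.bet := by ring
      rw [this, Real.rpow_neg hN0.le, ← one_div]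
      rfl
    simp only [e]
    refine h.mono (le_of_eq ?_)
    rw [abs_of_nonneg (by positivity), mul_comm]
  · have hN0 : (0 : ℝ) < N := by positivity
    have hbd : ∀ᵐ z ∂ν, |kerFun M m s s' z| ≤ K ^ 2 + K0 ^ 2 * K ^ 4 := by
      filter_upwards [hν.bdd] with z hz
      exact abs_kerFun_le hK hz s s'
    have hint : Integrable (kerFun M m s s') ν :=
      Integrable.of_bound (continuous_kerFun s s').measurable.aestronglyMeasurable _ hbd
    have hkB : kerB M m ν s s' = ∫ z, kerFun M m s s' z ∂ν := rfl
    have hkb : |kerB M m ν s s'| ≤ K ^ 2 + K0 ^ 2 * K ^ 4 := by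
      have := norm_integral_le_of_norm_le_const (f := kerFun M m s s')
        (C := K ^ 2 + K0 ^ 2 * K ^ 4) hbd
      simpa [hkB] using this
    have h := (momLE_iid (p := p) ((continuous_kerFun s s').measurable.sub_const
      (kerB M m ν s s')) (b := b) (by
      filter_upwards [hbd] with z hz
      refine (abs_sub _ _).trans ?_
      rw [hb]
      have : 0 ≤ K0 * K := by positivity
      linarith) (by
        rw [integral_sub hint (integrable_const _), ← hkB]
        simp) hX (natCast_mul_rpow_neg_half_sq hN)).const_mul ((N : ℝ) ^ (-(1 / 2) : ℝ))
    have e : ∀ ω, kerN M m (X ω) s s' - kerB M m ν s s' = (N : ℝ) ^ (-(1 / 2) : ℝ) *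
        ((N : ℝ) ^ (-(1 / 2) : ℝ) * ∑ i, (kerFun M m s s' (X ω i) - kerB M m ν s s')) := by
      intro ω
      rw [← mul_assoc, rpow_neg_half_sq hN, Finset.sum_sub_distrib, kerN, mul_sub]
      congr 1
      simp only [Finset.sum_const, Finset.card_univ, Fintype.card_fin, nsmul_eq_mul]
      field_simp
    simp only [e]
    refine h.mono ?_
    rw [abs_of_nonneg (by positivity), mul_comm]
    have := rpow_neg_half_le (m := m) hN
    gcongr

/-- The transition probabilities of a sample path of a run. -/
def Run.kap (R : Run M m N ℙ) (q : M.S → M.X → ℝ) (ξ : ℕ → Ω → M.S) (j : ℕ) (ω : Ω) (s : M.S) :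
    ℝ :=
  M.trans q (explorePolicy M m j (R.params j ω).2) (ξ j ω) s

/-- A function of the transitions of a sample path, with time stopped at `T`. -/
def Run.val (R : Run M m N ℙ) (T : ℝ) (v : ℝ × (M.S → ℝ) × (M.S → ℝ) → M.S → M.S → ℝ)
    (ξ : ℕ → Ω → M.S) (j : ℕ) (ω : Ω) (s : M.S) : ℝ :=
  v (min ((j : ℝ) / N) T, R.Q j ω, R.P j ω) (ξ j ω) s

omit [IsProbabilityMeasure ℙ] in
theorem Run.sum_centered_eq (R : Run M m N ℙ) (hN : 1 ≤ N) (q : M.S → M.X → ℝ)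
    (v : ℝ × (M.S → ℝ) × (M.S → ℝ) → M.S → M.S → ℝ) (ξ : ℕ → Ω → M.S) {T : ℝ} {k : ℕ}
    (hk : (k : ℝ) ≤ N * T) (ω : Ω) :
    ∑ j ∈ Finset.range k, centered q v (yPath N (fun j => R.Q j ω) (fun j => R.P j ω) j) (ξ j ω)
      (ξ (j + 1) ω) = ∑ j ∈ Finset.range k, martIncr ξ (R.kap q ξ) (R.val T v ξ) j ω := by
  refine Finset.sum_congr rfl fun j hj => ?_
  have hN0 : (0 : ℝ) < N := by positivity
  have hjT : (j : ℝ) / N ≤ T := by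
    rw [div_le_iff₀ hN0, mul_comm]
    refine le_trans ?_ hk
    exact_mod_cast (Finset.mem_range.1 hj).le
  unfold centered martIncr Run.val
  rw [min_eq_left hjT]
  rfl

/-- The boundedness of `v` on `timeDom` makes the martingale increments bounded without any control
of the random networks. At scale `N ^ (-1 / 2)` the moments are bounded, and the second factor `N ^
(-1 / 2)` of `1 / N` is at most the claimed rate. -/
theorem Run.moment_mart_le (R : Run M m N ℙ) (hN : 1 ≤ N) {q : M.S → M.X → ℝ}
    (hq : GoodKernel M q) {ξ : ℕ → Ω → M.S} (hξ : ∀ k, Measurable[R.F k] (ξ k))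
    (hstep : ∀ k s, ℙ[Set.indicator {ω | ξ (k + 1) ω = s} (fun _ => (1 : ℝ)) | R.F k] =ᵐ[ℙ]
      fun ω => M.trans q (explorePolicy M m k (R.params k ω).2) (ξ k ω) s) {T : ℝ} (hT : 0 ≤ T)
    {v : ℝ × (M.S → ℝ) × (M.S → ℝ) → M.S → M.S → ℝ}
    (hv : ∀ s s', BddLip (timeDom M T) fun y => v y s s') {b : ℝ}
    (hb : ∀ s s', ∀ y ∈ timeDom M T, |v y s s'| ≤ b) {k : ℕ} (hk : (k : ℝ) ≤ N * T) (p : ℕ) :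
    MomLE ℙ p (fun ω => 1 / N * ∑ j ∈ Finset.range k, martIncr ξ (R.kap q ξ) (R.val T v ξ) j ω)
      (p.factorial * (2 * Real.exp (T * (4 * b ^ 2))) * ((N : ℝ) ^ (1 / 2 - m.bet)) ^ p) := by
  have hN0 : (0 : ℝ) < N := by positivity
  -- The moment lemma asks for a bound at every index, also beyond `N * T`; stopping the time
  -- variable provides it.
  have htm : ∀ j : ℕ, min ((j : ℝ) / N) T ∈ Set.Icc 0 T := fun j =>
    ⟨le_min (by positivity) hT, min_le_right _ _⟩
  have hpol : ∀ (j : ℕ) ω, M.IsPositivePolicy (explorePolicy M m j (R.params j ω).2) := fun j ω =>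
    MDP.explore_softmax_isPositivePolicy _ _
  have hκ : ∀ j s, Measurable[R.F j] fun ω => R.kap q ξ j ω s := by
    intro j s
    have hc : Continuous fun P : M.S → ℝ => M.explore (eta ((j : ℝ) / N)) (M.softmax P) s :=
      continuous_const.add (continuous_const.mul (continuous_softmax s))
    have h1 : Measurable[R.F j] fun ω => explorePolicy M m j (R.params j ω).2 s :=
      hc.measurable.comp (R.P_measurable j)
    have h2 : Measurable fun s₀ : M.S => q s₀ s.1 := measurable_of_finite _
    exact (h2.comp (hξ j)).mul h1
  have hV : ∀ j s, Measurable[R.F j] fun ω => R.val T v ξ j ω s := by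
    intro j s
    refine measurable_eval_of_finite (U := fun ω s₀ =>
      v (min ((j : ℝ) / N) T, R.Q j ω, R.P j ω) s₀ s) (hξ j) fun s₀ => ?_
    exact ((hv s₀ s).measurable_slice (htm j)).comp ((R.Q_measurable j).prodMk (R.P_measurable j))
  have hmart := moment_sum_martIncr_le (ℙ := ℙ) (F := R.F) (b := b) hξ hκ hV
    (fun j ω s => hq.trans_nonneg (hpol j ω) _ _) (fun j ω => hq.trans_sum (hpol j ω) _) hstep
    (fun j ω s => hb _ _ _ (htm j)) ((N : ℝ) ^ (-(1 / 2) : ℝ)) k p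
  have h : MomLE ℙ p (fun ω => (N : ℝ) ^ (-(1 / 2) : ℝ) *
      ∑ j ∈ Finset.range k, martIncr ξ (R.kap q ξ) (R.val T v ξ) j ω)
      (p.factorial * (2 * Real.exp (T * (4 * b ^ 2)))) := by
    refine ⟨(((sum_martIncr_measurable hξ hκ hV k).mono (R.F.le k)
      le_rfl).const_mul _).aestronglyMeasurable, hmart.1, hmart.2.trans ?_⟩
    have hexp : (k : ℝ) * ((N : ℝ) ^ (-(1 / 2) : ℝ) * (2 * b)) ^ 2 ≤ T * (4 * b ^ 2) := by
      calc (k : ℝ) * ((N : ℝ) ^ (-(1 / 2) : ℝ) * (2 * b)) ^ 2 =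
            k * ((N : ℝ) ^ (-(1 / 2) : ℝ)) ^ 2 * (4 * b ^ 2) := by ring
        _ ≤ (N * T) * ((N : ℝ) ^ (-(1 / 2) : ℝ)) ^ 2 * (4 * b ^ 2) := by gcongr
        _ = (N * ((N : ℝ) ^ (-(1 / 2) : ℝ)) ^ 2) * (T * (4 * b ^ 2)) := by ring
        _ ≤ 1 * (T * (4 * b ^ 2)) :=
            mul_le_mul_of_nonneg_right (natCast_mul_rpow_neg_half_sq hN) (by positivity)
        _ = T * (4 * b ^ 2) := one_mul _
    rw [← two_mul]
    exact mul_le_mul_of_nonneg_left (mul_le_mul_of_nonneg_left (Real.exp_le_exp.2 hexp)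
      zero_le_two) (by positivity)
  have e : ∀ x : ℝ, 1 / N * x = (N : ℝ) ^ (-(1 / 2) : ℝ) * ((N : ℝ) ^ (-(1 / 2) : ℝ) * x) :=
    fun x => by rw [← mul_assoc, rpow_neg_half_sq hN]
  simp only [e]
  refine (h.const_mul ((N : ℝ) ^ (-(1 / 2) : ℝ))).mono ?_
  rw [abs_of_nonneg (by positivity), mul_comm]
  have := rpow_neg_half_le (m := m) hN
  gcongr

end RunMoments

/-! ### Convergence -/

section Convergence

variable {dx da : ℕ} {M : MDP dx da} {m : Model dx da}

theorem MomLE.add {Ω : Type*} [MeasurableSpace Ω] {ℙ : Measure Ω} {p : ℕ} (hp : 1 ≤ p)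
    {Z Z' : Ω → ℝ} {A : ℝ} (h : MomLE ℙ p Z A) (h' : MomLE ℙ p Z' A) :
    MomLE ℙ p (fun ω => Z ω + Z' ω) (2 ^ p * A) := by
  have := MomLE.sum (s := Finset.univ) (Z := fun i : Fin 2 => if i = 0 then Z else Z') hp
    (A := A) (fun i _ => by fin_cases i <;> assumption)
  simpa using this

theorem MomLE.avg {Ω : Type*} [MeasurableSpace Ω] {ℙ : Measure Ω} {p : ℕ} (hp : 1 ≤ p) {N : ℕ}
    (hN : 1 ≤ N) {T : ℝ} {k : ℕ} (hk : (k : ℝ) ≤ N * T) {Z : ℕ → Ω → ℝ} {A : ℝ} (hA : 0 ≤ A)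
    (h : ∀ j < k, MomLE ℙ p (Z j) A) :
    MomLE ℙ p (fun ω => 1 / N * ∑ j ∈ Finset.range k, Z j ω) (T ^ p * A) := by
  have hN0 : (0 : ℝ) < N := by positivity
  refine ((MomLE.sum hp fun j hj => h j (Finset.mem_range.1 hj)).const_mul (1 / (N : ℝ))).mono ?_
  rw [Finset.card_range, ← mul_assoc, ← mul_pow, abs_of_nonneg (by positivity)]
  refine mul_le_mul_of_nonneg_right (pow_le_pow_left₀ (by positivity) ?_ _) hA
  rw [one_div_mul_eq_div, div_le_iff₀ hN0, mul_comm]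
  exact hk

theorem Run.measurePreserving_init {N : ℕ} {Ω : Type*} [MeasurableSpace Ω] {ℙ : Measure Ω}
    (R : Run M m N ℙ) : MeasurePreserving R.init ℙ
      ((Measure.pi fun _ : Fin N => m.nu).prod (Measure.pi fun _ : Fin N => m.mu)) :=
  ⟨R.init_meas.mono (R.F.le 0) le_rfl, R.init_law⟩

theorem CenteredLaw.ae_abs_fst_le {ν : Measure (ℝ × Feat dx da)} {K0 : ℝ}
    (hν : CenteredLaw dx da ν K0) {N : ℕ} {Ω : Type*} [MeasurableSpace Ω] {ℙ : Measure Ω}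
    {X : Ω → Params dx da N} (hX : MeasurePreserving X ℙ (Measure.pi fun _ => ν)) :
    ∀ᵐ ω ∂ℙ, ∀ i, |(X ω i).1| ≤ K0 := by
  have := hν.prob
  refine ae_all_iff.2 fun i => ?_
  exact ((measurePreserving_eval (fun _ : Fin N => ν) i).comp hX).quasiMeasurePreserving.ae hν.bdd

/-- The size of the initial networks and the deviation of their kernels from the limits. -/
def initError (M : MDP dx da) (m : Model dx da) {N : ℕ}
    (init : Params dx da N × Params dx da N) : ℝ :=
  (∑ s, |netOn M m init.1 s| + ∑ s, |netOn M m init.2 s|) +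
    (∑ s, ∑ s', |kerN M m init.1 s s' - kerB M m m.nu s s'| +
      ∑ s, ∑ s', |kerN M m init.2 s s' - kerB M m m.mu s s'|)

theorem abs_le_sum_abs {ι : Type*} [Fintype ι] (f : ι → ℝ) (i : ι) : |f i| ≤ ∑ j, |f j| :=
  Finset.single_le_sum (f := fun j => |f j|) (fun _ _ => abs_nonneg _) (Finset.mem_univ i)

theorem abs_le_sum_sum_abs {ι : Type*} [Fintype ι] (f : ι → ι → ℝ) (i i' : ι) :
    |f i i'| ≤ ∑ j, ∑ j', |f j j'| :=
  (abs_le_sum_abs (f i) i').trans (Finset.single_le_sum (f := fun j => ∑ j', |f j j'|)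
    (fun _ _ => Finset.sum_nonneg fun _ _ => abs_nonneg _) (Finset.mem_univ i))

theorem le_initError {N : ℕ} (init : Params dx da N × Params dx da N) (s s' : M.S) :
    (|netOn M m init.1 s| ≤ initError M m init ∧ |netOn M m init.2 s| ≤ initError M m init) ∧
    |kerN M m init.1 s s' - kerB M m m.nu s s'| ≤ initError M m init ∧
    |kerN M m init.2 s s' - kerB M m m.mu s s'| ≤ initError M m init := by
  have h1 := abs_le_sum_abs (netOn M m init.1) s
  have h2 := abs_le_sum_abs (netOn M m init.2) s
  have h3 := abs_le_sum_sum_abs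
    (fun s s' => kerN M m init.1 s s' - kerB M m m.nu s s') s s'
  have h4 := abs_le_sum_sum_abs
    (fun s s' => kerN M m init.2 s s' - kerB M m m.mu s s') s s'
  have p1 := abs_nonneg (netOn M m init.1 s)
  have p2 := abs_nonneg (netOn M m init.2 s)
  have p3 := abs_nonneg (kerN M m init.1 s s' - kerB M m m.nu s s')
  have p4 := abs_nonneg (kerN M m init.2 s s' - kerB M m m.mu s s')
  unfold initError
  refine ⟨⟨?_, ?_⟩, ?_, ?_⟩ <;> linarith

theorem initError_nonneg {N : ℕ} (init : Params dx da N × Params dx da N) :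
    0 ≤ initError M m init := by
  unfold initError
  positivity

/-- The averages of the martingale differences in the estimates of a run. -/
def Run.noise {N : ℕ} {Ω : Type*} [MeasurableSpace Ω] {ℙ : Measure Ω} (R : Run M m N ℙ) (T : ℝ)
    (vQ vP : M.S → ℝ × (M.S → ℝ) × (M.S → ℝ) → M.S → M.S → ℝ) (j : ℕ) (ω : Ω) : ℝ :=
  ∑ s, |1 / N * ∑ i ∈ Finset.range j,
    martIncr R.xi (R.kap M.p R.xi) (R.val T (vQ s) R.xi) i ω| +
  ∑ s, |1 / N * ∑ i ∈ Finset.range j,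
    martIncr R.xt (R.kap M.pAux R.xt) (R.val T (vP s) R.xt) i ω|

theorem Run.noise_nonneg {N : ℕ} {Ω : Type*} [MeasurableSpace Ω] {ℙ : Measure Ω}
    (R : Run M m N ℙ) {T : ℝ} {vQ vP : M.S → ℝ × (M.S → ℝ) × (M.S → ℝ) → M.S → M.S → ℝ} (j : ℕ)
    (ω : Ω) : 0 ≤ R.noise T vQ vP j ω := by
  unfold Run.noise
  positivity

theorem MomLE.sum_abs {ι : Type*} [Fintype ι] {Ω : Type*} [MeasurableSpace Ω] {ℙ : Measure Ω}
    {p : ℕ} (hp : 1 ≤ p) {Z : ι → Ω → ℝ} {A : ℝ} (h : ∀ s, MomLE ℙ p (Z s) A) :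
    MomLE ℙ p (fun ω => ∑ s, |Z s ω|) ((Fintype.card ι : ℝ) ^ p * A) :=
  MomLE.sum (s := Finset.univ) hp fun s _ => (h s).abs

theorem exists_initError_moment (M : MDP dx da) (m : Model dx da) {p : ℕ} (hp : 1 ≤ p) :
    ∃ A : ℝ, 0 ≤ A ∧ ∀ N : ℕ, 1 ≤ N → ∀ {Ω : Type*} [MeasurableSpace Ω] {ℙ : Measure Ω}
      [IsProbabilityMeasure ℙ] (R : Run M m N ℙ),
      MomLE ℙ p (fun ω => initError M m (R.init ω)) (A * ((N : ℝ) ^ (1 / 2 - m.bet)) ^ p) := by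
  obtain ⟨K, hK⟩ := exists_actBound M m
  obtain ⟨K0, -, hν, hμ⟩ := exists_centeredLaw m
  obtain ⟨A1, hA1, hm1⟩ := exists_init_moment hK hν p
  obtain ⟨A2, hA2, hm2⟩ := exists_init_moment hK hμ p
  obtain ⟨d, hd⟩ : ∃ d : ℝ, d = (Fintype.card M.S : ℝ) ^ p := ⟨_, rfl⟩
  have hd0 : 0 ≤ d := hd ▸ by positivity
  refine ⟨2 ^ p * (2 ^ p * (d * (A1 + A2)) + 2 ^ p * (d * (d * (A1 + A2)))), by positivity,
    fun N hN Ω _ ℙ _ R => ?_⟩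
  obtain ⟨r, hr⟩ : ∃ r, r = ((N : ℝ) ^ (1 / 2 - m.bet)) ^ p := ⟨_, rfl⟩
  have hr0 : 0 ≤ r := hr ▸ by positivity
  have hX1 : MeasurePreserving (fun ω => (R.init ω).1) ℙ (Measure.pi fun _ => m.nu) :=
    measurePreserving_fst.comp R.measurePreserving_init
  have hX2 : MeasurePreserving (fun ω => (R.init ω).2) ℙ (Measure.pi fun _ => m.mu) :=
    measurePreserving_snd.comp R.measurePreserving_init
  have hl : A1 * r ≤ (A1 + A2) * r := mul_le_mul_of_nonneg_right (by linarith) hr0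
  have hl' : A2 * r ≤ (A1 + A2) * r := mul_le_mul_of_nonneg_right (by linarith) hr0
  have h1 := hm1 N hN hX1
  have h2 := hm2 N hN hX2
  rw [← hr] at h1 h2 ⊢
  have hB : 0 ≤ (A1 + A2) * r := by positivity
  have i1 := MomLE.add hp (MomLE.sum_abs hp fun s => (h1 s s).1.mono hl)
    (MomLE.sum_abs hp fun s => (h2 s s).1.mono hl')
  have i2 := MomLE.add hp
    (MomLE.sum (s := Finset.univ) hp fun s _ => MomLE.sum_abs hp fun s' => (h1 s s').2.mono hl)
    (MomLE.sum (s := Finset.univ) hp fun s _ => MomLE.sum_abs hp fun s' => (h2 s s').2.mono hl')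
  rw [Finset.card_univ, ← hd] at i2
  rw [← hd] at i1
  refine (MomLE.add hp (i1.mono (le_add_of_nonneg_right ?_))
    (i2.mono (le_add_of_nonneg_left ?_))).mono (le_of_eq ?_)
  · positivity
  · positivity
  · ring

theorem exists_noise_moment (hp : GoodKernel M M.p) (hp' : GoodKernel M M.pAux) {T : ℝ}
    (hT : 0 ≤ T) {vQ vP : M.S → ℝ × (M.S → ℝ) × (M.S → ℝ) → M.S → M.S → ℝ}
    (hvQ : ∀ s s₁ s₂, BddLip (timeDom M T) fun y => vQ s y s₁ s₂)
    (hvP : ∀ s s₁ s₂, BddLip (timeDom M T) fun y => vP s y s₁ s₂) {p : ℕ} (hp1 : 1 ≤ p) :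
    ∃ A : ℝ, 0 ≤ A ∧ ∀ N : ℕ, 1 ≤ N → ∀ {Ω : Type*} [MeasurableSpace Ω] {ℙ : Measure Ω}
      [IsProbabilityMeasure ℙ] (R : Run M m N ℙ) (j : ℕ), (j : ℝ) ≤ N * T →
      MomLE ℙ p (R.noise T vQ vP j) (A * ((N : ℝ) ^ (1 / 2 - m.bet)) ^ p) := by
  obtain ⟨b1, -, hb1, -⟩ := BddLip.uniform fun i : M.S × M.S × M.S => hvQ i.1 i.2.1 i.2.2
  obtain ⟨b2, -, hb2, -⟩ := BddLip.uniform fun i : M.S × M.S × M.S => hvP i.1 i.2.1 i.2.2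
  obtain ⟨A1, hA1⟩ : ∃ A, A = p.factorial * (2 * Real.exp (T * (4 * b1 ^ 2))) := ⟨_, rfl⟩
  obtain ⟨A2, hA2⟩ : ∃ A, A = p.factorial * (2 * Real.exp (T * (4 * b2 ^ 2))) := ⟨_, rfl⟩
  have hA10 : 0 ≤ A1 := hA1 ▸ by positivity
  have hA20 : 0 ≤ A2 := hA2 ▸ by positivity
  refine ⟨2 ^ p * ((Fintype.card M.S : ℝ) ^ p * (A1 + A2)), by positivity,
    fun N hN Ω _ ℙ _ R j hj => ?_⟩
  have h1 := fun s => R.moment_mart_le hN hp R.xi_meas R.xi_step hT (hvQ s)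
    (fun s₁ s₂ y hy => hb1 (s, s₁, s₂) y hy) hj p
  have h2 := fun s => R.moment_mart_le hN hp' R.xt_meas R.xt_step hT (hvP s)
    (fun s₁ s₂ y hy => hb2 (s, s₁, s₂) y hy) hj p
  rw [← hA1] at h1
  rw [← hA2] at h2
  obtain ⟨r, hr⟩ : ∃ r, r = ((N : ℝ) ^ (1 / 2 - m.bet)) ^ p := ⟨_, rfl⟩
  have hr0 : 0 ≤ r := hr ▸ by positivity
  rw [← hr] at h1 h2 ⊢
  have hl : A1 * r ≤ (A1 + A2) * r := mul_le_mul_of_nonneg_right (by linarith) hr0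
  have hl' : A2 * r ≤ (A1 + A2) * r := mul_le_mul_of_nonneg_right (by linarith) hr0
  have h := MomLE.add hp1 (MomLE.sum_abs hp1 fun s => (h1 s).mono hl)
    (MomLE.sum_abs hp1 fun s => (h2 s).mono hl')
  exact h.mono (le_of_eq (by ring))

/-- The distance of the actor network from its limit is bounded by the initial error and the
noise. -/
theorem exists_network_bound (hp : GoodKernel M M.p) (hp' : GoodKernel M M.pAux) {T : ℝ}
    (hT : 0 ≤ T) {Ql Pl : ℝ → M.S → ℝ} (hlim : IsLimit M m T Ql Pl) :
    ∃ vQ vP : M.S → ℝ × (M.S → ℝ) × (M.S → ℝ) → M.S → M.S → ℝ,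
      (∀ s s₁ s₂, BddLip (timeDom M T) fun y => vQ s y s₁ s₂) ∧
      (∀ s s₁ s₂, BddLip (timeDom M T) fun y => vP s y s₁ s₂) ∧ ∃ C : ℝ, 1 ≤ C ∧
      ∀ N : ℕ, 1 ≤ N → ∀ {Ω : Type*} [MeasurableSpace Ω] {ℙ : Measure Ω}
      [IsProbabilityMeasure ℙ] (R : Run M m N ℙ) (k : ℕ), (k : ℝ) ≤ N * T →
      ∀ᵐ ω ∂ℙ, min 1 (dist (R.P k ω) (Pl ((k : ℝ) / N))) ≤
        C * ((N : ℝ) ^ (m.bet - 1) + initError M m (R.init ω) + (R.noise T vQ vP k ω +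
          1 / N * ∑ j ∈ Finset.range k, R.noise T vQ vP j ω)) := by
  obtain ⟨K, hK⟩ := exists_actBound M m
  obtain ⟨K0, hK0, hν, hμ⟩ := exists_centeredLaw m
  obtain ⟨vQ, vP, hvQ, hvP, C, hC, hpath⟩ := exists_pathwise hp hp' hK hT hK0 hlim
  -- `1` settles the case of a large initial error; `2 * C` appears because `initError` is used both
  -- for the kernels and for the initial outputs.
  refine ⟨vQ, vP, hvQ, hvP, 1 + 2 * C, by linarith, fun N hN Ω _ ℙ _ R k hk => ?_⟩
  have hX1 : MeasurePreserving (fun ω => (R.init ω).1) ℙ (Measure.pi fun _ => m.nu) :=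
    measurePreserving_fst.comp R.measurePreserving_init
  have hX2 : MeasurePreserving (fun ω => (R.init ω).2) ℙ (Measure.pi fun _ => m.mu) :=
    measurePreserving_snd.comp R.measurePreserving_init
  filter_upwards [hν.ae_abs_fst_le hX1, hμ.ae_abs_fst_le hX2] with ω hω1 hω2
  have hnn := fun j => R.noise_nonneg (T := T) (vQ := vQ) (vP := vP) j ω
  have hav : 0 ≤ 1 / N * ∑ j ∈ Finset.range k, R.noise T vQ vP j ω :=
    mul_nonneg (by positivity) (Finset.sum_nonneg fun j _ => hnn j)
  have hk0 := hnn k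
  have he := (scale_pos (m := m) hN).le
  have hz0 := initError_nonneg (M := M) (m := m) (R.init ω)
  have hle := fun s s' => le_initError (M := M) (m := m) (R.init ω) s s'
  -- If the initial error exceeds `1`, the right side exceeds the cap. Otherwise the initial critic
  -- is at most `1`, as the pathwise estimate requires.
  rcases le_or_gt (initError M m (R.init ω)) 1 with hz | hz
  swap
  · refine (min_le_left _ _).trans ?_
    calc (1 : ℝ) = 1 * 1 := (one_mul 1).symm
      _ ≤ _ := mul_le_mul (by linarith) (by linarith) zero_le_one (by linarith)
  have h := hpath N hN (R.init ω) (fun j => R.xi j ω) (fun j => R.xt j ω) _ _ hω1 hω2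
    (fun s => (hle s s).1.1.trans hz) (fun s => (hle s s).1.1) (fun s => (hle s s).1.2)
    (fun s s' => (hle s s').2.1) (fun s s' => (hle s s').2.2)
    (fun k => R.Q k ω) (fun k => R.P k ω) rfl rfl (fun j => R.noise T vQ vP j ω) hnn
    (fun j hj s => by
      rw [R.sum_centered_eq hN M.p (vQ s) R.xi hj ω]
      exact (abs_le_sum_abs (fun s => 1 / N * ∑ i ∈ Finset.range j,
        martIncr R.xi (R.kap M.p R.xi) (R.val T (vQ s) R.xi) i ω) s).trans
        (le_add_of_nonneg_right (Finset.sum_nonneg fun _ _ => abs_nonneg _)))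
    (fun j hj s => by
      rw [R.sum_centered_eq hN M.pAux (vP s) R.xt hj ω]
      exact (abs_le_sum_abs (fun s => 1 / N * ∑ i ∈ Finset.range j,
        martIncr R.xt (R.kap M.pAux R.xt) (R.val T (vP s) R.xt) i ω) s).trans
        (le_add_of_nonneg_left (Finset.sum_nonneg fun _ _ => abs_nonneg _))) k hk
  refine (min_le_right _ _).trans (h.trans ?_)
  obtain ⟨V, hV⟩ : ∃ V, V = (N : ℝ) ^ (m.bet - 1) + initError M m (R.init ω) +
    (R.noise T vQ vP k ω + 1 / N * ∑ j ∈ Finset.range k, R.noise T vQ vP j ω) := ⟨_, rfl⟩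
  rw [← hV]
  calc _ ≤ C * (2 * V) := mul_le_mul_of_nonneg_left (by linarith) hC
    _ ≤ _ := by linarith

/-- The distance of the actor network from its limit, capped at `1`, has moments of the claimed
order. -/
theorem exists_network_error (hp : GoodKernel M M.p) (hp' : GoodKernel M M.pAux) {T : ℝ}
    (hT : 0 ≤ T) {Ql Pl : ℝ → M.S → ℝ} (hlim : IsLimit M m T Ql Pl) {p : ℕ} (hp1 : 1 ≤ p) :
    ∃ C : ℝ, 0 ≤ C ∧ ∀ N : ℕ, 1 ≤ N → ∀ {Ω : Type*} [MeasurableSpace Ω] {ℙ : Measure Ω}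
      [IsProbabilityMeasure ℙ] (R : Run M m N ℙ) (k : ℕ), (k : ℝ) ≤ N * T → ∃ W : Ω → ℝ,
      MomLE ℙ p W (C * (((N : ℝ) ^ (m.bet - 1)) ^ p + ((N : ℝ) ^ (1 / 2 - m.bet)) ^ p)) ∧
      ∀ᵐ ω ∂ℙ, 1 / N ≤ W ω ∧ min 1 (dist (R.P k ω) (Pl ((k : ℝ) / N))) ≤ W ω := by
  obtain ⟨vQ, vP, hvQ, hvP, C, hC, hpath⟩ := exists_network_bound hp hp' hT hlim
  obtain ⟨A1, hA1, hm1⟩ := exists_initError_moment M m hp1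
  obtain ⟨A2, hA2, hm2⟩ := exists_noise_moment (m := m) hp hp' hT hvQ hvP hp1
  have hA3 : 0 ≤ T ^ p * A2 := by positivity
  obtain ⟨B, hB⟩ : ∃ B, B = 1 + A1 + A2 + T ^ p * A2 := ⟨_, rfl⟩
  have hB0 : 0 ≤ B := by linarith
  refine ⟨C ^ p * (2 ^ p * (2 ^ p * B)), by positivity, fun N hN Ω _ ℙ _ R k hk => ?_⟩
  have hpathR := hpath N hN R k hk
  have hm1R := hm1 N hN R
  have hm2R := hm2 N hN R
  obtain ⟨e, he⟩ : ∃ e, e = (N : ℝ) ^ (m.bet - 1) := ⟨_, rfl⟩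
  have he0 : 0 ≤ e := he ▸ (scale_pos hN).le
  have hNe : 1 / N ≤ e := he ▸ inv_le_scale hN
  obtain ⟨r, hr⟩ : ∃ r, r = ((N : ℝ) ^ (1 / 2 - m.bet)) ^ p := ⟨_, rfl⟩
  have hr0 : 0 ≤ r := hr ▸ by positivity
  rw [← he] at hpathR
  rw [← hr] at hm1R hm2R
  rw [← he, ← hr]
  have hep : 0 ≤ e ^ p := by positivity
  have hle : ∀ {a : ℝ}, a ≤ B → a * r ≤ B * (e ^ p + r) := fun ha =>
    (mul_le_mul_of_nonneg_right ha hr0).trans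
      (mul_le_mul_of_nonneg_left (le_add_of_nonneg_left hep) hB0)
  have hme : MomLE ℙ p (fun _ : Ω => e) (B * (e ^ p + r)) := (MomLE.const e).mono (by
    rw [abs_of_nonneg he0]
    calc e ^ p ≤ 1 * (e ^ p + r) := by linarith
      _ ≤ _ := mul_le_mul_of_nonneg_right (by linarith) (by positivity))
  have hmA := MomLE.avg hp1 hN hk (by positivity) fun j hj =>
    hm2R j (le_trans (by exact_mod_cast hj.le) hk)
  rw [← mul_assoc] at hmA
  have hmW := (MomLE.add hp1 (MomLE.add hp1 hme (hm1R.mono (hle (by linarith))))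
    (MomLE.add hp1 ((hm2R k hk).mono (hle (by linarith)))
      (hmA.mono (hle (by linarith))))).const_mul C
  refine ⟨_, hmW.mono (le_of_eq ?_), ?_⟩
  · rw [abs_of_nonneg (zero_le_one.trans hC)]; ring
  filter_upwards [hpathR] with ω hω
  -- Since `C ≥ 1`, `W` dominates `e` and thus `1 / N`; this later absorbs the time discretization.
  refine ⟨hNe.trans ?_, hω⟩
  have hnn := fun j => R.noise_nonneg (T := T) (vQ := vQ) (vP := vP) j ω
  have hav : 0 ≤ 1 / N * ∑ j ∈ Finset.range k, R.noise T vQ vP j ω :=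
    mul_nonneg (by positivity) (Finset.sum_nonneg fun j _ => hnn j)
  have hk0 := hnn k
  have hz0 := initError_nonneg (M := M) (m := m) (R.init ω)
  refine le_trans (by linarith) (le_mul_of_one_le_left (by linarith) hC)

/-- The errors of bounded Lipschitz functionals of the time and the actor network. -/
theorem exists_errorLE (hp : GoodKernel M M.p) (hp' : GoodKernel M M.pAux) {T : ℝ}
    (hT : 0 ≤ T) {Ql Pl : ℝ → M.S → ℝ} (hlim : IsLimit M m T Ql Pl) {p : ℕ} (hp1 : 1 ≤ p)
    {Φ : ℝ × (M.S → ℝ) × (M.S → ℝ) → M.S → ℝ}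
    (hΦ : ∀ s, BddLip (timeDom M T) fun y => Φ y s) :
    ∃ C : ℝ, 0 ≤ C ∧ ∀ N : ℕ, 1 ≤ N → ∀ {Ω : Type*} [MeasurableSpace Ω] {ℙ : Measure Ω}
      [IsProbabilityMeasure ℙ] (R : Run M m N ℙ),
      ErrorLE ℙ T p (fun t ω => Φ ((⌊(N : ℝ) * t⌋₊ : ℝ) / N, 0, R.P ⌊(N : ℝ) * t⌋₊ ω))
        (fun t => Φ (t, 0, Pl t))
        (C * ((N : ℝ) ^ (p * (m.bet - 1)) + (N : ℝ) ^ (p * (1 / 2 - m.bet)))) := by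
  have := M.nonempty_S
  obtain ⟨C, hC, hW⟩ := exists_network_error hp hp' hT hlim hp1
  obtain ⟨L, hL, hb, hl⟩ := BddLip.uniform hΦ
  obtain ⟨R1, hR1⟩ := isCompact_Icc.exists_bound_of_continuousOn hlim.contQ
  obtain ⟨D, hD, hPL, -⟩ := hlim.exists_riemann hp hp' hT (abs_nonneg R1) fun t ht =>
    (hR1 t ht).trans (le_abs_self _)
  -- Covers both cases of the cap: when `W ≥ 1` the trivial bound `2 * L` is enough, and otherwise
  -- time step, motion of the limit and network error contribute `L * (2 + D) * W`.
  obtain ⟨G, hG⟩ : ∃ G, G = L * (3 + D) := ⟨_, rfl⟩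
  have hG0 : 0 ≤ G := hG ▸ by positivity
  refine ⟨G ^ p * C, by positivity, fun N hN Ω _ ℙ _ R t ht => ?_⟩
  have hN0 : (0 : ℝ) < N := by positivity
  obtain ⟨k, hk⟩ : ∃ k, k = ⌊(N : ℝ) * t⌋₊ := ⟨_, rfl⟩
  have hkt : (k : ℝ) ≤ N * t := hk ▸ Nat.floor_le (mul_nonneg hN0.le ht.1)
  have hkT : (k : ℝ) ≤ N * T := hkt.trans (mul_le_mul_of_nonneg_left ht.2 hN0.le)
  have hkN : (k : ℝ) / N ∈ Set.Icc 0 T :=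
    ⟨by positivity, by rw [div_le_iff₀ hN0, mul_comm]; exact hkT⟩
  have hdt : |(k : ℝ) / N - t| ≤ 1 / N := by
    have h1 : (N : ℝ) * t < k + 1 := hk ▸ Nat.lt_floor_add_one _
    rw [abs_le]
    constructor
    · rw [neg_le_sub_iff_le_add, ← add_div, le_div_iff₀ hN0]
      linarith
    · have : (k : ℝ) / N ≤ t := by rw [div_le_iff₀ hN0]; linarith
      have : 0 ≤ 1 / (N : ℝ) := by positivity
      linarith
  obtain ⟨W, hWm, hWle⟩ := hW N hN R k hkT
  simp only [← hk]
  obtain ⟨X, hX⟩ : ∃ X : M.S → Ω → ℝ, X = fun s ω =>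
      |Φ ((k : ℝ) / N, 0, R.P k ω) s - Φ (t, 0, Pl t) s| ^ p := ⟨_, rfl⟩
  have hXm : ∀ s, Measurable (X s) := fun s => by
    have h1 : Measurable fun ω => Φ ((k : ℝ) / N, 0, R.P k ω) s :=
      ((hΦ s).measurable_slice hkN).comp
        (measurable_const.prodMk ((R.P_measurable k).mono (R.F.le k) le_rfl))
    rw [hX]
    exact (continuous_abs.measurable.comp (h1.sub_const _)).pow_const p
  have hXle : ∀ᵐ ω ∂ℙ, ⨆ s, X s ω ≤ G ^ p * |W ω| ^ p := by
    filter_upwards [hWle] with ω ⟨hω1, hω2⟩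
    refine ciSup_le fun s => ?_
    rw [hX, ← mul_pow]
    refine pow_le_pow_left₀ (abs_nonneg _) ?_ _
    refine le_trans ?_ (mul_le_mul_of_nonneg_left (le_abs_self (W ω)) hG0)
    have hd1 : |Φ ((k : ℝ) / N, 0, R.P k ω) s - Φ (t, 0, Pl t) s| ≤
        L * (1 / N + D * (1 / N) + dist (R.P k ω) (Pl ((k : ℝ) / N))) := by
      refine (hl s _ hkN _ ht).trans (mul_le_mul_of_nonneg_left ?_ hL)
      have h1 := dist_triangle (R.P k ω) (Pl ((k : ℝ) / N)) (Pl t)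
      have h2 := (hPL _ hkN _ ht).trans (mul_le_mul_of_nonneg_left hdt hD)
      have h3 : 0 ≤ 1 / (N : ℝ) := by positivity
      have h4 := dist_nonneg (x := R.P k ω) (y := Pl ((k : ℝ) / N))
      have h5 : 0 ≤ D * (1 / N) := by positivity
      rw [Prod.dist_eq, Prod.dist_eq, dist_self, Real.dist_eq]
      refine max_le (by linarith) (max_le (by linarith) (by linarith))
    have hd2 : |Φ ((k : ℝ) / N, 0, R.P k ω) s - Φ (t, 0, Pl t) s| ≤ 2 * L := by
      refine (abs_sub _ _).trans ?_
      have h1 := hb s _ (show ((k : ℝ) / N, (0 : M.S → ℝ), R.P k ω) ∈ timeDom M T from hkN)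
      have h2 := hb s _ (show (t, (0 : M.S → ℝ), Pl t) ∈ timeDom M T from ht)
      linarith
    have hW0 : 0 ≤ W ω := le_trans (by positivity) hω1
    rw [hG]
    rcases min_le_iff.1 hω2 with h | h
    · refine hd2.trans ?_
      calc 2 * L ≤ L * (3 + D) * 1 := by nlinarith
        _ ≤ _ := mul_le_mul_of_nonneg_left h (by positivity)
    · refine hd1.trans ?_
      rw [mul_assoc]
      refine mul_le_mul_of_nonneg_left ?_ hL
      have := mul_le_mul_of_nonneg_left hω1 hD
      linarith
  have hint := hWm.2.1.const_mul (G ^ p)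
  have hI : Integrable (fun ω => ⨆ s, X s ω) ℙ := by
    refine hint.mono' (Measurable.iSup hXm).aestronglyMeasurable ?_
    filter_upwards [hXle] with ω hω
    rw [Real.norm_of_nonneg (Real.iSup_nonneg fun s => by rw [hX]; positivity)]
    exact hω
  have hfin : ∫ ω, (⨆ s, X s ω) ∂ℙ ≤
      G ^ p * C * ((N : ℝ) ^ (p * (m.bet - 1)) + (N : ℝ) ^ (p * (1 / 2 - m.bet))) := by
    refine (integral_mono_ae hI hint hXle).trans ?_
    rw [integral_const_mul, mul_assoc]
    refine mul_le_mul_of_nonneg_left (hWm.2.2.trans (le_of_eq ?_)) (by positivity)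
    rw [mul_comm (p : ℝ), mul_comm (p : ℝ), Real.rpow_mul_natCast hN0.le,
      Real.rpow_mul_natCast hN0.le]
  rw [hX] at hI hfin
  exact ⟨hI, hfin⟩

theorem ErrorLE.mono {E : Type*} [Fintype E] {Ω : Type*} [MeasurableSpace Ω] {ℙ : Measure Ω}
    {T : ℝ} {p : ℕ} {Y : ℝ → Ω → E → ℝ} {y : ℝ → E → ℝ} {b b' : ℝ} (h : ErrorLE ℙ T p Y y b)
    (hb : b ≤ b') : ErrorLE ℙ T p Y y b' := fun t ht =>
  ⟨(h t ht).1, (h t ht).2.trans hb⟩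

/-- All four quantities are bounded Lipschitz in time and actor network, with no dependence on the
critic, whose slot is filled with `0`. The constant is chosen before the probability space and the
run. -/
theorem exists_allErrorsLE (hp : GoodKernel M M.p) (hp' : GoodKernel M M.pAux) {T : ℝ}
    (hT : 0 ≤ T) {Ql Pl : ℝ → M.S → ℝ} (hlim : IsLimit M m T Ql Pl) {p : ℕ} (hp1 : 1 ≤ p) :
    ∃ C : ℝ, ∀ N : ℕ, 1 ≤ N → ∀ {Ω : Type*} [MeasurableSpace Ω] {ℙ : Measure Ω}
      [IsProbabilityMeasure ℙ] (R : Run M m N ℙ), R.AllErrorsLE Pl T p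
        (C * ((N : ℝ) ^ (p * (m.bet - 1)) + (N : ℝ) ^ (p * (1 / 2 - m.bet)))) := by
  obtain ⟨C1, h10, h1⟩ := exists_errorLE hp hp' hT hlim hp1
    (Φ := fun y => M.softmax y.2.2) fun s => softmax_bddLip s
  obtain ⟨C2, h20, h2⟩ := exists_errorLE hp hp' hT hlim hp1 (Φ := polY M) fun s => polY_bddLip s
  obtain ⟨C3, h30, h3⟩ := exists_errorLE hp hp' hT hlim hp1
    (Φ := fun y => stationary (M.trans M.p (polY M y))) fun s => stationary_polY_bddLip hp s
  obtain ⟨C4, h40, h4⟩ := exists_errorLE hp hp' hT hlim hp1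
    (Φ := fun y => stationary (M.trans M.pAux (polY M y))) fun s => stationary_polY_bddLip hp' s
  refine ⟨C1 + C2 + C3 + C4, fun N hN Ω _ ℙ _ R => ?_⟩
  have h0 : 0 ≤ (N : ℝ) ^ (p * (m.bet - 1)) + (N : ℝ) ^ (p * (1 / 2 - m.bet)) := by positivity
  exact ⟨ErrorLE.mono (h1 N hN R) (mul_le_mul_of_nonneg_right (by linarith) h0),
    ErrorLE.mono (h2 N hN R) (mul_le_mul_of_nonneg_right (by linarith) h0),
    ErrorLE.mono (h3 N hN R) (mul_le_mul_of_nonneg_right (by linarith) h0),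
    ErrorLE.mono (h4 N hN R) (mul_le_mul_of_nonneg_right (by linarith) h0)⟩

theorem Run.AllErrorsLE.mono {N : ℕ} {Ω : Type*} [MeasurableSpace Ω] {ℙ : Measure Ω}
    {R : Run M m N ℙ} {Pl : ℝ → M.S → ℝ} {T : ℝ} {p : ℕ} {b b' : ℝ}
    (h : R.AllErrorsLE Pl T p b) (hb : b ≤ b') : R.AllErrorsLE Pl T p b' :=
  ⟨h.1.mono hb, h.2.1.mono hb, h.2.2.1.mono hb, h.2.2.2.mono hb⟩

theorem tendsto_rate (m : Model dx da) {p : ℕ} (hp1 : 1 ≤ p) (C : ℝ) :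
    Tendsto (fun N : ℕ => C * ((N : ℝ) ^ (p * (m.bet - 1)) + (N : ℝ) ^ (p * (1 / 2 - m.bet))))
      atTop (𝓝 0) := by
  have hp0 : (0 : ℝ) < p := by positivity
  have h : ∀ x : ℝ, x < 0 → Tendsto (fun N : ℕ => (N : ℝ) ^ (p * x)) atTop (𝓝 0) := by
    intro x hx
    have := (tendsto_rpow_neg_atTop (y := -(p * x))
      (neg_pos.2 (mul_neg_of_pos_of_neg hp0 hx))).comp (tendsto_natCast_atTop_atTop (R := ℝ))
    simpa [Function.comp_def] using this
  simpa using ((h _ (sub_neg.2 m.bet_mem.2)).add (h _ (sub_neg.2 m.bet_mem.1))).const_mul C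

end Convergence

end ActorCritic

end

theorem proposition1 {dx da : ℕ} (M : ActorCritic.MDP dx da) (m : ActorCritic.Model dx da)
    (hErg : M.Ergodic) (hLip : M.StationaryLipschitz) (T : ℝ) (hT : 0 < T) :
    (∃ Q P : ℝ → M.S → ℝ, ActorCritic.IsLimit M m T Q P) ∧
    ∀ Q P : ℝ → M.S → ℝ, ActorCritic.IsLimit M m T Q P → ∀ p : ℕ, 1 ≤ p →
      (∀ ε > 0, ∃ N₀ : ℕ, ∀ N > N₀, ∀ (Ω : Type*) [MeasurableSpace Ω]
        (ℙ : MeasureTheory.Measure Ω) [MeasureTheory.IsProbabilityMeasure ℙ]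
        (R : ActorCritic.Run M m N ℙ), R.AllErrorsLE P T p ε) ∧
      (∃ (C : ℝ) (N₀ : ℕ), ∀ N > N₀, ∀ (Ω : Type*) [MeasurableSpace Ω]
        (ℙ : MeasureTheory.Measure Ω) [MeasureTheory.IsProbabilityMeasure ℙ]
        (R : ActorCritic.Run M m N ℙ), R.AllErrorsLE P T p
          (C * ((N : ℝ) ^ (p * (m.bet - 1)) + (N : ℝ) ^ (p * (1 / 2 - m.bet))))) := by
  have hp := ActorCritic.GoodKernel.p hErg hLip
  have hp' := ActorCritic.GoodKernel.pAux hErg hLip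
  refine ⟨ActorCritic.exists_isLimit hp hp' hT.le, fun Q P hlim p hp1 => ⟨fun ε hε => ?_, ?_⟩⟩
  · obtain ⟨C, hC⟩ := ActorCritic.exists_allErrorsLE hp hp' hT.le hlim hp1
    obtain ⟨N₀, hN₀⟩ := Filter.eventually_atTop.1
      ((ActorCritic.tendsto_rate m hp1 C).eventually (gt_mem_nhds hε))
    refine ⟨N₀, fun N hN Ω _ ℙ _ R => ?_⟩
    exact (hC N (Nat.one_le_of_lt hN) R).mono (hN₀ N hN.le).le
  · obtain ⟨C, hC⟩ := ActorCritic.exists_allErrorsLE hp hp' hT.le hlim hp1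
    -- The estimate holds from `N = 1` on, so the threshold is `0`.
    exact ⟨C, 0, fun N hN Ω _ ℙ _ R => hC N hN R⟩
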